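/- **Conventions.** An operator space $E$ is a complex Banach space with norms on all $M_n(E)$ satisfying Ruan's axioms. A linear map $T$ has $\|T\|_{cb}=\sup_n\|\mathrm{id}_{M_n}\otimes T\|$, and $E$, $E'$ are completely isomorphic with constant $C$ if there is a linear bijection $T:E\to E'$ with $\|T\|_{cb}\|T^{-1}\|_{cb}\le C$. $E$ is $h$-homogeneous if every bounded linear $T:E\to E$ satisfies $\|T\|_{cb}\le h\|T\|$, and $\mu$-Hilbertian if there is an isomorphism $\varphi$ of $E$ onto a Hilbert space with $\|\varphi\|\,\|\varphi^{-1}\|\le\mu$. $X\oplus Y$ is the direct sum with $\|(x,y)\|_{M_n(X\oplus Y)}=\max(\|x\|_{M_n(X)},\|y\|_{M_n(Y)})$, and $QS(X\oplus Y)$ is the class of operator spaces that are completely isometric to a quotient (by a closed subspace) of a closed subspace of $X\oplus Y$. Let $X$, $Y$ be separable infinite-dimensional Hilbertian operator spaces, homogeneous with constants $h_X,h_Y$ and Hilbertian with constants $\mu_X,\mu_Y$. Identify both with $\ell_2$ through isomorphisms $\varphi:X\to\ell_2$, $\psi:Y\to\ell_2$ with $\|\varphi\|\|\varphi^{-1}\|\le\mu_X$,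 $\|\psi\|\|\psi^{-1}\|\le\mu_Y$. For positive sequences $u_c=(u_c(j))_{j\in\mathbb N}$, $u_r=(u_r(j))_{j\in\mathbb N}$ with $$\sum_j\min(u_c(j),u_r(j))<\infty \tag{W}$$ let $\ell_2(u_c;X)^X$ be the Hilbert space $\ell_2(u_c;\ell_2)$ (norm $(\sum_j u_c(j)\|a(j)\|^2)^{1/2}$), identified with $\ell_2$ by the unitary that absorbs the weight and enumerates $\mathbb N\times\mathbb N$, and equipped with the operator space structure of $X$; define $\ell_2(u_r;Y)^Y$ in the same way. $K_{u_c,u_r}(X,Y)$ is the space of constant sequences in $\ell_2(u_c;X)^X+\ell_2(u_r;Y)^Y$: as a vector space it is $\ell_2$, and for $v\in M_n(\ell_2)$ $$\|v\|_{M_n(K_{u_c,u_r}(X,Y))}=\inf\max\bigl(\|a\|_{M_n(\ell_2(u_c;X)^X)},\|b\|_{M_n(\ell_2(u_r;Y)^Y)}\bigr),$$ the infimum being over all $a,b$ with $v=a(j)+b(j)$ for every $j$. For $\lambda,\gamma\ge0$ the intersection $\lambda X\cap\gamma Y\cap K_{u_c,u_r}(X,Y)$ is $\ell_2$ with the matrix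 norms $$\max\bigl(\lambda\|\varphi^{-1}v\|_{M_n(X)},\ \gamma\|\psi^{-1}v\|_{M_n(Y)},\ \|v\|_{M_n(K_{u_c,u_r}(X,Y))}\bigr);$$ a term with $\lambda=0$ or $\gamma=0$ is thus omitted. **Theorem 2.9.** Let $F$ be an infinite-dimensional $h_F$-homogeneous operator space in $QS(X\oplus Y)$. Then there are constants $\lambda,\gamma\in[0,1]$ and positive sequences $u_c,u_r$ satisfying (W) such that $F$ is completely isomorphic to $\lambda X\cap\gamma Y\cap K_{u_c,u_r}(X,Y)$ with a constant $C$ that depends only on $h_X,h_Y,h_F,\mu_X,\mu_Y$. More generally, if $F$ is only completely isomorphic, with constant $\kappa$, to a space in $QS(X\oplus Y)$, the same holds with $C$ depending also on $\kappa$. -/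

import Mathlib

noncomputable section

/-- A family of functions `M_n(V) → ℝ`, one for every matrix size `n`. -/
abbrev MatrixNorms (V : Type*) := (n : ℕ) → Matrix (Fin n) (Fin n) V → ℝ

/-- The operator norm of a rectangular scalar matrix acting between Euclidean spaces. -/
def scalarOpNorm {m n : ℕ} (α : Matrix (Fin m) (Fin n) ℂ) : ℝ :=
  ‖LinearMap.toContinuousLinearMap (Matrix.toEuclideanLin α)‖

/-- The product `α x β` of a vector-valued matrix `x` with scalar matrices `α`, `β`. -/
def scalarMulMul {V : Type*} [AddCommGroup V] [Module ℂ V] {m n : ℕ}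
    (α : Matrix (Fin n) (Fin m) ℂ) (x : Matrix (Fin m) (Fin m) V)
    (β : Matrix (Fin m) (Fin n) ℂ) : Matrix (Fin n) (Fin n) V :=
  Matrix.of fun i j => ∑ k, ∑ l, (α i k * β l j) • x k l

/-- The block-diagonal matrix `x ⊕ y`. -/
def matrixDirectSum {V : Type*} [Zero V] {m n : ℕ}
    (x : Matrix (Fin m) (Fin m) V) (y : Matrix (Fin n) (Fin n) V) :
    Matrix (Fin (m + n)) (Fin (m + n)) V :=
  Matrix.reindex finSumFinEquiv finSumFinEquiv (Matrix.fromBlocks x 0 0 y)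

/-- An operator space structure (in the sense of Ruan's axioms) on a normed space `E`: matrix norms
on all `M_n(E)`, extending the norm of `E = M_1(E)`, such that `‖x ⊕ y‖ = max ‖x‖ ‖y‖` and
`‖α x β‖ ≤ ‖α‖ ‖x‖ ‖β‖` for scalar matrices `α`, `β`. (Definiteness of the matrix norms follows
from that of the norm of `E`.) -/
class OperatorSpace (E : Type*) [NormedAddCommGroup E] [NormedSpace ℂ E] where
  mnorm : MatrixNorms E
  mnorm_one : ∀ x : Matrix (Fin 1) (Fin 1) E, mnorm 1 x = ‖x 0 0‖
  mnorm_add_le : ∀ (n : ℕ) (x y : Matrix (Fin n) (Fin n) E),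
    mnorm n (x + y) ≤ mnorm n x + mnorm n y
  mnorm_smul : ∀ (n : ℕ) (c : ℂ) (x : Matrix (Fin n) (Fin n) E),
    mnorm n (c • x) = ‖c‖ * mnorm n x
  mnorm_directSum : ∀ (m n : ℕ) (x : Matrix (Fin m) (Fin m) E) (y : Matrix (Fin n) (Fin n) E),
    mnorm (m + n) (matrixDirectSum x y) = max (mnorm m x) (mnorm n y)
  mnorm_scalarMulMul_le : ∀ (m n : ℕ) (α : Matrix (Fin n) (Fin m) ℂ)
    (x : Matrix (Fin m) (Fin m) E) (β : Matrix (Fin m) (Fin n) ℂ),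
    mnorm n (scalarMulMul α x β) ≤ scalarOpNorm α * mnorm m x * scalarOpNorm β

/-- `(V, N)` and `(W, N')` are completely isomorphic with constant `C`: there is a linear bijection
`T : V → W` with `‖T‖_cb ‖T⁻¹‖_cb ≤ C`. -/
def CompletelyIsomorphic (C : ℝ) {V W : Type*} [AddCommGroup V] [Module ℂ V] [AddCommGroup W]
    [Module ℂ W] (N : MatrixNorms V) (N' : MatrixNorms W) : Prop :=
  ∃ (T : V ≃ₗ[ℂ] W) (A B : ℝ), 0 ≤ A ∧ 0 ≤ B ∧ A * B ≤ C ∧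
    (∀ (n : ℕ) (x : Matrix (Fin n) (Fin n) V), N' n (x.map T) ≤ A * N n x) ∧
    (∀ (n : ℕ) (y : Matrix (Fin n) (Fin n) W), N n (y.map T.symm) ≤ B * N' n y)

/-- `E` is `h`-homogeneous: every bounded `T : E → E` has `‖T‖_cb ≤ h ‖T‖`. -/
def IsHomogeneous (h : ℝ) (E : Type*) [NormedAddCommGroup E] [NormedSpace ℂ E]
    [OperatorSpace E] : Prop :=
  ∀ (T : E →L[ℂ] E) (n : ℕ) (x : Matrix (Fin n) (Fin n) E),
    OperatorSpace.mnorm n (x.map T) ≤ h * ‖T‖ * OperatorSpace.mnorm n x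

/-- The matrix norms of the direct sum `X ⊕_∞ Y`. -/
def directSumNorms {V W : Type*} (N : MatrixNorms V) (N' : MatrixNorms W) :
    MatrixNorms (V × W) :=
  fun n z => max (N n (z.map Prod.fst)) (N' n (z.map Prod.snd))

/-- The matrix norms of a subspace. -/
def subspaceNorms {V : Type*} [AddCommGroup V] [Module ℂ V] (N : MatrixNorms V)
    (S : Submodule ℂ V) : MatrixNorms S :=
  fun n x => N n (x.map Subtype.val)

/-- The matrix norms of a quotient: `M_n(V ⧸ K)` carries the quotient norm of `M_n(V)`. -/
def quotientNorms {V : Type*} [AddCommGroup V] [Module ℂ V] (N : MatrixNorms V)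
    (K : Submodule ℂ V) : MatrixNorms (V ⧸ K) :=
  fun n z => sInf {r : ℝ | ∃ x : Matrix (Fin n) (Fin n) V, x.map K.mkQ = z ∧ N n x = r}

/-- `F` belongs to `QS(X ⊕ Y)`, up to a complete isomorphism of constant `κ`: it is completely
`κ`-isomorphic to a quotient, by a closed subspace, of a closed subspace of `X ⊕_∞ Y`. -/
def MemQSDirectSum (κ : ℝ) (F X Y : Type*)
    [NormedAddCommGroup F] [NormedSpace ℂ F] [OperatorSpace F]
    [NormedAddCommGroup X] [NormedSpace ℂ X] [OperatorSpace X]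
    [NormedAddCommGroup Y] [NormedSpace ℂ Y] [OperatorSpace Y] : Prop :=
  ∃ S : Submodule ℂ (X × Y), IsClosed (S : Set (X × Y)) ∧
    ∃ K : Submodule ℂ S, IsClosed (K : Set S) ∧
      CompletelyIsomorphic κ (OperatorSpace.mnorm (E := F))
        (quotientNorms (subspaceNorms
          (directSumNorms (OperatorSpace.mnorm (E := X)) (OperatorSpace.mnorm (E := Y))) S) K)

/-- The Hilbert space `ℓ₂` of square summable complex sequences. -/
abbrev Ell2 : Type := lp (fun _ : ℕ => ℂ) 2

/-- The weighted space `ℓ₂(u; ℓ₂)` of the sequences `f : ℕ → ℓ₂` with `∑ⱼ u(j) ‖f(j)‖² < ∞`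
(for a positive weight `u`). -/
def WeightedEll2 (u : ℕ → ℝ) : Type :=
  {f : ℕ → Ell2 // Summable fun j => u j * ‖f j‖ ^ 2}

theorem memℓp_flatten (u : ℕ → ℝ) (f : WeightedEll2 u) :
    Memℓp (fun m : ℕ => ((Real.sqrt (u m.unpair.1) : ℝ) : ℂ) * f.1 m.unpair.1 m.unpair.2) 2 := by
  have h2 : (0 : ℝ) < (2 : ENNReal).toReal := by norm_num
  have hs : ∀ j : ℕ, HasSum (fun k => ‖f.1 j k‖ ^ 2) (‖f.1 j‖ ^ 2) := by
    intro j
    have := lp.hasSum_norm h2 (f.1 j)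
    simpa using this
  have hp : Summable fun p : ℕ × ℕ =>
      ‖((Real.sqrt (u p.1) : ℝ) : ℂ) * f.1 p.1 p.2‖ ^ 2 := by
    have key : ∀ j k : ℕ, ‖((Real.sqrt (u j) : ℝ) : ℂ) * f.1 j k‖ ^ 2
        = Real.sqrt (u j) ^ 2 * ‖f.1 j k‖ ^ 2 := by
      intro j k
      rw [norm_mul, mul_pow, Complex.norm_real, Real.norm_eq_abs, sq_abs]
    refine (summable_prod_of_nonneg (fun _ => by positivity)).mpr ⟨fun j => ?_, ?_⟩
    · simp only [key]
      exact (hs j).summable.mul_left _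
    · simp only [key, tsum_mul_left, (hs _).tsum_eq]
      refine Summable.of_nonneg_of_le (fun j => by positivity) (fun j => ?_) f.2.abs
      rw [abs_mul, abs_of_nonneg (sq_nonneg ‖f.1 j‖)]
      refine mul_le_mul_of_nonneg_right ?_ (sq_nonneg _)
      rcases le_total 0 (u j) with h | h
      · rw [Real.sq_sqrt h]
        exact le_abs_self _
      · rw [Real.sqrt_eq_zero_of_nonpos h]
        simp
  refine memℓp_gen ?_
  have h3 : Summable fun m : ℕ =>
      ‖((Real.sqrt (u m.unpair.1) : ℝ) : ℂ) * f.1 m.unpair.1 m.unpair.2‖ ^ 2 :=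
    (Nat.pairEquiv.symm.summable_iff
      (f := fun p : ℕ × ℕ => ‖((Real.sqrt (u p.1) : ℝ) : ℂ) * f.1 p.1 p.2‖ ^ 2)).mpr hp
  simpa only [ENNReal.toReal_ofNat, Real.rpow_ofNat] using h3

/-- The unitary `ℓ₂(u; ℓ₂) → ℓ₂(ℕ × ℕ) → ℓ₂` obtained by absorbing the positive weight `u` and
enumerating `ℕ × ℕ` by the pairing function `ℕ → ℕ × ℕ`, `m ↦ (m.unpair.1, m.unpair.2)`. -/
def flatten (u : ℕ → ℝ) (f : WeightedEll2 u) : Ell2 :=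
  ⟨fun m => ((Real.sqrt (u m.unpair.1) : ℝ) : ℂ) * f.1 m.unpair.1 m.unpair.2, memℓp_flatten u f⟩

/-- Let `φ : X → ℓ₂` be an isomorphism. These are the matrix norms on `ℓ₂` obtained by regarding
`ℓ₂` as the operator space `X`. -/
def transportedNorms {X : Type*} [NormedAddCommGroup X] [NormedSpace ℂ X] [OperatorSpace X]
    (φ : X ≃L[ℂ] Ell2) : MatrixNorms Ell2 :=
  fun n v => OperatorSpace.mnorm n (v.map φ.symm)

/-- The matrix norms of `ℓ₂(u; X)^X`: the Hilbert space `ℓ₂(u; ℓ₂)`, identified with `ℓ₂` by a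
unitary, carries the operator space structure of `X`. (When `X` is homogeneous, another choice of
the unitary gives completely isomorphic matrix norms, with a constant controlled by the homogeneity
and Hilbertian constants of `X`.) -/
def weightedNorms {X : Type*} [NormedAddCommGroup X] [NormedSpace ℂ X] [OperatorSpace X]
    (φ : X ≃L[ℂ] Ell2) (u : ℕ → ℝ) : MatrixNorms (WeightedEll2 u) :=
  fun n a => transportedNorms φ n (a.map (flatten u))

/-- The matrix norms of `K_{u_c, u_r}(X, Y)`, the space of constant sequences in the sum
`ℓ₂(u_c; X)^X + ℓ₂(u_r; Y)^Y`. The constant sequence `v, v, …` is identified with `v`, and the norm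
of `v ∈ M_n(ℓ₂)` is the infimum of `max ‖a‖ ‖b‖` over all decompositions `v = a(j) + b(j)`,
`j ∈ ℕ`, with `a ∈ M_n(ℓ₂(u_c; X)^X)` and `b ∈ M_n(ℓ₂(u_r; Y)^Y)`. -/
def constNorms {X Y : Type*}
    [NormedAddCommGroup X] [NormedSpace ℂ X] [OperatorSpace X]
    [NormedAddCommGroup Y] [NormedSpace ℂ Y] [OperatorSpace Y]
    (φ : X ≃L[ℂ] Ell2) (ψ : Y ≃L[ℂ] Ell2) (uc ur : ℕ → ℝ) : MatrixNorms Ell2 :=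
  fun n v => sInf {r : ℝ |
    ∃ (a : Matrix (Fin n) (Fin n) (WeightedEll2 uc)) (b : Matrix (Fin n) (Fin n) (WeightedEll2 ur)),
      (∀ p q j, v p q = (a p q).1 j + (b p q).1 j) ∧
      max (weightedNorms φ uc n a) (weightedNorms ψ ur n b) = r}

/-- The matrix norms of the intersection `s X ∩ t Y ∩ K_{u_c, u_r}(X, Y)`, where `X` and `Y` are
identified with `ℓ₂` by `φ` and `ψ`. If `s = 0` or `t = 0`, the corresponding term is absent from
the maximum, that is, the space `s X` or `t Y` is omitted from the intersection. -/
def interNorms {X Y : Type*}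
    [NormedAddCommGroup X] [NormedSpace ℂ X] [OperatorSpace X]
    [NormedAddCommGroup Y] [NormedSpace ℂ Y] [OperatorSpace Y]
    (φ : X ≃L[ℂ] Ell2) (ψ : Y ≃L[ℂ] Ell2) (s t : ℝ) (uc ur : ℕ → ℝ) : MatrixNorms Ell2 :=
  fun n v => max (max (s * transportedNorms φ n v) (t * transportedNorms ψ n v))
    (constNorms φ ψ uc ur n v)

end

/-! Write `F` as `S ⧸ K` with `K ⊆ S ⊆ X ⊕ Y`. After rescaling the two identifications by `a` and
`c`, the Banach space `X ⊕ Y` becomes the Hilbert space `ℓ₂ ⊕ ℓ₂`, the quotient by `K` becomes the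
orthogonal complement `L` of `K`, and `S ⧸ K` becomes the range of an isometry `V : ℓ₂ → L`. The
compressions `J₁`, `J₂` of the coordinate embeddings to `L` satisfy `J₁ J₁* + J₂ J₂* = 1`, and the
norm of `v` is the infimum of `max ‖x‖ ‖y‖` over the lifts `a J₁ x + c J₂ y = V v`
(`exists_liftNorm_model`). Everything is thus governed by one operator `0 ≤ B = J₁ J₁* ≤ 1` and the
position of `V` in its spectral decomposition: where `B` is about `t`, `J₁` acts like `√t` and `J₂`
like `√(1 - t)`.

Homogeneity of `F` means that only the behaviour of `V` at infinity matters. By compactness there is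
an asymptotic spectral distribution (`exists_asymptotic_form`), realised up to small errors by an
orthonormal sequence `w i` such that the `V (w i)` have mutually orthogonal orbits. Moving the
standard basis to the `w i` costs a factor `h` in each direction. In the resulting picture `V v` is
the constant function `v` in `L²(μ; ℓ₂)` for a measure `μ` on `[0, 1]`, and a lift is a
decomposition `v = a √t x(t) + c √(1 - t) y(t)`.

Cut `(0, 1)` into pieces on which `t / (1 - t)` is about `2 ^ k`; there `t` and `1 - t` are constant
up to a factor. With `m k` the mass of the piece and `t k` its node, the lift becomes a
decomposition of the constant sequence `v` for the weights `m k / (a² t k)` and `m k / (c² (1 - t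
k))`. Since `t k` or `1 - t k` is at least `1/2` and the masses are summable, (W) holds. At `t = 1`
only `x` can lift, and at `t = 0` only `y`; the masses there produce the terms `s X` and `t Y`.

The passage between lifts and weighted sequences is made by operators of `ℓ₂` with absolutely
bounded norms, so that homogeneity of `X` and `Y` controls all matrix norms at once. Their norms
reduce, by functional calculus, to scalar inequalities on `[0, 1]`. The comparison of norms consists
of `end_bound`, `exists_const_decomposition` and `norm_le_of_const_decomposition`, assembled in
`exists_interNorm_equivalent`. -/

/-- A function on `M_n(ℓ₂)` that is subadditive and nonnegative, is comparable with the entries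
and is `h`-homogeneous with respect to the bounded operators of `ℓ₂`. -/
structure TameNorm {n : ℕ} (h : ℝ) (N : Matrix (Fin n) (Fin n) Ell2 → ℝ) : Prop where
  const_nonneg : 0 ≤ h
  nonneg : ∀ x, 0 ≤ N x
  add_le : ∀ x y, N (x + y) ≤ N x + N y
  upper : ∃ c, 0 ≤ c ∧ ∀ x, N x ≤ c * ∑ p, ∑ q, ‖x p q‖
  lower : ∃ c, 0 ≤ c ∧ ∀ x p q, ‖x p q‖ ≤ c * N x
  hom : ∀ (T : Ell2 →L[ℂ] Ell2) x, N (x.map T) ≤ h * ‖T‖ * N x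

/-! ### Elementary consequences of Ruan's axioms. -/

section MatrixNormsOfOperatorSpaces

variable {E : Type*} [NormedAddCommGroup E] [NormedSpace ℂ E] [OperatorSpace E]

open OperatorSpace

theorem mnorm_zero (n : ℕ) : mnorm n (0 : Matrix (Fin n) (Fin n) E) = 0 := by
  simpa using mnorm_smul n (0 : ℂ) (0 : Matrix (Fin n) (Fin n) E)

theorem mnorm_nonneg {n : ℕ} (x : Matrix (Fin n) (Fin n) E) : 0 ≤ mnorm n x := by
  have h1 := mnorm_add_le n x ((-1 : ℂ) • x)
  rw [mnorm_smul] at h1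
  have h2 : x + (-1 : ℂ) • x = 0 := by ext i j; simp
  rw [h2, mnorm_zero] at h1
  norm_num at h1
  linarith

theorem mnorm_sum_le {ι : Type*} (n : ℕ) (s : Finset ι) (x : ι → Matrix (Fin n) (Fin n) E) :
    mnorm n (∑ i ∈ s, x i) ≤ ∑ i ∈ s, mnorm n (x i) := by
  classical
  induction s using Finset.induction_on with
  | empty => simp [mnorm_zero]
  | insert a s ha ih =>
    rw [Finset.sum_insert ha, Finset.sum_insert ha]
    exact (mnorm_add_le _ _ _).trans (by linarith)

/-- A matrix is the sum of its entries placed by rank-one scalar factors. The constants in this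
bound and the next depend on `n`; they serve only for limits at fixed `n` and never enter the final
constant. -/
theorem exists_mnorm_le_sum_norm (n : ℕ) :
    ∃ c : ℝ, 0 ≤ c ∧ ∀ x : Matrix (Fin n) (Fin n) E, mnorm n x ≤ c * ∑ p, ∑ q, ‖x p q‖ := by
  let α : Fin n → Matrix (Fin n) (Fin 1) ℂ := fun p => Matrix.of fun i _ => if i = p then 1 else 0
  let β : Fin n → Matrix (Fin 1) (Fin n) ℂ := fun p => Matrix.of fun _ i => if i = p then 1 else 0
  refine ⟨∑ p, ∑ q, scalarOpNorm (α p) * scalarOpNorm (β q),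
    Finset.sum_nonneg fun p _ => Finset.sum_nonneg fun q _ =>
      mul_nonneg (norm_nonneg _) (norm_nonneg _), fun x => ?_⟩
  have hx : x = ∑ p, ∑ q, scalarMulMul (α p) (Matrix.of fun _ _ : Fin 1 => x p q) (β q) := by
    ext i j
    simp [Matrix.sum_apply, scalarMulMul, α, β, ← ite_and]
    simp [ite_and]
  have key : ∀ p q, mnorm n (scalarMulMul (α p) (Matrix.of fun _ _ : Fin 1 => x p q) (β q))
      ≤ (∑ p, ∑ q, scalarOpNorm (α p) * scalarOpNorm (β q)) * ‖x p q‖ := by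
    intro p q
    refine (mnorm_scalarMulMul_le 1 n _ _ _).trans ?_
    rw [mnorm_one, mul_right_comm]
    refine mul_le_mul_of_nonneg_right ?_ (norm_nonneg _)
    refine (Finset.single_le_sum (f := fun q => scalarOpNorm (α p) * scalarOpNorm (β q))
      (fun q _ => mul_nonneg (norm_nonneg _) (norm_nonneg _)) (Finset.mem_univ q)).trans ?_
    exact Finset.single_le_sum (f := fun p => ∑ q, scalarOpNorm (α p) * scalarOpNorm (β q))
      (fun p _ => Finset.sum_nonneg fun q _ => mul_nonneg (norm_nonneg _) (norm_nonneg _))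
      (Finset.mem_univ p)
  conv_lhs => rw [hx]
  rw [Finset.mul_sum]
  refine (mnorm_sum_le _ _ _).trans (Finset.sum_le_sum fun p _ => ?_)
  rw [Finset.mul_sum]
  exact (mnorm_sum_le _ _ _).trans (Finset.sum_le_sum fun q _ => key p q)

theorem exists_norm_apply_le_mnorm (n : ℕ) :
    ∃ c : ℝ, 0 ≤ c ∧ ∀ (x : Matrix (Fin n) (Fin n) E) p q, ‖x p q‖ ≤ c * mnorm n x := by
  let α : Fin n → Matrix (Fin n) (Fin 1) ℂ := fun p => Matrix.of fun i _ => if i = p then 1 else 0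
  let β : Fin n → Matrix (Fin 1) (Fin n) ℂ := fun p => Matrix.of fun _ i => if i = p then 1 else 0
  refine ⟨∑ p, ∑ q, scalarOpNorm (β p) * scalarOpNorm (α q),
    Finset.sum_nonneg fun p _ => Finset.sum_nonneg fun q _ =>
      mul_nonneg (norm_nonneg _) (norm_nonneg _), fun x p q => ?_⟩
  have h1 := mnorm_scalarMulMul_le n 1 (β p) x (α q)
  rw [mnorm_one] at h1
  have h2 : scalarMulMul (β p) x (α q) 0 0 = x p q := by
    simp [scalarMulMul, α, β]
  rw [h2, mul_right_comm] at h1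
  refine h1.trans (mul_le_mul_of_nonneg_right ?_ (mnorm_nonneg _))
  refine (Finset.single_le_sum (f := fun q => scalarOpNorm (β p) * scalarOpNorm (α q))
      (fun q _ => mul_nonneg (norm_nonneg _) (norm_nonneg _)) (Finset.mem_univ q)).trans ?_
  exact Finset.single_le_sum (f := fun p => ∑ q, scalarOpNorm (β p) * scalarOpNorm (α q))
      (fun p _ => Finset.sum_nonneg fun q _ => mul_nonneg (norm_nonneg _) (norm_nonneg _))
      (Finset.mem_univ p)

/-- Conjugating an operator of `ℓ₂` by `φ` costs the Hilbertian constant. The absolute value makes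
the constant nonnegative whatever the sign of `h`. -/
theorem tameNorm_transportedNorms {h μ : ℝ} (φ : E ≃L[ℂ] Ell2)
    (hφ : ‖(φ : E →L[ℂ] Ell2)‖ * ‖(φ.symm : Ell2 →L[ℂ] E)‖ ≤ μ) (hE : IsHomogeneous h E) (n : ℕ) :
    TameNorm (|h| * μ) (transportedNorms φ n) where
  const_nonneg := mul_nonneg (abs_nonneg h)
    ((mul_nonneg (norm_nonneg _) (norm_nonneg _)).trans hφ)
  nonneg x := mnorm_nonneg _
  add_le x y := by
    have : (x + y).map φ.symm = x.map φ.symm + y.map φ.symm := by ext i j; simp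
    unfold transportedNorms
    rw [this]
    exact mnorm_add_le _ _ _
  upper := by
    obtain ⟨c, hc, h⟩ := exists_mnorm_le_sum_norm (E := E) n
    refine ⟨c * ‖(φ.symm : Ell2 →L[ℂ] E)‖, by positivity, fun x => (h _).trans ?_⟩
    rw [mul_assoc]
    refine mul_le_mul_of_nonneg_left ?_ hc
    rw [Finset.mul_sum]
    refine Finset.sum_le_sum fun p _ => ?_
    rw [Finset.mul_sum]
    exact Finset.sum_le_sum fun q _ => (φ.symm : Ell2 →L[ℂ] E).le_opNorm (x p q)
  lower := by
    obtain ⟨c, hc, h⟩ := exists_norm_apply_le_mnorm (E := E) n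
    refine ⟨‖(φ : E →L[ℂ] Ell2)‖ * c, by positivity, fun x p q => ?_⟩
    have h1 := h (x.map φ.symm) p q
    have h2 := (φ : E →L[ℂ] Ell2).le_opNorm (φ.symm (x p q))
    simp only [ContinuousLinearEquiv.coe_coe, ContinuousLinearEquiv.apply_symm_apply] at h2
    rw [mul_assoc]
    exact h2.trans (mul_le_mul_of_nonneg_left h1 (norm_nonneg _))
  hom T x := by
    let T' : E →L[ℂ] E := (φ.symm : Ell2 →L[ℂ] E) ∘L T ∘L (φ : E →L[ℂ] Ell2)
    have h1 := hE T' n (x.map φ.symm)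
    have h2 : (x.map φ.symm).map T' = (x.map T).map φ.symm := by ext i j; simp [T']
    rw [h2] at h1
    refine h1.trans (mul_le_mul_of_nonneg_right ?_ (mnorm_nonneg _))
    have h3 : ‖T'‖ ≤ μ * ‖T‖ := by
      refine (ContinuousLinearMap.opNorm_comp_le _ _).trans ?_
      refine (mul_le_mul_of_nonneg_left (ContinuousLinearMap.opNorm_comp_le _ _)
        (norm_nonneg _)).trans ?_
      calc _ = ‖(φ : E →L[ℂ] Ell2)‖ * ‖(φ.symm : Ell2 →L[ℂ] E)‖ * ‖T‖ := by ring
        _ ≤ _ := mul_le_mul_of_nonneg_right hφ (norm_nonneg _)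
    calc h * ‖T'‖ ≤ |h| * ‖T'‖ := mul_le_mul_of_nonneg_right (le_abs_self _) (norm_nonneg _)
      _ ≤ |h| * (μ * ‖T‖) := mul_le_mul_of_nonneg_left h3 (abs_nonneg _)
      _ = _ := by ring

end MatrixNormsOfOperatorSpaces

/-! ### Coordinates, synthesis operators and weighted sequences in `ℓ₂`. -/

section SquareSummableSequences

open Filter Topology

/-- The `m`-th vector of the standard basis of `ℓ₂`. -/
noncomputable def stdBasis (m : ℕ) : Ell2 := lp.single 2 m 1

theorem stdBasis_apply (m i : ℕ) : stdBasis m i = if i = m then 1 else 0 := by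
  simp [stdBasis, lp.single_apply, Pi.single_apply]

theorem inner_stdBasis (m : ℕ) (x : Ell2) : inner ℂ (stdBasis m) x = x m := by
  rw [stdBasis, lp.inner_single_left]
  simp

theorem hasSum_norm_sq (z : Ell2) : HasSum (fun m => ‖z m‖ ^ 2) (‖z‖ ^ 2) := by
  have h2 : (0 : ℝ) < (2 : ENNReal).toReal := by norm_num
  simpa using lp.hasSum_norm h2 z

theorem memℓp_two_of_summable {z : ℕ → ℂ} (h : Summable fun m => ‖z m‖ ^ 2) : Memℓp z 2 := by
  refine memℓp_gen ?_
  simpa only [ENNReal.toReal_ofNat, Real.rpow_ofNat] using h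

/-- The `m`-th coordinate functional of `ℓ₂`. -/
noncomputable def coord (m : ℕ) : Ell2 →L[ℂ] ℂ := lp.evalCLM ℂ (fun _ : ℕ => ℂ) 2 m

theorem coord_apply (m : ℕ) (z : Ell2) : coord m z = z m := rfl

theorem sum_norm_sq_le {ι : Type*} (s : Finset ι) (c : ι → ℕ) (hc : Set.InjOn c s) (z : Ell2) :
    ∑ p ∈ s, ‖z (c p)‖ ^ 2 ≤ ‖z‖ ^ 2 := by
  classical
  rw [← Finset.sum_image (f := fun m => ‖z m‖ ^ 2) hc]
  exact sum_le_hasSum _ (fun _ _ => by positivity) (hasSum_norm_sq z)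

variable {ι H : Type*} [NormedAddCommGroup H] [InnerProductSpace ℂ H]

/-- The operator `z ↦ ∑ z(c(p)) G(p)`, the sum being over `p ∈ s`. -/
noncomputable def synth (s : Finset ι) (c : ι → ℕ) (G : ι → H) : Ell2 →L[ℂ] H :=
  ∑ p ∈ s, (coord (c p)).smulRight (G p)

theorem synth_apply (s : Finset ι) (c : ι → ℕ) (G : ι → H) (z : Ell2) :
    synth s c G z = ∑ p ∈ s, z (c p) • G p := by
  simp [synth, coord_apply]

/-- The source of the operator norm bounds below: the analysis operators are adjoints of synthesis
operators, so an estimate on finite combinations of the `G p` serves both. -/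
theorem norm_synth_le {s : Finset ι} {c : ι → ℕ} (hc : Set.InjOn c s) {G : ι → H} {R : ℝ}
    (hR : 0 ≤ R) (hG : ∀ k : ι → ℂ, ‖∑ p ∈ s, k p • G p‖ ^ 2 ≤ R ^ 2 * ∑ p ∈ s, ‖k p‖ ^ 2) :
    ‖synth s c G‖ ≤ R := by
  refine ContinuousLinearMap.opNorm_le_bound _ hR fun z => ?_
  refine le_of_sq_le_sq ?_ (by positivity)
  rw [synth_apply, mul_pow]
  exact (hG fun p => z (c p)).trans
    (mul_le_mul_of_nonneg_left (sum_norm_sq_le s c hc z) (sq_nonneg R))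

theorem adjoint_synth_apply [CompleteSpace H] {s : Finset ι} {c : ι → ℕ} (hc : Set.InjOn c s)
    (G : ι → H) {p : ι} (hp : p ∈ s) (x : H) :
    ContinuousLinearMap.adjoint (synth s c G) x (c p) = inner ℂ (G p) x := by
  classical
  rw [← inner_stdBasis, ContinuousLinearMap.adjoint_inner_right, synth_apply,
    Finset.sum_eq_single p]
  · simp [stdBasis_apply]
  · intro q hq hqp
    have : c q ≠ c p := fun h => hqp (hc hq hp h)
    simp [stdBasis_apply, this]
  · exact fun h => (h hp).elim

theorem adjoint_synth_apply_of_notMem [CompleteSpace H] {s : Finset ι} {c : ι → ℕ}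
    (G : ι → H) {m : ℕ} (hm : ∀ p ∈ s, c p ≠ m) (x : H) :
    ContinuousLinearMap.adjoint (synth s c G) x m = 0 := by
  rw [← inner_stdBasis, ContinuousLinearMap.adjoint_inner_right, synth_apply,
    Finset.sum_eq_zero, inner_zero_left]
  intro q hq
  simp [stdBasis_apply, hm q hq]

/-- The projection of `ℓ₂` onto the coordinates in `s`. -/
noncomputable def trunc (s : Finset ℕ) : Ell2 →L[ℂ] Ell2 := synth s id stdBasis

theorem trunc_apply (s : Finset ℕ) (z : Ell2) (m : ℕ) :
    trunc s z m = if m ∈ s then z m else 0 := by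
  classical
  rw [← coord_apply m (trunc s z), trunc, synth_apply, map_sum]
  simp [coord_apply, stdBasis_apply]

theorem tendsto_trunc {s : ℕ → Finset ℕ} (hs : Tendsto s atTop atTop) (z : Ell2) :
    Tendsto (fun M => trunc (s M) z) atTop (𝓝 z) := by
  have h := lp.hasSum_single (p := 2) (by norm_num) z
  refine (h.comp hs).congr fun M => ?_
  ext m
  rw [trunc_apply, ← coord_apply m (_ : Ell2), Function.comp_apply, map_sum]
  simp [coord_apply, lp.single_apply, Pi.single_apply]

theorem summable_pair (w : Ell2) : Summable fun p : ℕ × ℕ => ‖w (Nat.pair p.1 p.2)‖ ^ 2 :=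
  (Nat.pairEquiv.summable_iff (f := fun m => ‖w m‖ ^ 2)).mpr (hasSum_norm_sq w).summable

theorem memℓp_slice (w : Ell2) (j : ℕ) (c : ℂ) :
    Memℓp (fun i => c * w (Nat.pair j i)) 2 := by
  refine memℓp_two_of_summable ?_
  simp only [norm_mul, mul_pow]
  exact ((summable_pair w).prod_factor j).mul_left _

/-- The inverse of `flatten`, for a positive weight. -/
noncomputable def unflatten (u : ℕ → ℝ) (hu : ∀ j, 0 < u j) (w : Ell2) : WeightedEll2 u :=
  ⟨fun j => ⟨fun i => ((Real.sqrt (u j) : ℝ) : ℂ)⁻¹ * w (Nat.pair j i), memℓp_slice w j _⟩, by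
    refine (summable_pair w).prod.congr fun j => ?_
    have h := (hasSum_norm_sq ⟨fun i => ((Real.sqrt (u j) : ℝ) : ℂ)⁻¹ * w (Nat.pair j i),
      memℓp_slice w j _⟩).tsum_eq
    rw [← h, ← tsum_mul_left]
    refine tsum_congr fun i => ?_
    rw [norm_mul, mul_pow, norm_inv, Complex.norm_real, Real.norm_eq_abs, inv_pow, sq_abs,
      Real.sq_sqrt (hu j).le, mul_inv_cancel_left₀ (hu j).ne']⟩

theorem unflatten_apply (u : ℕ → ℝ) (hu : ∀ j, 0 < u j) (w : Ell2) (j i : ℕ) :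
    (unflatten u hu w).1 j i = ((Real.sqrt (u j) : ℝ) : ℂ)⁻¹ * w (Nat.pair j i) := rfl

theorem flatten_apply (u : ℕ → ℝ) (f : WeightedEll2 u) (j i : ℕ) :
    flatten u f (Nat.pair j i) = ((Real.sqrt (u j) : ℝ) : ℂ) * f.1 j i := by
  change ((Real.sqrt (u (Nat.pair j i).unpair.1) : ℝ) : ℂ) * f.1 (Nat.pair j i).unpair.1
    (Nat.pair j i).unpair.2 = _
  rw [Nat.unpair_pair]

theorem flatten_unflatten (u : ℕ → ℝ) (hu : ∀ j, 0 < u j) (w : Ell2) :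
    flatten u (unflatten u hu w) = w := by
  ext m
  have h := flatten_apply u (unflatten u hu w) m.unpair.1 m.unpair.2
  rw [Nat.pair_unpair, unflatten_apply, Nat.pair_unpair] at h
  rw [h, mul_inv_cancel_left₀]
  exact_mod_cast (Real.sqrt_pos.mpr (hu _)).ne'

end SquareSummableSequences

/-! ### Quadratic forms of the functional calculus of `B`. -/

section SpectralForms

variable {L : Type*} [NormedAddCommGroup L] [InnerProductSpace ℂ L] [CompleteSpace L]

open ContinuousLinearMap

/-- The quadratic form of `g(B)`. -/
noncomputable def spectralForm (B : L →L[ℂ] L) (f : L) (g : ℝ → ℝ) : ℝ :=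
  (inner ℂ f (cfc g B f)).re

variable {B : L →L[ℂ] L}

theorem cfc_apply_add {g h : ℝ → ℝ} (hg : Continuous g) (hh : Continuous h) (f : L) :
    cfc (fun t => g t + h t) B f = cfc g B f + cfc h B f := by
  rw [cfc_add B g h hg.continuousOn hh.continuousOn, add_apply]

theorem cfc_apply_sum {ι : Type*} (s : Finset ι) {g : ι → ℝ → ℝ} (hg : ∀ k, Continuous (g k))
    (f : L) : cfc (fun t => ∑ k ∈ s, g k t) B f = ∑ k ∈ s, cfc (g k) B f := by
  have h : (fun t => ∑ k ∈ s, g k t) = ∑ k ∈ s, g k := by ext t; simp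
  rw [h, cfc_sum g B s fun k _ => (hg k).continuousOn]
  simp

theorem cfc_apply_mul {g h : ℝ → ℝ} (hg : Continuous g) (hh : Continuous h) (f : L) :
    cfc (fun t => g t * h t) B f = cfc g B (cfc h B f) := by
  rw [cfc_mul g h B hg.continuousOn hh.continuousOn, mul_apply_eq_comp]

theorem cfc_apply_const_mul (c : ℝ) {g : ℝ → ℝ} (hg : Continuous g) (f : L) :
    cfc (fun t => c * g t) B f = (c : ℂ) • cfc g B f := by
  rw [cfc_const_mul c g B hg.continuousOn, smul_apply]
  exact (Complex.coe_smul c _).symm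

theorem isSelfAdjoint_cfc (g : ℝ → ℝ) : IsSelfAdjoint (cfc g B) := cfc_predicate g B

theorem inner_cfc_left (g : ℝ → ℝ) (f f' : L) :
    inner ℂ (cfc g B f) f' = inner ℂ f (cfc g B f') := by
  rw [← ContinuousLinearMap.adjoint_inner_right, (isSelfAdjoint_cfc g).adjoint_eq]

theorem inner_cfc_self (g : ℝ → ℝ) (f : L) :
    inner ℂ (cfc g B f) f = (spectralForm B f g : ℂ) := by
  rw [inner_cfc_left, spectralForm]
  refine (Complex.conj_eq_iff_re.mp ?_).symm
  rw [inner_conj_symm, inner_cfc_left]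

theorem spectralForm_add {g h : ℝ → ℝ} (hg : Continuous g) (hh : Continuous h) (f : L) :
    spectralForm B f (fun t => g t + h t) = spectralForm B f g + spectralForm B f h := by
  rw [spectralForm, cfc_apply_add hg hh, inner_add_right, Complex.add_re]; rfl

theorem spectralForm_const_mul (c : ℝ) {g : ℝ → ℝ} (hg : Continuous g) (f : L) :
    spectralForm B f (fun t => c * g t) = c * spectralForm B f g := by
  rw [spectralForm, cfc_apply_const_mul c hg, inner_smul_right, Complex.re_ofReal_mul]; rfl

theorem spectralForm_sub {g h : ℝ → ℝ} (hg : Continuous g) (hh : Continuous h) (f : L) :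
    spectralForm B f (fun t => g t - h t) = spectralForm B f g - spectralForm B f h := by
  have h1 := spectralForm_add (B := B) hg (h := fun t => (-1) * h t) (by fun_prop) f
  rw [spectralForm_const_mul _ hh] at h1
  have h2 : (fun t => g t + (-1) * h t) = fun t => g t - h t := by ext t; ring
  rw [h2] at h1
  rw [h1]; ring

theorem spectralForm_sum {ι : Type*} (s : Finset ι) {g : ι → ℝ → ℝ} (hg : ∀ k, Continuous (g k))
    (f : L) : spectralForm B f (fun t => ∑ k ∈ s, g k t) = ∑ k ∈ s, spectralForm B f (g k) := by
  rw [spectralForm, cfc_apply_sum s hg, inner_sum, Complex.re_sum]; rfl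

theorem spectralForm_one (hB : IsSelfAdjoint B) (f : L) :
    spectralForm B f (fun _ => 1) = ‖f‖ ^ 2 := by
  rw [spectralForm, cfc_const_one ℝ B]
  exact inner_self_eq_norm_sq (𝕜 := ℂ) f

theorem spectralForm_mono (hs : spectrum ℝ B ⊆ Set.Icc 0 1) {g h : ℝ → ℝ} (hg : Continuous g)
    (hh : Continuous h) (hle : ∀ t ∈ Set.Icc (0 : ℝ) 1, g t ≤ h t) (f : L) :
    spectralForm B f g ≤ spectralForm B f h := by
  have h1 : cfc g B ≤ cfc h B :=
    cfc_mono (fun t ht => hle t (hs ht)) hg.continuousOn hh.continuousOn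
  have h2 := ((ContinuousLinearMap.le_def _ _).mp h1).re_inner_nonneg_right f
  rw [sub_apply, inner_sub_right, map_sub] at h2
  exact sub_nonneg.mp h2

variable {J : Ell2 →L[ℂ] L} {τ : ℝ → ℝ}

/-- Because `J J* = τ(B)`, Gram matrices of vectors `J* g(B) f` are computed inside the functional
calculus of `B`. -/
theorem inner_adjoint_cfc (hJ : J ∘L adjoint J = cfc τ B) (hτ : Continuous τ) {g h : ℝ → ℝ}
    (hg : Continuous g) (hh : Continuous h) (f f' : L) :
    inner ℂ (adjoint J (cfc g B f)) (adjoint J (cfc h B f'))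
      = inner ℂ f (cfc (fun t => τ t * g t * h t) B f') := by
  rw [ContinuousLinearMap.adjoint_inner_left, ← comp_apply, hJ, inner_cfc_left,
    ← cfc_apply_mul hτ hh, ← cfc_apply_mul hg (by fun_prop)]
  congr 3
  ext t
  ring_nf

theorem norm_adjoint_cfc_sq (hJ : J ∘L adjoint J = cfc τ B) (hτ : Continuous τ) {g : ℝ → ℝ}
    (hg : Continuous g) (f : L) :
    ‖adjoint J (cfc g B f)‖ ^ 2 = spectralForm B f fun t => τ t * g t * g t := by
  rw [spectralForm, ← inner_adjoint_cfc hJ hτ hg hg]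
  exact (inner_self_eq_norm_sq (𝕜 := ℂ) _).symm

/-- For real coefficients the combination is `J* g(B) f` for a single real function `g`, so a
pointwise inequality on the spectrum passes to the quadratic forms. -/
theorem norm_sq_sum_adjoint_cfc_real (hJ : J ∘L adjoint J = cfc τ B) (hτ : Continuous τ)
    (hs : spectrum ℝ B ⊆ Set.Icc 0 1) {κ : Type*} (I : Finset κ) {g w : κ → ℝ → ℝ}
    (hg : ∀ k, Continuous (g k)) (hw : ∀ k, Continuous (w k))
    (hgw : ∀ c : κ → ℝ, ∀ t ∈ Set.Icc (0 : ℝ) 1,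
      τ t * (∑ k ∈ I, c k * g k t) ^ 2 ≤ ∑ k ∈ I, c k ^ 2 * w k t) (f : L) (c : κ → ℝ) :
    ‖∑ k ∈ I, (c k : ℂ) • adjoint J (cfc (g k) B f)‖ ^ 2
      ≤ ∑ k ∈ I, c k ^ 2 * spectralForm B f (w k) := by
  have h1 : ∑ k ∈ I, (c k : ℂ) • adjoint J (cfc (g k) B f)
      = adjoint J (cfc (fun t => ∑ k ∈ I, c k * g k t) B f) := by
    rw [cfc_apply_sum I (g := fun k t => c k * g k t) (by fun_prop), map_sum]
    refine Finset.sum_congr rfl fun k _ => ?_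
    rw [cfc_apply_const_mul _ (hg k), map_smul]
  have h2 : ∑ k ∈ I, c k ^ 2 * spectralForm B f (w k)
      = spectralForm B f fun t => ∑ k ∈ I, c k ^ 2 * w k t := by
    rw [spectralForm_sum I (g := fun k t => c k ^ 2 * w k t) (by fun_prop)]
    exact Finset.sum_congr rfl fun k _ => (spectralForm_const_mul _ (hw k) f).symm
  rw [h1, h2, norm_adjoint_cfc_sq hJ hτ (by fun_prop)]
  refine spectralForm_mono hs (by fun_prop) (by fun_prop) (fun t ht => ?_) f
  rw [mul_assoc, ← sq]
  exact hgw c t ht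

/-- The functional calculus used is real; complex coefficients are split into real and imaginary
parts, whence the factor 2. -/
theorem norm_sq_sum_adjoint_cfc (hJ : J ∘L adjoint J = cfc τ B) (hτ : Continuous τ)
    (hs : spectrum ℝ B ⊆ Set.Icc 0 1) {κ : Type*} (I : Finset κ) {g w : κ → ℝ → ℝ}
    (hg : ∀ k, Continuous (g k)) (hw : ∀ k, Continuous (w k))
    (hgw : ∀ c : κ → ℝ, ∀ t ∈ Set.Icc (0 : ℝ) 1,
      τ t * (∑ k ∈ I, c k * g k t) ^ 2 ≤ ∑ k ∈ I, c k ^ 2 * w k t) (f : L) (c : κ → ℂ) :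
    ‖∑ k ∈ I, c k • adjoint J (cfc (g k) B f)‖ ^ 2
      ≤ 2 * ∑ k ∈ I, ‖c k‖ ^ 2 * spectralForm B f (w k) := by
  set D : κ → Ell2 := fun k => adjoint J (cfc (g k) B f)
  have h1 : ∑ k ∈ I, c k • D k
      = ∑ k ∈ I, ((c k).re : ℂ) • D k + Complex.I • ∑ k ∈ I, ((c k).im : ℂ) • D k := by
    rw [Finset.smul_sum, ← Finset.sum_add_distrib]
    refine Finset.sum_congr rfl fun k _ => ?_
    rw [smul_smul, ← add_smul, mul_comm Complex.I, Complex.re_add_im]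
  have hre := norm_sq_sum_adjoint_cfc_real hJ hτ hs I hg hw hgw f fun k => (c k).re
  have him := norm_sq_sum_adjoint_cfc_real hJ hτ hs I hg hw hgw f fun k => (c k).im
  have h2 := norm_add_le (∑ k ∈ I, ((c k).re : ℂ) • D k)
    (Complex.I • ∑ k ∈ I, ((c k).im : ℂ) • D k)
  rw [norm_smul, Complex.norm_I, one_mul, ← h1] at h2
  have h3 : ∑ k ∈ I, ‖c k‖ ^ 2 * spectralForm B f (w k)
      = ∑ k ∈ I, (c k).re ^ 2 * spectralForm B f (w k)
        + ∑ k ∈ I, (c k).im ^ 2 * spectralForm B f (w k) := by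
    rw [← Finset.sum_add_distrib]
    refine Finset.sum_congr rfl fun k _ => ?_
    rw [← Complex.normSq_eq_norm_sq, Complex.normSq_apply]
    ring
  rw [h3]
  have h4 := pow_le_pow_left₀ (norm_nonneg _) h2 2
  have h5 := add_sq_le (a := ‖∑ k ∈ I, ((c k).re : ℂ) • D k‖)
    (b := ‖∑ k ∈ I, ((c k).im : ℂ) • D k‖)
  exact h4.trans (h5.trans (by gcongr))

/-- If the vectors `f i` have orthogonal orbits, the bounds of `norm_sq_sum_adjoint_cfc` add up. -/
theorem norm_sq_sum_adjoint_cfc_family (hJ : J ∘L adjoint J = cfc τ B) (hτ : Continuous τ)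
    (hs : spectrum ℝ B ⊆ Set.Icc 0 1) {κ : Type*} (I : Finset κ) {g w : κ → ℝ → ℝ}
    (hg : ∀ k, Continuous (g k)) (hw : ∀ k, Continuous (w k))
    (hgw : ∀ c : κ → ℝ, ∀ t ∈ Set.Icc (0 : ℝ) 1,
      τ t * (∑ k ∈ I, c k * g k t) ^ 2 ≤ ∑ k ∈ I, c k ^ 2 * w k t)
    (A : Finset ℕ) (f : ℕ → L)
    (hf : ∀ i i', i ≠ i' → ∀ k ∈ I, ∀ l ∈ I,
      inner ℂ (f i) (cfc (fun t => τ t * g k t * g l t) B (f i')) = 0)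
    (c : κ × ℕ → ℂ) :
    ‖∑ p ∈ I ×ˢ A, c p • adjoint J (cfc (g p.1) B (f p.2))‖ ^ 2
      ≤ 2 * ∑ p ∈ I ×ˢ A, ‖c p‖ ^ 2 * spectralForm B (f p.2) (w p.1) := by
  rw [Finset.sum_product_right, Finset.sum_product_right, Finset.mul_sum]
  have horth : ∀ i i', i ≠ i' → inner ℂ (∑ k ∈ I, c (k, i) • adjoint J (cfc (g k) B (f i)))
      (∑ l ∈ I, c (l, i') • adjoint J (cfc (g l) B (f i'))) = 0 := by
    intro i i' hii
    rw [sum_inner]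
    refine Finset.sum_eq_zero fun k hk => ?_
    rw [inner_sum]
    refine Finset.sum_eq_zero fun l hl => ?_
    rw [inner_smul_left, inner_smul_right, inner_adjoint_cfc hJ hτ (hg k) (hg l),
      hf i i' hii k hk l hl, mul_zero, mul_zero]
  have hpyth : ‖∑ i ∈ A, ∑ k ∈ I, c (k, i) • adjoint J (cfc (g k) B (f i))‖ ^ 2
      = ∑ i ∈ A, ‖∑ k ∈ I, c (k, i) • adjoint J (cfc (g k) B (f i))‖ ^ 2 := by
    classical
    rw [← inner_self_eq_norm_sq (𝕜 := ℂ), sum_inner, map_sum]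
    refine Finset.sum_congr rfl fun i hi => ?_
    rw [inner_sum, Finset.sum_eq_single i, inner_self_eq_norm_sq (𝕜 := ℂ)]
    · exact fun i' _ h => horth i i' h.symm
    · exact fun h => (h hi).elim
  rw [hpyth]
  refine Finset.sum_le_sum fun i hi => ?_
  exact norm_sq_sum_adjoint_cfc hJ hτ hs I hg hw hgw (f i) fun k => c (k, i)

end SpectralForms

/-! ### The asymptotic spectral distribution of an isometry. -/

section AsymptoticForms

open ContinuousLinearMap

theorem orthonormal_stdBasis : Orthonormal ℂ stdBasis := by
  classical
  rw [orthonormal_iff_ite]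
  intro i j
  rw [inner_stdBasis, stdBasis_apply]

theorem not_finiteDimensional_ell2 : ¬ FiniteDimensional ℂ Ell2 := fun _ =>
  have := orthonormal_stdBasis.linearIndependent.finite_of_isNoetherian
  not_finite ℕ

variable {L : Type*} [NormedAddCommGroup L] [InnerProductSpace ℂ L]

/-- Finitely many linear conditions cannot be injective on `ℓ₂`. -/
theorem exists_unit_vector_orthogonal (V : Ell2 →ₗᵢ[ℂ] L) (Z : Finset L) :
    ∃ w : Ell2, ‖w‖ = 1 ∧ ∀ z ∈ Z, inner ℂ z (V w) = 0 := by
  let T : Ell2 →ₗ[ℂ] (Z → ℂ) :=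
    LinearMap.pi fun z => (innerSL ℂ (z : L)).toLinearMap ∘ₗ V.toLinearMap
  have hT : LinearMap.ker T ≠ ⊥ := fun h =>
    not_finiteDimensional_ell2 (FiniteDimensional.of_injective T (LinearMap.ker_eq_bot.mp h))
  obtain ⟨w, hw, hw0⟩ := Submodule.exists_mem_ne_zero_of_ne_bot hT
  have hn : (‖w‖ : ℂ) ≠ 0 := by exact_mod_cast norm_ne_zero_iff.mpr hw0
  refine ⟨(‖w‖ : ℂ)⁻¹ • w, ?_, fun z hz => ?_⟩
  · rw [norm_smul, norm_inv, Complex.norm_real, norm_norm, inv_mul_cancel₀]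
    exact norm_ne_zero_iff.mpr hw0
  · have h := congrFun (LinearMap.mem_ker.mp hw) ⟨z, hz⟩
    rw [map_smul, inner_smul_right]
    simpa [T] using Or.inr h

variable [CompleteSpace L] {B : L →L[ℂ] L}

/-- Unit vectors `V w` whose spectral forms on the functions `ρ k` are close to `r k` can be found in
the orthogonal complement of any finite set. -/
def IsAsymptoticForm (B : L →L[ℂ] L) (V : Ell2 →ₗᵢ[ℂ] L) {κ : Type*} (ρ : κ → ℝ → ℝ)
    (r : κ → ℝ) : Prop :=
  ∀ (Z : Finset L) (I : Finset κ) (δ : ℝ), 0 < δ → ∃ w : Ell2, ‖w‖ = 1 ∧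
    (∀ z ∈ Z, inner ℂ z (V w) = 0) ∧ ∀ k ∈ I, |spectralForm B (V w) (ρ k) - r k| < δ

/-- The tuples of spectral forms lie in the compact cube `[0, 1] ^ κ`. Their closures, over unit
vectors orthogonal to larger and larger finite sets, are nonempty and directed, so they share a
point `r`. -/
theorem exists_asymptotic_form (V : Ell2 →ₗᵢ[ℂ] L) (hB : IsSelfAdjoint B)
    (hs : spectrum ℝ B ⊆ Set.Icc 0 1) {κ : Type*} {ρ : κ → ℝ → ℝ} (hρ : ∀ k, Continuous (ρ k))
    (hρ0 : ∀ k, ∀ t ∈ Set.Icc (0 : ℝ) 1, 0 ≤ ρ k t) (hρ1 : ∀ k, ∀ t ∈ Set.Icc (0 : ℝ) 1, ρ k t ≤ 1) :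
    ∃ r : κ → ℝ, IsAsymptoticForm B V ρ r := by
  classical
  let D : Finset L → Set (κ → ℝ) := fun Z =>
    {x | ∃ w : Ell2, ‖w‖ = 1 ∧ (∀ z ∈ Z, inner ℂ z (V w) = 0) ∧
      x = fun k => spectralForm B (V w) (ρ k)}
  have hDK : ∀ Z, closure (D Z) ⊆ Set.univ.pi fun _ => Set.Icc (0 : ℝ) 1 := by
    refine fun Z => closure_minimal ?_ (isClosed_set_pi fun _ _ => isClosed_Icc)
    rintro _ ⟨w, hw, -, rfl⟩ k -
    have h1 := spectralForm_mono hs (continuous_const (y := (1 : ℝ))) (hρ k)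
    have h2 := spectralForm_mono hs (hρ k) (continuous_const (y := (1 : ℝ))) (hρ1 k) (V w)
    have h3 := spectralForm_mono hs (g := fun t => 0 * 1) (by fun_prop) (hρ k)
      (fun t ht => by simpa using hρ0 k t ht) (V w)
    rw [spectralForm_one hB, V.norm_map, hw, one_pow] at h2
    rw [spectralForm_const_mul 0 (g := fun _ => 1) (by fun_prop), zero_mul] at h3
    exact ⟨h3, h2⟩
  have hcompact : ∀ Z, IsCompact (closure (D Z)) := fun Z =>
    (isCompact_univ_pi fun _ => isCompact_Icc).of_isClosed_subset isClosed_closure (hDK Z)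
  have hmono : ∀ Z Z', Z ⊆ Z' → D Z' ⊆ D Z := by
    rintro Z Z' h _ ⟨w, hw, hz, rfl⟩
    exact ⟨w, hw, fun z hz' => hz z (h hz'), rfl⟩
  obtain ⟨r, hr⟩ := IsCompact.nonempty_iInter_of_directed_nonempty_isCompact_isClosed
    (fun Z => closure (D Z))
    (fun Z Z' => ⟨Z ∪ Z', closure_mono (hmono _ _ Finset.subset_union_left),
      closure_mono (hmono _ _ Finset.subset_union_right)⟩)
    (fun Z => by
      obtain ⟨w, hw, hz⟩ := exists_unit_vector_orthogonal V Z
      exact ⟨_, subset_closure ⟨w, hw, hz, rfl⟩⟩)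
    hcompact (fun _ => isClosed_closure)
  refine ⟨r, fun Z I δ hδ => ?_⟩
  have hopen : IsOpen (Set.pi (I : Set κ) fun k => Metric.ball (r k) δ) :=
    isOpen_set_pi I.finite_toSet fun _ _ => Metric.isOpen_ball
  obtain ⟨_, hx, w, hw, hz, rfl⟩ := mem_closure_iff.mp (Set.mem_iInter.mp hr Z) _ hopen
    fun k _ => Metric.mem_ball_self hδ
  exact ⟨w, hw, hz, fun k hk => by simpa [Real.dist_eq] using hx k hk⟩

/-- The vectors of `exists_asymptotic_form` form a sequence with orthogonal orbits under a given
finite set of operators. -/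
theorem exists_asymptotic_sequence (V : Ell2 →ₗᵢ[ℂ] L) {κ : Type*} {ρ : κ → ℝ → ℝ} {r : κ → ℝ}
    (hr : IsAsymptoticForm B V ρ r)
    {T : Set (L →L[ℂ] L)} (hT : T.Finite) (I : Finset κ) {δ : ℝ} (hδ : 0 < δ) :
    ∃ w : ℕ → Ell2, (∀ i, ‖w i‖ = 1) ∧ (∀ i i', i ≠ i' → inner ℂ (w i) (w i') = 0) ∧
      (∀ S ∈ T, ∀ i i', i ≠ i' → inner ℂ (V (w i)) (S (V (w i'))) = 0) ∧
      ∀ i, ∀ k ∈ I, |spectralForm B (V (w i)) (ρ k) - r k| < δ := by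
  classical
  -- The recursion only compares an earlier vector with a later one; asking for orthogonality under
  -- both `S` and its adjoint covers the two orders of a pair.
  obtain ⟨w, hw, horth⟩ := exists_seq_of_forall_finset_exists
    (fun w : Ell2 => ‖w‖ = 1 ∧ ∀ k ∈ I, |spectralForm B (V w) (ρ k) - r k| < δ)
    (fun x y => inner ℂ (V x) (V y) = 0 ∧
      ∀ S ∈ T, inner ℂ (S (V x)) (V y) = 0 ∧ inner ℂ (adjoint S (V x)) (V y) = 0) fun X _ => by
    obtain ⟨y, hy1, hy2, hy3⟩ := hr
      (X.image V ∪ ((hT.toFinset ×ˢ X).image fun p => p.1 (V p.2)) ∪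
        ((hT.toFinset ×ˢ X).image fun p => adjoint p.1 (V p.2))) I δ hδ
    refine ⟨y, ⟨hy1, hy3⟩, fun x hx => ⟨hy2 _ ?_, fun S hS => ⟨hy2 _ ?_, hy2 _ ?_⟩⟩⟩
    · exact Finset.mem_union_left _ (Finset.mem_union_left _ (Finset.mem_image_of_mem _ hx))
    · exact Finset.mem_union_left _ (Finset.mem_union_right _
        (Finset.mem_image.mpr ⟨(S, x), by simp [hS, hx], rfl⟩))
    · exact Finset.mem_union_right _ (Finset.mem_image.mpr ⟨(S, x), by simp [hS, hx], rfl⟩)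
  refine ⟨w, fun i => (hw i).1, fun i i' h => ?_, fun S hS i i' h => ?_, fun i => (hw i).2⟩
  · rcases lt_or_gt_of_ne h with h | h
    · rw [← V.inner_map_map]
      exact (horth i i' h).1
    · rw [← V.inner_map_map]
      exact inner_eq_zero_symm.mp (horth i' i h).1
  · rcases lt_or_gt_of_ne h with h | h
    · rw [← ContinuousLinearMap.adjoint_inner_left]
      exact ((horth i i' h).2 S hS).2
    · exact inner_eq_zero_symm.mp ((horth i' i h).2 S hS).1

end AsymptoticForms

/-! ### A dyadic partition of unity on the interval and its scalar inequalities. -/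

section DyadicPartition

open Filter Topology

/-- The points of `(0, 1)` with `t / (1 - t) = 2 ^ k`. -/
noncomputable def node (k : ℤ) : ℝ := 2 ^ k / (1 + 2 ^ k)

theorem node_pos (k : ℤ) : 0 < node k := by unfold node; positivity

theorem one_sub_node (k : ℤ) : 1 - node k = 1 / (1 + 2 ^ k) := by
  have : (0 : ℝ) < 2 ^ k := by positivity
  unfold node
  field_simp
  ring

theorem node_lt_one (k : ℤ) : node k < 1 := by
  have h := one_sub_node k
  have : (0 : ℝ) < 1 / (1 + 2 ^ k) := by positivity
  linarith

theorem node_mono {k l : ℤ} (h : k ≤ l) : node k ≤ node l := by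
  have h1 := one_sub_node k
  have h2 := one_sub_node l
  have h3 : (2 : ℝ) ^ k ≤ 2 ^ l := zpow_le_zpow_right₀ one_le_two h
  have h4 : 1 / (1 + (2 : ℝ) ^ l) ≤ 1 / (1 + 2 ^ k) :=
    one_div_le_one_div_of_le (by positivity) (by linarith)
  linarith

theorem node_lt_node_succ (k : ℤ) : node k < node (k + 1) := by
  have h1 := one_sub_node k
  have h2 := one_sub_node (k + 1)
  have h3 : (2 : ℝ) ^ k < 2 ^ (k + 1) := zpow_lt_zpow_right₀ one_lt_two (lt_add_one k)
  have h4 : 1 / (1 + (2 : ℝ) ^ (k + 1)) < 1 / (1 + 2 ^ k) :=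
    one_div_lt_one_div_of_lt (by positivity) (by linarith)
  linarith

theorem node_add_two_le (k : ℤ) : node (k + 2) ≤ 4 * node k := by
  unfold node
  have h : (0 : ℝ) < 2 ^ k := by positivity
  have h1 : (2 : ℝ) ^ (k + 2) = 4 * 2 ^ k := by
    rw [zpow_add₀ two_ne_zero]; norm_num; ring
  rw [h1, ← mul_div_assoc]
  gcongr
  linarith

theorem le_one_sub_node_add_two (k : ℤ) : (1 - node k) / 4 ≤ 1 - node (k + 2) := by
  rw [one_sub_node, one_sub_node, div_div]
  have h : (0 : ℝ) < 2 ^ k := by positivity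
  have h1 : (2 : ℝ) ^ (k + 2) = 4 * 2 ^ k := by
    rw [zpow_add₀ two_ne_zero]; norm_num; ring
  rw [h1]
  apply one_div_le_one_div_of_le <;> linarith

theorem node_zero : node 0 = 1 / 2 := by norm_num [node]

theorem tendsto_one_sub_node : Tendsto (fun M : ℕ => 1 - node M) atTop (𝓝 0) := by
  refine squeeze_zero (fun M => by linarith [node_lt_one M])
    (g := fun M : ℕ => ((1 : ℝ) / 2) ^ M) (fun M => ?_)
    (tendsto_pow_atTop_nhds_zero_of_lt_one (by norm_num) (by norm_num))
  rw [one_sub_node, zpow_natCast, one_div_pow]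
  exact one_div_le_one_div_of_le (by positivity) (by linarith)

theorem tendsto_node_one_sub : Tendsto (fun M : ℕ => node (1 - M)) atTop (𝓝 0) := by
  refine squeeze_zero (fun M => (node_pos _).le)
    (g := fun M : ℕ => 2 * ((1 : ℝ) / 2) ^ M) (fun M => ?_) ?_
  · have h : (2 : ℝ) ^ (1 - (M : ℤ)) = 2 * (1 / 2) ^ M := by
      rw [zpow_sub₀ two_ne_zero, zpow_natCast, zpow_one, one_div_pow]; ring
    unfold node
    rw [h]
    exact div_le_self (by positivity) (by linarith [show (0 : ℝ) < 2 * (1 / 2) ^ M by positivity])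
  · simpa using (tendsto_pow_atTop_nhds_zero_of_lt_one (r := (1 : ℝ) / 2) (by norm_num)
      (by norm_num)).const_mul 2

/-- The continuous function that is `0` below `node k`, `1` above `node (k + 1)` and affine in
between. -/
noncomputable def ramp (k : ℤ) (t : ℝ) : ℝ :=
  max 0 (min 1 ((t - node k) / (node (k + 1) - node k)))

theorem continuous_ramp (k : ℤ) : Continuous (ramp k) := by unfold ramp; fun_prop

theorem ramp_nonneg (k : ℤ) (t : ℝ) : 0 ≤ ramp k t := le_max_left _ _

theorem ramp_le_one (k : ℤ) (t : ℝ) : ramp k t ≤ 1 := max_le zero_le_one (min_le_left _ _)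

theorem ramp_of_le {k : ℤ} {t : ℝ} (h : t ≤ node k) : ramp k t = 0 :=
  max_eq_left ((min_le_right _ _).trans
    (div_nonpos_of_nonpos_of_nonneg (by linarith) (by linarith [node_lt_node_succ k])))

theorem ramp_of_ge {k : ℤ} {t : ℝ} (h : node (k + 1) ≤ t) : ramp k t = 1 := by
  have h1 := node_lt_node_succ k
  unfold ramp
  rw [min_eq_left, max_eq_right zero_le_one]
  rw [one_le_div (by linarith)]
  linarith

theorem ramp_succ_le (k : ℤ) (t : ℝ) : ramp (k + 1) t ≤ ramp k t := by
  rcases le_total t (node (k + 1)) with h | h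
  · rw [ramp_of_le h]
    exact ramp_nonneg _ _
  · rw [ramp_of_ge h]
    exact ramp_le_one _ _

/-- The functions of the dyadic partition of unity on `(0, 1)`. -/
noncomputable def bump (k : ℤ) (t : ℝ) : ℝ := ramp k t - ramp (k + 1) t

theorem continuous_bump (k : ℤ) : Continuous (bump k) :=
  (continuous_ramp k).sub (continuous_ramp (k + 1))

theorem bump_nonneg (k : ℤ) (t : ℝ) : 0 ≤ bump k t := sub_nonneg.mpr (ramp_succ_le k t)

theorem le_of_bump_ne_zero {k : ℤ} {t : ℝ} (h : bump k t ≠ 0) : node k ≤ t ∧ t ≤ node (k + 2) := by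
  constructor
  · by_contra! h1
    refine h ?_
    rw [bump, ramp_of_le h1.le, ramp_of_le (h1.le.trans (node_mono (by lia))), sub_zero]
  · by_contra! h1
    refine h ?_
    rw [bump, ramp_of_ge (k := k) ((node_mono (by lia)).trans h1.le),
      ramp_of_ge (k := k + 1) (by rw [add_assoc]; exact h1.le), sub_self]

theorem sum_Ico_sub_succ (r : ℤ → ℝ) (M : ℕ) :
    ∑ k ∈ Finset.Ico (-(M : ℤ)) M, (r k - r (k + 1)) = r (-M) - r M := by
  induction M with
  | zero => simp
  | succ n ih =>
    have h : Finset.Ico (-((n + 1 : ℕ) : ℤ)) (n + 1 : ℕ)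
        = insert (-((n + 1 : ℕ) : ℤ)) (insert (n : ℤ) (Finset.Ico (-(n : ℤ)) n)) := by
      ext k
      simp only [Finset.mem_Ico, Finset.mem_insert]
      push_cast
      lia
    rw [h, Finset.sum_insert, Finset.sum_insert, ih]
    · have h1 : -((n + 1 : ℕ) : ℤ) + 1 = -n := by push_cast; ring
      rw [h1]
      push_cast
      ring
    · simp
    · simp only [Finset.mem_Ico, Finset.mem_insert]
      push_cast
      lia

theorem sum_bump (M : ℕ) (t : ℝ) :
    ∑ k ∈ Finset.Ico (-(M : ℤ)) M, bump k t = ramp (-M) t - ramp M t :=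
  sum_Ico_sub_succ (fun k => ramp k t) M

/-- Cauchy–Schwarz with the bumps as weights, whose total is at most 1. -/
theorem sq_sum_bump_le (M : ℕ) (c : ℤ → ℝ) (t : ℝ) :
    (∑ k ∈ Finset.Ico (-(M : ℤ)) M, c k * bump k t) ^ 2
      ≤ ∑ k ∈ Finset.Ico (-(M : ℤ)) M, c k ^ 2 * bump k t := by
  have h := Finset.sum_sq_le_sum_mul_sum_of_sq_le_mul (Finset.Ico (-(M : ℤ)) M)
    (r := fun k => c k * bump k t) (f := fun k => bump k t) (g := fun k => c k ^ 2 * bump k t)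
    (fun k _ => bump_nonneg k t) (fun k _ => mul_nonneg (sq_nonneg _) (bump_nonneg k t))
    (fun k _ => le_of_eq (by ring))
  refine h.trans (mul_le_of_le_one_left
    (Finset.sum_nonneg fun k _ => mul_nonneg (sq_nonneg _) (bump_nonneg k t)) ?_)
  rw [sum_bump]
  linarith [ramp_le_one (-M) t, ramp_nonneg M t]

/-- The properties, symmetric in the two summands, of the function `τ` (`t` or `1 - t`): the size
`b k` of `τ` on the support of `bump k`, and the functions `θ M` supported where `τ` is close
to `1` and `τ'` to `0`. -/
structure DyadicSide (τ τ' : ℝ → ℝ) (b : ℤ → ℝ) (θ : ℕ → ℝ → ℝ) : Prop where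
  cont : Continuous τ
  nonneg : ∀ t ∈ Set.Icc (0 : ℝ) 1, 0 ≤ τ t
  le_one : ∀ t ∈ Set.Icc (0 : ℝ) 1, τ t ≤ 1
  b_pos : ∀ k, 0 < b k
  lower : ∀ k t, bump k t ≠ 0 → b k / 4 ≤ τ t
  upper : ∀ k t, bump k t ≠ 0 → τ t ≤ 4 * b k
  cont_end : ∀ M, Continuous (θ M)
  end_nonneg : ∀ M t, 0 ≤ θ M t
  end_le_one : ∀ M t, θ M t ≤ 1
  end_lower : ∀ M t, 1 ≤ M → θ M t ≠ 0 → 1 / 2 ≤ τ t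
  end_small : ∃ η : ℕ → ℝ, Tendsto η atTop (𝓝 0) ∧ (∀ M, 0 ≤ η M) ∧
    ∀ M t, τ' t * θ M t ≤ η M * θ M t

theorem dyadicSide_left :
    DyadicSide (fun t => t) (fun t => 1 - t) node (fun M => ramp M) where
  cont := continuous_id
  nonneg _ ht := ht.1
  le_one _ ht := ht.2
  b_pos := node_pos
  lower k t h := by linarith [(le_of_bump_ne_zero h).1, node_pos k]
  upper k t h := (le_of_bump_ne_zero h).2.trans (node_add_two_le k)
  cont_end M := continuous_ramp M
  end_nonneg M t := ramp_nonneg M t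
  end_le_one M t := ramp_le_one M t
  end_lower M t _ h := by
    by_contra! h1
    refine h (ramp_of_le (h1.le.trans ?_))
    rw [← node_zero]
    exact node_mono (by lia)
  end_small := by
    refine ⟨_, tendsto_one_sub_node, fun M => by linarith [node_lt_one M], fun M t => ?_⟩
    rcases le_total t (node M) with h | h
    · simp [ramp_of_le h]
    · exact mul_le_mul_of_nonneg_right (by linarith) (ramp_nonneg _ _)

theorem dyadicSide_right :
    DyadicSide (fun t => 1 - t) (fun t => t) (fun k => 1 - node k)
      (fun M t => 1 - ramp (-M) t) where
  cont := by fun_prop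
  nonneg t ht := by linarith [ht.2]
  le_one t ht := by linarith [ht.1]
  b_pos k := by linarith [node_lt_one k]
  lower k t h := by linarith [(le_of_bump_ne_zero h).2, le_one_sub_node_add_two k]
  upper k t h := by linarith [(le_of_bump_ne_zero h).1, node_lt_one k]
  cont_end M := continuous_const.sub (continuous_ramp _)
  end_nonneg M t := by linarith [ramp_le_one (-M) t]
  end_le_one M t := by linarith [ramp_nonneg (-M) t]
  end_lower M t hM h := by
    by_contra! h1
    refine h (sub_eq_zero.mpr (ramp_of_ge ?_).symm)
    have h2 : node (-(M : ℤ) + 1) ≤ node 0 := node_mono (by lia)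
    rw [node_zero] at h2
    linarith
  end_small := by
    refine ⟨_, tendsto_node_one_sub, fun M => (node_pos _).le, fun M t => ?_⟩
    rcases le_total t (node (1 - M)) with h | h
    · exact mul_le_mul_of_nonneg_right h (by linarith [ramp_le_one (-M) t])
    · rw [ramp_of_ge (k := -M) (by rw [neg_add_eq_sub]; exact h)]
      simp

namespace DyadicSide

variable {τ τ' : ℝ → ℝ} {b : ℤ → ℝ} {θ : ℕ → ℝ → ℝ}

/-- The functions `ψ k` are the bumps divided by `τ`. Replacing `τ` by `max τ (b k / 4)` in the
denominator changes nothing on the support of the bump and makes the quotient continuous everywhere.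
-/
theorem exists_bump_div (S : DyadicSide τ τ' b θ) :
    ∃ ψ : ℤ → ℝ → ℝ, (∀ k, Continuous (ψ k)) ∧ (∀ k t, τ t * ψ k t = bump k t) ∧
      ∀ (M : ℕ) (c : ℤ → ℝ), ∀ t ∈ Set.Icc (0 : ℝ) 1,
        τ t * (∑ k ∈ Finset.Ico (-(M : ℤ)) M, c k * ψ k t) ^ 2
          ≤ ∑ k ∈ Finset.Ico (-(M : ℤ)) M, c k ^ 2 * (4 / b k * bump k t) := by
  have hmul : ∀ k t, τ t * (bump k t / max (τ t) (b k / 4)) = bump k t := by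
    intro k t
    by_cases h : bump k t = 0
    · simp [h]
    · have h1 := S.lower k t h
      have h2 := S.b_pos k
      have h3 : τ t ≠ 0 := by linarith
      rw [max_eq_left h1]
      field_simp
  refine ⟨fun k t => bump k t / max (τ t) (b k / 4), fun k => ?_, hmul, fun M c t ht => ?_⟩
  · have := S.cont
    have := continuous_bump k
    have := S.b_pos k
    refine Continuous.div₀ (by fun_prop) (by fun_prop) fun t => ?_
    exact (lt_of_lt_of_le (by positivity) (le_max_right _ _)).ne'
  · rcases (S.nonneg t ht).eq_or_lt with h | h
    · rw [← h, zero_mul]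
      refine Finset.sum_nonneg fun k _ => ?_
      have := S.b_pos k
      have := bump_nonneg k t
      positivity
    · refine le_of_mul_le_mul_left ?_ h
      rw [← mul_assoc, ← sq, ← mul_pow, Finset.mul_sum]
      have h1 : ∀ k, τ t * (c k * (bump k t / max (τ t) (b k / 4))) = c k * bump k t := by
        intro k
        rw [mul_left_comm, hmul]
      simp only [h1]
      refine (sq_sum_bump_le M c t).trans ?_
      rw [Finset.mul_sum]
      refine Finset.sum_le_sum fun k _ => ?_
      rw [mul_left_comm]
      refine mul_le_mul_of_nonneg_left ?_ (sq_nonneg _)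
      by_cases h2 : bump k t = 0
      · simp [h2]
      · have h3 := S.lower k t h2
        have h4 := S.b_pos k
        have h5 := bump_nonneg k t
        rw [← mul_assoc]
        refine le_mul_of_one_le_left h5 ?_
        rw [mul_div_assoc', le_div_iff₀ h4]
        linarith

/-- The bumps see only `τ ≤ 4 b k`, but the constants `ε k` also live where `τ` is much larger than
`b k`. Their sum is handled by Cauchy–Schwarz with weights `ε k / b k`, which is what the
summability hypothesis is for. -/
theorem sq_sum_bump_add_le (S : DyadicSide τ τ' b θ) {ε : ℤ → ℝ} (hε : ∀ k, 0 < ε k)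
    (hsum : ∀ I : Finset ℤ, ∑ k ∈ I, ε k / b k ≤ 1) (M : ℕ) (c : ℤ → ℝ) (t : ℝ)
    (ht : t ∈ Set.Icc (0 : ℝ) 1) :
    τ t * (∑ k ∈ Finset.Ico (-(M : ℤ)) M, c k * (bump k t + ε k)) ^ 2
      ≤ ∑ k ∈ Finset.Ico (-(M : ℤ)) M, c k ^ 2 * (8 * b k * (bump k t + ε k)) := by
  set I := Finset.Ico (-(M : ℤ)) M
  have h0 := S.nonneg t ht
  have h1 : τ t * (∑ k ∈ I, c k * bump k t) ^ 2 ≤ ∑ k ∈ I, c k ^ 2 * (4 * b k * bump k t) := by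
    refine (mul_le_mul_of_nonneg_left (sq_sum_bump_le M c t) h0).trans ?_
    rw [Finset.mul_sum]
    refine Finset.sum_le_sum fun k _ => ?_
    rw [mul_left_comm]
    refine mul_le_mul_of_nonneg_left ?_ (sq_nonneg _)
    by_cases h2 : bump k t = 0
    · simp [h2]
    · exact mul_le_mul_of_nonneg_right (S.upper k t h2) (bump_nonneg k t)
  have h2 : τ t * (∑ k ∈ I, c k * ε k) ^ 2 ≤ ∑ k ∈ I, c k ^ 2 * (b k * ε k) := by
    refine (mul_le_of_le_one_left (sq_nonneg _) (S.le_one t ht)).trans ?_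
    have h := Finset.sum_sq_le_sum_mul_sum_of_sq_le_mul I
      (r := fun k => c k * ε k) (f := fun k => ε k / b k) (g := fun k => c k ^ 2 * (b k * ε k))
      (fun k _ => (div_pos (hε k) (S.b_pos k)).le)
      (fun k _ => mul_nonneg (sq_nonneg _) (mul_pos (S.b_pos k) (hε k)).le)
      (fun k _ => le_of_eq (by have := (S.b_pos k).ne'; field_simp))
    refine h.trans (mul_le_of_le_one_left (Finset.sum_nonneg fun k _ =>
      mul_nonneg (sq_nonneg _) (mul_pos (S.b_pos k) (hε k)).le) (hsum I))
  have h3 : ∑ k ∈ I, c k * (bump k t + ε k) = ∑ k ∈ I, c k * bump k t + ∑ k ∈ I, c k * ε k := by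
    rw [← Finset.sum_add_distrib]
    exact Finset.sum_congr rfl fun k _ => by ring
  rw [h3]
  refine (mul_le_mul_of_nonneg_left add_sq_le h0).trans ?_
  calc τ t * (2 * ((∑ k ∈ I, c k * bump k t) ^ 2 + (∑ k ∈ I, c k * ε k) ^ 2))
      = 2 * (τ t * (∑ k ∈ I, c k * bump k t) ^ 2 + τ t * (∑ k ∈ I, c k * ε k) ^ 2) := by ring
    _ ≤ 2 * (∑ k ∈ I, c k ^ 2 * (4 * b k * bump k t) + ∑ k ∈ I, c k ^ 2 * (b k * ε k)) := by
      gcongr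
    _ = ∑ k ∈ I, 2 * (c k ^ 2 * (4 * b k * bump k t) + c k ^ 2 * (b k * ε k)) := by
      rw [← Finset.sum_add_distrib, Finset.mul_sum]
    _ ≤ _ := by
      refine Finset.sum_le_sum fun k _ => ?_
      have := mul_nonneg (sq_nonneg (c k)) (mul_pos (S.b_pos k) (hε k)).le
      nlinarith

theorem exists_end_div (S : DyadicSide τ τ' b θ) {M : ℕ} (hM : 1 ≤ M) :
    ∃ ψ : ℝ → ℝ, Continuous ψ ∧ (∀ t, τ t * ψ t = θ M t) ∧
      ∀ t, τ t * ψ t ^ 2 ≤ 2 * θ M t := by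
  have hmul : ∀ t, τ t * (θ M t / max (τ t) (1 / 2)) = θ M t := by
    intro t
    by_cases h : θ M t = 0
    · simp [h]
    · have h1 := S.end_lower M t hM h
      have h3 : τ t ≠ 0 := by linarith
      rw [max_eq_left h1]
      field_simp
  refine ⟨fun t => θ M t / max (τ t) (1 / 2), ?_, hmul, fun t => ?_⟩
  · have := S.cont
    have := S.cont_end M
    refine Continuous.div₀ (by fun_prop) (by fun_prop) fun t => ?_
    exact (lt_of_lt_of_le (by positivity) (le_max_right _ _)).ne'
  · rw [sq, ← mul_assoc, hmul]
    have h1 := S.end_nonneg M t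
    have h2 := S.end_le_one M t
    have h3 : (1 : ℝ) / 2 ≤ max (τ t) (1 / 2) := le_max_right _ _
    rw [mul_div_assoc', div_le_iff₀ (by linarith)]
    nlinarith

end DyadicSide

end DyadicPartition

/-! ### Operators between lifts and weighted sequences, on one side of the sum. -/

section SideOperators

open ContinuousLinearMap

variable {L : Type*} [NormedAddCommGroup L] [InnerProductSpace ℂ L]

/-- Different vectors of the sequence `f` have orthogonal orbits with respect to `T`. -/
def OrthogonalOrbits (T : Set (L →L[ℂ] L)) (f : ℕ → L) : Prop :=
  ∀ S ∈ T, ∀ i i', i ≠ i' → inner ℂ (f i) (S (f i')) = 0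

theorem OrthogonalOrbits.mono {T T' : Set (L →L[ℂ] L)} {f : ℕ → L} (h : OrthogonalOrbits T' f)
    (hT : T ⊆ T') : OrthogonalOrbits T f := fun S hS => h S (hT hS)

variable [CompleteSpace L]
  {B : L →L[ℂ] L} {J : Ell2 →L[ℂ] L} {τ τ' : ℝ → ℝ} {b : ℤ → ℝ} {θ : ℕ → ℝ → ℝ}

/-- The position in `ℓ₂` of the `i`-th coordinate of the term of index `k`, when the terms of the
weighted sequences are indexed by integers. -/
def position (p : ℤ × ℕ) : ℕ := Nat.pair (Equiv.intEquivNat p.1) p.2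

theorem position_injective : Function.Injective position := by
  rintro ⟨k, i⟩ ⟨l, j⟩ h
  obtain ⟨h1, h2⟩ := Nat.pair_eq_pair.mp h
  rw [Equiv.apply_eq_iff_eq] at h1
  exact Prod.ext h1 h2

/-- The index set of the first `M` coordinates of the `2 M` central terms. -/
noncomputable def box (M : ℕ) : Finset (ℤ × ℕ) := Finset.Ico (-(M : ℤ)) M ×ˢ Finset.range M

theorem J_adjoint_cfc (hJ : J ∘L adjoint J = cfc τ B) (hτ : Continuous τ) {g h : ℝ → ℝ}
    (hg : Continuous g) (hgh : ∀ t, τ t * g t = h t) (f : L) :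
    J (adjoint J (cfc g B f)) = cfc h B f := by
  rw [← comp_apply, hJ, ← cfc_apply_mul hτ hg]
  simp only [hgh]

theorem spectralForm_nonneg (hs : spectrum ℝ B ⊆ Set.Icc 0 1) {g : ℝ → ℝ} (hg : Continuous g)
    (h0 : ∀ t ∈ Set.Icc (0 : ℝ) 1, 0 ≤ g t) (f : L) : 0 ≤ spectralForm B f g := by
  have h3 := spectralForm_mono hs (g := fun _ => 0 * 1) (by fun_prop) hg
      (fun t ht => by simpa using h0 t ht) f
  rwa [spectralForm_const_mul 0 (g := fun _ => 1) (by fun_prop), zero_mul] at h3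

namespace DyadicSide

/-- From a weighted sequence to a lift: `J* (bump k / τ)(B) f` is a preimage of `bump k (B) f` under
`J`, of squared norm at most about `m k / b k`, and the weight `u k` compensates exactly this size.
The finite set `T` does not depend on `f`, so that a sequence with orthogonal orbits can be chosen
afterwards for several such operators together. -/
theorem exists_central_synthesis (S : DyadicSide τ τ' b θ) (hJ : J ∘L adjoint J = cfc τ B)
    (hs : spectrum ℝ B ⊆ Set.Icc 0 1) {a : ℝ} (ha : 0 < a) {u m : ℤ → ℝ} (hu : ∀ k, 0 < u k)
    (hum : ∀ k, a ^ 2 * b k * u k = m k) (M : ℕ) :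
    ∃ T : Set (L →L[ℂ] L), T.Finite ∧ ∀ f : ℕ → L, OrthogonalOrbits T f →
      (∀ i, ∀ k ∈ Finset.Ico (-(M : ℤ)) M, spectralForm B (f i) (bump k) ≤ m k) →
      ∃ A : Ell2 →L[ℂ] Ell2, ‖A‖ ≤ 3 ∧ ∀ z, (a : ℂ) • J (A z) = ∑ p ∈ box M,
        (((Real.sqrt (u p.1) : ℝ) : ℂ)⁻¹ * z (position p)) • cfc (bump p.1) B (f p.2) := by
  obtain ⟨ψ, hψ, hψ1, hψ2⟩ := S.exists_bump_div
  have hτ := S.cont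
  set I := Finset.Ico (-(M : ℤ)) M
  refine ⟨(fun p : ℤ × ℤ => cfc (fun t => τ t * ψ p.1 t * ψ p.2 t) B) '' (I ×ˢ I : Finset (ℤ × ℤ)),
    (Finset.finite_toSet _).image _, fun f hf hm => ?_⟩
  have hsq : ∀ k, 0 < Real.sqrt (u k) := fun k => Real.sqrt_pos.mpr (hu k)
  refine ⟨synth (box M) position fun p => ((a * Real.sqrt (u p.1) : ℝ) : ℂ)⁻¹ •
    adjoint J (cfc (ψ p.1) B (f p.2)), ?_, fun z => ?_⟩
  · refine norm_synth_le position_injective.injOn (by norm_num) fun c => ?_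
    simp only [smul_smul]
    refine (norm_sq_sum_adjoint_cfc_family hJ hτ hs I hψ
      (w := fun k t => 4 / b k * bump k t) (fun k => (continuous_bump k).const_mul _)
      (hψ2 M) (Finset.range M) f ?_ _).trans ?_
    · intro i i' hi k hk l hl
      exact hf _ ⟨(k, l), by simp [hk, hl], rfl⟩ i i' hi
    · rw [Finset.mul_sum, Finset.mul_sum]
      refine Finset.sum_le_sum fun p hp => ?_
      obtain ⟨hp1, hp2⟩ := Finset.mem_product.mp hp
      rw [spectralForm_const_mul _ (continuous_bump _), norm_mul, mul_pow, norm_inv,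
        Complex.norm_real, Real.norm_eq_abs, inv_pow, sq_abs, mul_pow, Real.sq_sqrt (hu _).le]
      have h1 := hm p.2 p.1 hp1
      have hb := S.b_pos p.1
      have h2 := hu p.1
      calc 2 * (‖c p‖ ^ 2 * (a ^ 2 * u p.1)⁻¹ * (4 / b p.1 * spectralForm B (f p.2) (bump p.1)))
          ≤ 2 * (‖c p‖ ^ 2 * (a ^ 2 * u p.1)⁻¹ * (4 / b p.1 * m p.1)) := by gcongr
        _ = 8 * ‖c p‖ ^ 2 := by rw [← hum]; field_simp; ring
        -- The 8 is the 2 of the complex coefficients times the 4 of `4 / b k`.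
        _ ≤ 3 ^ 2 * ‖c p‖ ^ 2 := by nlinarith [sq_nonneg ‖c p‖]
  · rw [synth_apply, map_sum, Finset.smul_sum]
    refine Finset.sum_congr rfl fun p _ => ?_
    rw [map_smul, map_smul, J_adjoint_cfc hJ hτ (hψ _) (hψ1 _), smul_smul, smul_smul]
    congr 1
    have h1 : (a : ℂ) ≠ 0 := by exact_mod_cast ha.ne'
    push_cast
    rw [mul_inv]
    field_simp

/-- At the end of the interval no weight is needed, since `τ ≥ 1/2` on the support of `θ M`; the
norm is governed by the mass `σ²` remaining there. -/
theorem exists_end_synthesis (S : DyadicSide τ τ' b θ) (hJ : J ∘L adjoint J = cfc τ B)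
    (hs : spectrum ℝ B ⊆ Set.Icc 0 1) {a : ℝ} (ha : 0 < a) {M : ℕ} (hM : 1 ≤ M) :
    ∃ T : Set (L →L[ℂ] L), T.Finite ∧ ∀ f : ℕ → L, OrthogonalOrbits T f →
      ∀ σ : ℝ, 0 ≤ σ → (∀ i, spectralForm B (f i) (θ M) ≤ σ ^ 2) →
      ∃ A : Ell2 →L[ℂ] Ell2, ‖A‖ ≤ 2 * σ / a ∧ ∀ z, (a : ℂ) • J (A z)
        = ∑ i ∈ Finset.range M, z i • cfc (θ M) B (f i) := by
  obtain ⟨ψ, hψ, hψ1, hψ2⟩ := S.exists_end_div hM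
  have hτ := S.cont
  refine ⟨{cfc (fun t => τ t * ψ t * ψ t) B}, Set.finite_singleton _, fun f hf σ hσ hm => ?_⟩
  -- A one-point index set in place of the dyadic indices lets the estimate for families apply to a
  -- single function.
  have hinj : Set.InjOn (fun p : Unit × ℕ => p.2)
      ((Finset.univ : Finset Unit) ×ˢ Finset.range M : Finset (Unit × ℕ)) :=
    fun p _ q _ h => Prod.ext rfl h
  refine ⟨synth ((Finset.univ : Finset Unit) ×ˢ Finset.range M) (fun p => p.2)
    fun p => (a : ℂ)⁻¹ • adjoint J (cfc ψ B (f p.2)), ?_, fun z => ?_⟩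
  · refine norm_synth_le hinj (by positivity) fun c => ?_
    simp only [smul_smul]
    refine (norm_sq_sum_adjoint_cfc_family hJ hτ hs Finset.univ (g := fun _ => ψ) (fun _ => hψ)
      (w := fun _ t => 2 * θ M t) (fun k => (S.cont_end M).const_mul _)
      (fun c t _ => ?_) (Finset.range M) f ?_ _).trans ?_
    · simp only [Finset.univ_unique, Finset.sum_singleton]
      rw [mul_pow, mul_left_comm]
      exact mul_le_mul_of_nonneg_left (hψ2 t) (sq_nonneg _)
    · intro i i' hi k hk l hl
      exact hf _ rfl i i' hi
    · rw [Finset.mul_sum, Finset.mul_sum]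
      refine Finset.sum_le_sum fun p hp => ?_
      rw [spectralForm_const_mul _ (S.cont_end M), norm_mul, mul_pow, norm_inv,
        Complex.norm_real, Real.norm_eq_abs, inv_pow, sq_abs]
      calc 2 * (‖c p‖ ^ 2 * (a ^ 2)⁻¹ * (2 * spectralForm B (f p.2) (θ M)))
          ≤ 2 * (‖c p‖ ^ 2 * (a ^ 2)⁻¹ * (2 * σ ^ 2)) := by gcongr; exact hm _
        _ = _ := by field_simp
  · rw [synth_apply, map_sum, Finset.smul_sum, Finset.univ_unique, Finset.singleton_product,
      Finset.sum_map]
    refine Finset.sum_congr rfl fun i _ => ?_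
    have h1 : (a : ℂ) ≠ 0 := by exact_mod_cast ha.ne'
    simp only [Function.Embedding.coeFn_mk]
    rw [map_smul, map_smul, J_adjoint_cfc hJ hτ hψ hψ1, smul_smul, smul_smul]
    congr 1
    field_simp

/-- From a lift to a weighted sequence: pair the lift with `(bump k + ε k)(B) f` and divide by the
spectral form. The added `ε k` keeps the divisor positive on pieces that carry no asymptotic mass.
-/
theorem exists_central_analysis (S : DyadicSide τ τ' b θ) (hJ : J ∘L adjoint J = cfc τ B)
    (hs : spectrum ℝ B ⊆ Set.Icc 0 1) {a : ℝ} (ha : 0 < a) {u m ε : ℤ → ℝ} (hu : ∀ k, 0 < u k)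
    (hε : ∀ k, 0 < ε k) (hεb : ∀ I : Finset ℤ, ∑ k ∈ I, ε k / b k ≤ 1)
    (hum : ∀ k, a ^ 2 * b k * u k = m k) (M : ℕ) :
    ∃ T : Set (L →L[ℂ] L), T.Finite ∧ ∀ f : ℕ → L, OrthogonalOrbits T f →
      (∀ i, ∀ k ∈ Finset.Ico (-(M : ℤ)) M,
        m k / 2 ≤ spectralForm B (f i) (fun t => bump k t + ε k)) →
      ∃ A : Ell2 →L[ℂ] Ell2, ‖A‖ ≤ 6 ∧ (∀ x, ∀ p ∈ box M, A x (position p)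
        = ((Real.sqrt (u p.1) : ℝ) : ℂ) * ((a : ℂ) *
          (spectralForm B (f p.2) (fun t => bump p.1 t + ε p.1) : ℂ)⁻¹ *
          inner ℂ (cfc (fun t => bump p.1 t + ε p.1) B (f p.2)) (J x))) ∧
        ∀ x j, (∀ p ∈ box M, position p ≠ j) → A x j = 0 := by
  have hτ := S.cont
  set g : ℤ → ℝ → ℝ := fun k t => bump k t + ε k with hgdef
  have hg : ∀ k, Continuous (g k) := fun k => (continuous_bump k).add continuous_const
  set I := Finset.Ico (-(M : ℤ)) M
  refine ⟨(fun p : ℤ × ℤ => cfc (fun t => τ t * g p.1 t * g p.2 t) B) '' (I ×ˢ I : Finset (ℤ × ℤ)),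
    (Finset.finite_toSet _).image _, fun f hf hm => ?_⟩
  set s : ℤ × ℕ → ℝ := fun p => spectralForm B (f p.2) (g p.1) with hsdef
  refine ⟨adjoint (synth (box M) position fun p => ((Real.sqrt (u p.1) * (a * (s p)⁻¹) : ℝ) : ℂ) •
    adjoint J (cfc (g p.1) B (f p.2))), ?_, fun x p hp => ?_, fun x j hj => ?_⟩
  · rw [LinearIsometryEquiv.norm_map]
    refine norm_synth_le position_injective.injOn (by norm_num) fun c => ?_
    simp only [smul_smul]
    refine (norm_sq_sum_adjoint_cfc_family hJ hτ hs I hg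
      (w := fun k t => 8 * b k * g k t) (fun k => (hg k).const_mul _)
      (S.sq_sum_bump_add_le hε hεb M) (Finset.range M) f ?_ _).trans ?_
    · intro i i' hi k hk l hl
      exact hf _ ⟨(k, l), by simp [hk, hl], rfl⟩ i i' hi
    · rw [Finset.mul_sum, Finset.mul_sum]
      refine Finset.sum_le_sum fun p hp => ?_
      obtain ⟨hp1, hp2⟩ := Finset.mem_product.mp hp
      rw [spectralForm_const_mul _ (hg _), norm_mul, mul_pow,
        Complex.norm_real, Real.norm_eq_abs, sq_abs, mul_pow, Real.sq_sqrt (hu _).le]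
      have h1 : m p.1 / 2 ≤ s p := hm p.2 p.1 hp1
      have hb := S.b_pos p.1
      have h2 := hu p.1
      have h3 : 0 < m p.1 := by rw [← hum]; positivity
      have h4 : 0 < s p := by linarith
      change 2 * (‖c p‖ ^ 2 * (u p.1 * (a * (s p)⁻¹) ^ 2) * (8 * b p.1 * s p)) ≤ _
      have h5 : 2 * (‖c p‖ ^ 2 * (u p.1 * (a * (s p)⁻¹) ^ 2) * (8 * b p.1 * s p))
          = 16 * ‖c p‖ ^ 2 * (m p.1 / s p) := by
        rw [← hum]; field_simp; ring
      have h6 : m p.1 / s p ≤ 2 := by rw [div_le_iff₀ h4]; linarith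
      rw [h5]
      -- The squared norm is at most 32, rounded up to 36.
      calc 16 * ‖c p‖ ^ 2 * (m p.1 / s p) ≤ 16 * ‖c p‖ ^ 2 * 2 := by gcongr
        _ ≤ _ := by nlinarith [sq_nonneg ‖c p‖]
  · rw [adjoint_synth_apply position_injective.injOn _ hp, inner_smul_left,
      ContinuousLinearMap.adjoint_inner_left, Complex.conj_ofReal]
    push_cast
    ring
  · exact adjoint_synth_apply_of_notMem _ hj x

/-- The multiplier `ρ` of `J` need not be the `τ` of the side. With `ρ = τ` and `η = 1` the operator
stays bounded; with the opposite multiplier `τ'` and `η → 0` it vanishes in the limit. -/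
theorem exists_end_analysis (S : DyadicSide τ τ' b θ) (hs : spectrum ℝ B ⊆ Set.Icc 0 1)
    {ρ : ℝ → ℝ} (hJ : J ∘L adjoint J = cfc ρ B) (hρ : Continuous ρ) {a : ℝ} (ha : 0 < a) {η : ℝ}
    {M : ℕ} (hη : 0 ≤ η) (hρη : ∀ t ∈ Set.Icc (0 : ℝ) 1, ρ t * θ M t ≤ η * θ M t) {m : ℝ} (hm : 0 < m) :
    ∃ T : Set (L →L[ℂ] L), T.Finite ∧ ∀ f : ℕ → L, OrthogonalOrbits T f →
      (∀ i, m ^ 2 / 2 ≤ spectralForm B (f i) (θ M)) →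
      ∃ A : Ell2 →L[ℂ] Ell2, ‖A‖ ≤ 2 * a * Real.sqrt η / m ∧
        (∀ x, ∀ i < M, A x i = (a : ℂ) * (spectralForm B (f i) (θ M) : ℂ)⁻¹ *
          inner ℂ (cfc (θ M) B (f i)) (J x)) ∧ ∀ x i, M ≤ i → A x i = 0 := by
  have hθ := S.cont_end M
  refine ⟨{cfc (fun t => ρ t * θ M t * θ M t) B}, Set.finite_singleton _, fun f hf hf2 => ?_⟩
  set I : Finset (Unit × ℕ) := (Finset.univ : Finset Unit) ×ˢ Finset.range M
  have hinj : Set.InjOn (fun p : Unit × ℕ => p.2) I := fun p _ q _ h => Prod.ext rfl h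
  set s : ℕ → ℝ := fun i => spectralForm B (f i) (θ M) with hsdef
  refine ⟨adjoint (synth I (fun p => p.2) fun p => ((a * (s p.2)⁻¹ : ℝ) : ℂ) •
    adjoint J (cfc (θ M) B (f p.2))), ?_, fun x i hi => ?_, fun x j hj => ?_⟩
  · rw [LinearIsometryEquiv.norm_map]
    refine norm_synth_le hinj (by positivity) fun c => ?_
    simp only [smul_smul]
    refine (norm_sq_sum_adjoint_cfc_family hJ hρ hs Finset.univ (g := fun _ => θ M) (fun _ => hθ)
      (w := fun _ t => η * θ M t) (fun _ => hθ.const_mul _) (fun c t ht => ?_)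
      (Finset.range M) f ?_ _).trans ?_
    · simp only [Finset.univ_unique, Finset.sum_singleton]
      rw [mul_pow, mul_left_comm]
      refine mul_le_mul_of_nonneg_left ?_ (sq_nonneg _)
      have h1 := S.end_nonneg M t
      have h2 := mul_le_mul_of_nonneg_right (hρη t ht) h1
      have h3 := mul_le_of_le_one_right (mul_nonneg hη h1) (S.end_le_one M t)
      rw [sq, ← mul_assoc]
      exact h2.trans h3
    · intro i i' hi k hk l hl
      exact hf _ rfl i i' hi
    · rw [Finset.mul_sum, Finset.mul_sum]
      refine Finset.sum_le_sum fun p hp => ?_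
      rw [spectralForm_const_mul _ hθ, norm_mul, mul_pow, Complex.norm_real, Real.norm_eq_abs,
        sq_abs]
      have h1 : m ^ 2 / 2 ≤ s p.2 := hf2 p.2
      have h4 : 0 < s p.2 := lt_of_lt_of_le (by positivity) h1
      change 2 * (‖c p‖ ^ 2 * (a * (s p.2)⁻¹) ^ 2 * (η * s p.2)) ≤ _
      have h5 : 2 * (‖c p‖ ^ 2 * (a * (s p.2)⁻¹) ^ 2 * (η * s p.2))
          = ‖c p‖ ^ 2 * a ^ 2 * η * (2 / s p.2) := by
        field_simp
      have h6 : 2 / s p.2 ≤ 4 / m ^ 2 := by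
        rw [div_le_div_iff₀ h4 (by positivity)]; linarith
      rw [h5, div_pow, mul_pow, Real.sq_sqrt hη]
      calc ‖c p‖ ^ 2 * a ^ 2 * η * (2 / s p.2) ≤ ‖c p‖ ^ 2 * a ^ 2 * η * (4 / m ^ 2) := by gcongr
        _ = _ := by field_simp; ring
  · have h1 := adjoint_synth_apply hinj (fun p => ((a * (s p.2)⁻¹ : ℝ) : ℂ) •
      adjoint J (cfc (θ M) B (f p.2))) (p := ((), i)) (by simp [I, hi]) x
    refine h1.trans ?_
    rw [inner_smul_left, ContinuousLinearMap.adjoint_inner_left, Complex.conj_ofReal]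
    push_cast
    ring
  · refine adjoint_synth_apply_of_notMem _ (fun p hp h => ?_) x
    have := (Finset.mem_product.mp hp).2
    rw [Finset.mem_range] at this
    exact absurd this (by rw [h]; lia)

end DyadicSide

end SideOperators

/-! ### Truncations exhaust `ℓ₂`, with convergence in tame norms. -/

section TruncationLimits

open Filter Topology

theorem tendsto_box : Tendsto (fun M => (box M).image position) atTop atTop := by
  refine tendsto_atTop_finset_of_monotone (fun M M' h => ?_) fun m => ?_
  · refine Finset.image_subset_image (Finset.product_subset_product (fun k hk => ?_)
      (Finset.range_mono h))
    rw [Finset.mem_Ico] at hk ⊢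
    lia
  · refine ⟨max (Equiv.intEquivNat.symm m.unpair.1).natAbs m.unpair.2 + 1, ?_⟩
    refine Finset.mem_image.mpr ⟨(Equiv.intEquivNat.symm m.unpair.1, m.unpair.2), ?_, ?_⟩
    · refine Finset.mem_product.mpr ⟨Finset.mem_Ico.mpr ?_, Finset.mem_range.mpr ?_⟩
      · dsimp only
        lia
      · dsimp only
        lia
    · simp [position]

variable {n : ℕ} {h : ℝ} {N : Matrix (Fin n) (Fin n) Ell2 → ℝ}

namespace TameNorm

theorem map_le (hN : TameNorm h N) {T : Ell2 →L[ℂ] Ell2} {R : ℝ} (hT : ‖T‖ ≤ R)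
    (x : Matrix (Fin n) (Fin n) Ell2) : N (x.map T) ≤ h * R * N x :=
  (hN.hom T x).trans (mul_le_mul_of_nonneg_right
    (mul_le_mul_of_nonneg_left hT hN.const_nonneg) (hN.nonneg x))

theorem tendsto_zero (hN : TameNorm h N) {x : ℕ → Matrix (Fin n) (Fin n) Ell2}
    (hx : ∀ p q, Tendsto (fun M => x M p q) atTop (𝓝 0)) :
    Tendsto (fun M => N (x M)) atTop (𝓝 0) := by
  obtain ⟨c, hc, hle⟩ := hN.upper
  refine squeeze_zero (fun M => hN.nonneg _) (fun M => hle _) ?_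
  have h1 : Tendsto (fun M => c * ∑ p, ∑ q, ‖x M p q‖) atTop
      (𝓝 (c * ∑ p : Fin n, ∑ q : Fin n, ‖(0 : Ell2)‖)) :=
    (tendsto_finsetSum _ fun p _ => tendsto_finsetSum _ fun q _ => (hx p q).norm).const_mul c
  simpa using h1

theorem tendsto_sub_trunc (hN : TameNorm h N) {s : ℕ → Finset ℕ} (hs : Tendsto s atTop atTop)
    (v : Matrix (Fin n) (Fin n) Ell2) :
    Tendsto (fun M => N (v - v.map (trunc (s M)))) atTop (𝓝 0) := by
  refine hN.tendsto_zero fun p q => ?_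
  have := (tendsto_trunc hs (v p q)).const_sub (v p q)
  rwa [sub_self] at this

theorem le_add_sub (hN : TameNorm h N) (v w : Matrix (Fin n) (Fin n) Ell2) :
    N v ≤ N w + N (v - w) := by
  have := hN.add_le w (v - w)
  rwa [add_sub_cancel] at this

end TameNorm

end TruncationLimits

/-! ### Norms defined by lifts, and shifts to an orthonormal sequence. -/

section FixedSize

open ContinuousLinearMap Filter Topology

variable {L : Type*} [NormedAddCommGroup L] [InnerProductSpace ℂ L]

/-- `N(v)` is the infimum of `max (NX x) (NY y)` over the solutions of `a J₁ x + c J₂ y = V v`. -/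
structure LiftNorm {n : ℕ} (V : Ell2 →ₗᵢ[ℂ] L) (J₁ J₂ : Ell2 →L[ℂ] L) (a c : ℝ)
    (NX NY N : Matrix (Fin n) (Fin n) Ell2 → ℝ) : Prop where
  le_of_lift : ∀ v x y, (∀ p q, (a : ℂ) • J₁ (x p q) + (c : ℂ) • J₂ (y p q) = V (v p q)) →
    N v ≤ max (NX x) (NY y)
  exists_lift : ∀ v, ∀ r : ℝ, 0 < r → ∃ x y, (∀ p q,
    (a : ℂ) • J₁ (x p q) + (c : ℂ) • J₂ (y p q) = V (v p q)) ∧ NX x ≤ N v + r ∧ NY y ≤ N v + r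

variable {n : ℕ} {V : Ell2 →ₗᵢ[ℂ] L} {J₁ J₂ : Ell2 →L[ℂ] L} {a c : ℝ}
    {NX NY N : Matrix (Fin n) (Fin n) Ell2 → ℝ} {hX hY h : ℝ}

theorem LiftNorm.swap (hl : LiftNorm V J₁ J₂ a c NX NY N) : LiftNorm V J₂ J₁ c a NY NX N where
  le_of_lift v x y hxy := by
    rw [max_comm]
    exact hl.le_of_lift v y x fun p q => by rw [add_comm]; exact hxy p q
  exists_lift v r hr := by
    obtain ⟨x, y, h1, h2, h3⟩ := hl.exists_lift v r hr
    exact ⟨y, x, fun p q => by rw [add_comm]; exact h1 p q, h3, h2⟩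

/-- The operator that maps the standard basis vectors of index less than `M` to the `w i`. -/
noncomputable def shiftOp (w : ℕ → Ell2) (M : ℕ) : Ell2 →L[ℂ] Ell2 :=
  synth (Finset.range M) id w

theorem shiftOp_apply (w : ℕ → Ell2) (M : ℕ) (z : Ell2) :
    shiftOp w M z = ∑ i ∈ Finset.range M, z i • w i := synth_apply _ _ _ _

theorem norm_shiftOp_le {w : ℕ → Ell2} (hw : Orthonormal ℂ w) (M : ℕ) : ‖shiftOp w M‖ ≤ 1 := by
  refine norm_synth_le Function.injective_id.injOn zero_le_one fun k => ?_
  rw [one_pow, one_mul]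
  refine le_of_eq ?_
  rw [← inner_self_eq_norm_sq (𝕜 := ℂ), hw.inner_sum, map_sum]
  refine Finset.sum_congr rfl fun i _ => ?_
  rw [← Complex.normSq_eq_conj_mul_self, Complex.normSq_eq_norm_sq]
  exact Complex.ofReal_re _

theorem adjoint_shiftOp_shiftOp {w : ℕ → Ell2} (hw : Orthonormal ℂ w) (M : ℕ) (z : Ell2) :
    adjoint (shiftOp w M) (shiftOp w M z) = trunc (Finset.range M) z := by
  ext i
  rw [trunc_apply]
  by_cases hi : i ∈ Finset.range M
  · rw [if_pos hi, shiftOp_apply]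
    refine (adjoint_synth_apply (c := id) Function.injective_id.injOn w hi _).trans ?_
    exact hw.inner_right_sum (fun i => z i) hi
  · rw [if_neg hi]
    exact adjoint_synth_apply_of_notMem (c := id) w (fun p hp h => hi (by rwa [← show p = i from h])) _

/-- The norms of a matrix and of its image under the partial isometry `shiftOp`. -/
theorem TameNorm.trunc_le (hN : TameNorm h N) {w : ℕ → Ell2} (hw : Orthonormal ℂ w) (M : ℕ)
    (v : Matrix (Fin n) (Fin n) Ell2) :
    N (v.map (trunc (Finset.range M))) ≤ h * N (v.map (shiftOp w M)) := by
  have h1 := hN.map_le (T := adjoint (shiftOp w M)) (R := 1)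
    (by rw [LinearIsometryEquiv.norm_map]; exact norm_shiftOp_le hw M) (v.map (shiftOp w M))
  rw [mul_one] at h1
  convert h1 using 2
  ext1 p q
  exact (adjoint_shiftOp_shiftOp hw M _).symm

theorem TameNorm.shiftOp_le (hN : TameNorm h N) {w : ℕ → Ell2} (hw : Orthonormal ℂ w) (M : ℕ)
    (v : Matrix (Fin n) (Fin n) Ell2) : N (v.map (shiftOp w M)) ≤ h * N v := by
  simpa using hN.map_le (norm_shiftOp_le hw M) v

variable [CompleteSpace L]

/-- Testing `V (shiftOp w M z)` against a vector whose orbit is orthogonal to the `V (w i)`. -/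
theorem inner_cfc_shiftOp {B : L →L[ℂ] L} {w : ℕ → Ell2} {g : ℝ → ℝ}
    (hg : ∀ i i', i ≠ i' → inner ℂ (V (w i)) (cfc g B (V (w i'))) = 0) {M i : ℕ} (hi : i < M)
    (z : Ell2) : inner ℂ (cfc g B (V (w i))) (V (shiftOp w M z))
      = z i * (spectralForm B (V (w i)) g : ℂ) := by
  rw [shiftOp_apply, map_sum, inner_sum, Finset.sum_eq_single i]
  · rw [map_smul, inner_smul_right, inner_cfc_self]
  · intro j _ hj
    rw [map_smul, inner_smul_right, inner_cfc_left, hg i j hj.symm, mul_zero]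
  · exact fun h => (h (Finset.mem_range.mpr hi)).elim

end FixedSize

/-! ### The asymptotic distribution function and the terms of `X` and `Y`. -/

section IntersectionBounds

open ContinuousLinearMap Filter Topology

variable {L : Type*} [NormedAddCommGroup L] [InnerProductSpace ℂ L] [CompleteSpace L]
  {B : L →L[ℂ] L} {V : Ell2 →ₗᵢ[ℂ] L} {r : ℤ → ℝ}

namespace IsAsymptoticForm

theorem mem_Icc (hr : IsAsymptoticForm B V ramp r) (hB : IsSelfAdjoint B)
    (hs : spectrum ℝ B ⊆ Set.Icc 0 1) (k : ℤ) : r k ∈ Set.Icc (0 : ℝ) 1 := by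
  have key : ∀ δ : ℝ, 0 < δ → -δ ≤ r k ∧ r k ≤ 1 + δ := by
    intro δ hδ
    obtain ⟨w, hw, -, hk⟩ := hr ∅ {k} δ hδ
    have h1 := abs_lt.mp (hk k (by simp))
    have h2 := spectralForm_nonneg hs (continuous_ramp k) (fun t _ => ramp_nonneg k t) (V w)
    have h3 := spectralForm_mono hs (continuous_ramp k) (continuous_const (y := (1 : ℝ)))
      (fun t _ => ramp_le_one k t) (V w)
    rw [spectralForm_one hB, V.norm_map, hw, one_pow] at h3
    constructor <;> linarith
  constructor
  · exact le_of_forall_pos_le_add fun δ hδ => by linarith [(key δ hδ).1]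
  · exact le_of_forall_pos_le_add fun δ hδ => (key δ hδ).2

theorem succ_le (hr : IsAsymptoticForm B V ramp r)
    (hs : spectrum ℝ B ⊆ Set.Icc 0 1) (k : ℤ) : r (k + 1) ≤ r k := by
  refine le_of_forall_pos_le_add fun δ hδ => ?_
  obtain ⟨w, hw, -, hk⟩ := hr ∅ {k, k + 1} (δ / 2) (by positivity)
  have h1 := abs_lt.mp (hk k (by simp))
  have h2 := abs_lt.mp (hk (k + 1) (by simp))
  have h3 := spectralForm_mono hs (continuous_ramp (k + 1)) (continuous_ramp k)
    (fun t _ => ramp_succ_le k t) (V w)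
  linarith

theorem exists_sequence (hr : IsAsymptoticForm B V ramp r) (hB : IsSelfAdjoint B)
    {T : Set (L →L[ℂ] L)} (hT : T.Finite) (M : ℕ) {δ : ℝ} (hδ : 0 < δ) :
    ∃ w : ℕ → Ell2, Orthonormal ℂ w ∧ OrthogonalOrbits T (fun i => V (w i)) ∧
      ∀ i, (∀ k ∈ Finset.Ico (-(M : ℤ)) M,
          |spectralForm B (V (w i)) (bump k) - (r k - r (k + 1))| < δ) ∧
        |spectralForm B (V (w i)) (ramp M) - r M| < δ ∧
        |spectralForm B (V (w i)) (fun t => 1 - ramp (-M) t) - (1 - r (-M))| < δ := by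
  -- Half the tolerance, because a bump is the difference of two ramps.
  obtain ⟨w, h1, h2, h3, h4⟩ := exists_asymptotic_sequence V hr hT (Finset.Icc (-(M : ℤ)) M)
    (δ := δ / 2) (by positivity)
  refine ⟨w, ⟨h1, fun i i' h => h2 i i' h⟩, h3, fun i => ⟨fun k hk => ?_, ?_, ?_⟩⟩
  · rw [Finset.mem_Ico] at hk
    have h5 := abs_lt.mp (h4 i k (Finset.mem_Icc.mpr ⟨hk.1, hk.2.le⟩))
    have h6 := abs_lt.mp (h4 i (k + 1) (Finset.mem_Icc.mpr ⟨by lia, by lia⟩))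
    have h7 : spectralForm B (V (w i)) (bump k) = spectralForm B (V (w i)) (ramp k)
        - spectralForm B (V (w i)) (ramp (k + 1)) :=
      spectralForm_sub (continuous_ramp k) (continuous_ramp (k + 1)) _
    rw [h7, abs_lt]
    constructor <;> linarith
  · exact (h4 i M (by simp)).trans (by linarith)
  · have h5 := abs_lt.mp (h4 i (-M) (by simp))
    rw [spectralForm_sub continuous_const (continuous_ramp _), spectralForm_one hB, V.norm_map,
      h1 i, abs_lt]
    constructor <;> linarith

end IsAsymptoticForm

variable {J J' : Ell2 →L[ℂ] L} {a c : ℝ} {n : ℕ} {NX NY N : Matrix (Fin n) (Fin n) Ell2 → ℝ}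
  {hX hY h : ℝ}

/-- Pair a lift of the shifted `v` with `θ M (B) V (w i)`. This gives `v`, truncated to its first
`M` coordinates, as `A x + A' y` with `‖A‖ ≤ 2 a / m`, while `A' → 0` because `τ'` is small on the
support of `θ M`. Homogeneity bounds `A x`, and in the limit only this term remains. -/
theorem end_bound {τ τ' : ℝ → ℝ} {b : ℤ → ℝ} {θ : ℕ → ℝ → ℝ} (S : DyadicSide τ τ' b θ)
    (hs : spectrum ℝ B ⊆ Set.Icc 0 1) (hτ' : Continuous τ')
    (hJ : J ∘L adjoint J = cfc τ B) (hJ' : J' ∘L adjoint J' = cfc τ' B) (ha : 0 < a) (hc : 0 < c)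
    (hNX : TameNorm hX NX) (hNY : TameNorm hY NY) (hN : TameNorm h N)
    (hl : LiftNorm V J J' a c NX NY N) {R : ℕ → ℝ}
    (hR : ∀ (T : Set (L →L[ℂ] L)), T.Finite → ∀ (M : ℕ) (δ : ℝ), 0 < δ → ∃ w : ℕ → Ell2,
      Orthonormal ℂ w ∧ OrthogonalOrbits T (fun i => V (w i)) ∧
        ∀ i, |spectralForm B (V (w i)) (θ M) - R M| < δ)
    {m : ℝ} (hm : 0 ≤ m) (hmR : ∀ M, m ^ 2 ≤ R M) (v : Matrix (Fin n) (Fin n) Ell2) :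
    m / a * NX v ≤ 2 * hX * h * N v := by
  rcases hm.eq_or_lt with rfl | hm
  · rw [zero_div, zero_mul]
    have := hNX.const_nonneg
    have := hN.const_nonneg
    have := hN.nonneg v
    positivity
  obtain ⟨η, hη, hη0, hηθ⟩ := S.end_small
  obtain ⟨cX, hcX, hupper⟩ := hNX.upper
  obtain ⟨cY, hcY, hlower⟩ := hNY.lower
  have key : ∀ M : ℕ, NX v ≤ hX * (2 * a / m) * (h * N v + 1 / ((M : ℝ) + 1))
      + cX * (n * (n * (2 * c * Real.sqrt (η M) / m * (cY * (h * N v + 1 / ((M : ℝ) + 1))))))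
      + NX (v - v.map (trunc (Finset.range M))) := by
    intro M
    have hrpos : (0 : ℝ) < 1 / ((M : ℝ) + 1) := by positivity
    obtain ⟨T₁, hT₁, h1⟩ := S.exists_end_analysis hs hJ S.cont ha (M := M) zero_le_one
      (fun t ht => mul_le_mul_of_nonneg_right (S.le_one t ht) (S.end_nonneg M t)) hm
    obtain ⟨T₂, hT₂, h2⟩ := S.exists_end_analysis hs hJ' hτ' hc (hη0 M) (fun t _ => hηθ M t) hm
    obtain ⟨w, hw, hT, hwR⟩ := hR (T₁ ∪ T₂ ∪ {cfc (θ M) B})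
      ((hT₁.union hT₂).union (Set.finite_singleton _)) M (m ^ 2 / 2) (by positivity)
    have hlow : ∀ i, m ^ 2 / 2 ≤ spectralForm B (V (w i)) (θ M) := fun i => by
      have h3 := (abs_lt.mp (hwR i)).1
      have h4 := hmR M
      linarith
    obtain ⟨A, hA, hA1, hA2⟩ := h1 _ (hT.mono fun S hS => Or.inl (Or.inl hS)) hlow
    obtain ⟨A', hA', hA'1, hA'2⟩ := h2 _ (hT.mono fun S hS => Or.inl (Or.inr hS)) hlow
    rw [Real.sqrt_one, mul_one] at hA
    obtain ⟨x, y, hxy, hx, hy⟩ := hl.exists_lift (v.map (shiftOp w M)) _ hrpos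
    have h3 := hN.shiftOp_le hw M v
    have htr : v.map (trunc (Finset.range M)) = x.map A + y.map A' := by
      ext p q i
      have h5 : ((x.map A + y.map A') p q) i = A (x p q) i + A' (y p q) i := rfl
      rw [h5, Matrix.map_apply, trunc_apply]
      by_cases hi : i < M
      · rw [if_pos (Finset.mem_range.mpr hi), hA1 _ i hi, hA'1 _ i hi]
        have h6 := inner_cfc_shiftOp (V := V) (B := B) (w := w) (g := θ M)
          (fun i i' hii => hT _ (Or.inr rfl) i i' hii) hi (v p q)
        have h7 := hxy p q
        rw [Matrix.map_apply] at h7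
        rw [← h7, inner_add_right, inner_smul_right, inner_smul_right] at h6
        have h8 : (spectralForm B (V (w i)) (θ M) : ℂ) ≠ 0 := by
          have := hlow i
          have : 0 < m ^ 2 / 2 := by positivity
          exact_mod_cast (show spectralForm B (V (w i)) (θ M) ≠ 0 by linarith)
        rw [eq_comm, mul_right_comm, mul_right_comm (c : ℂ), ← add_mul, h6, mul_assoc,
          mul_inv_cancel₀ h8, mul_one]
      · rw [if_neg (by simpa using hi), hA2 _ i (not_lt.mp hi), hA'2 _ i (not_lt.mp hi), add_zero]
    have h9 := hNX.le_add_sub v (v.map (trunc (Finset.range M)))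
    have h10 : NX (v.map (trunc (Finset.range M))) ≤ NX (x.map A) + NX (y.map A') := by
      rw [htr]
      exact hNX.add_le _ _
    have h11 : NX (x.map A) ≤ hX * (2 * a / m) * (h * N v + 1 / ((M : ℝ) + 1)) :=
      (hNX.map_le hA x).trans (mul_le_mul_of_nonneg_left (by linarith)
        (mul_nonneg hNX.const_nonneg (by positivity)))
    have h12 : ∀ p q, ‖(y.map A') p q‖ ≤ 2 * c * Real.sqrt (η M) / m *
        (cY * (h * N v + 1 / ((M : ℝ) + 1))) := fun p q => by
      refine (A'.le_opNorm _).trans (mul_le_mul hA' ?_ (norm_nonneg _) (by positivity))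
      exact (hlower y p q).trans (mul_le_mul_of_nonneg_left (by linarith) hcY)
    -- The matrix `y` is controlled in `NY`, not in `NX`, so the bound goes through the entries. The
    -- factors depending on `n` are harmless since they multiply `√(η M)`.
    have h13 : NX (y.map A') ≤ cX * (n * (n * (2 * c * Real.sqrt (η M) / m *
        (cY * (h * N v + 1 / ((M : ℝ) + 1)))))) := by
      refine (hupper _).trans (mul_le_mul_of_nonneg_left ?_ hcX)
      have h14 : ∀ p, ∑ q, ‖(y.map A') p q‖ ≤ n * (2 * c * Real.sqrt (η M) / m *
          (cY * (h * N v + 1 / ((M : ℝ) + 1)))) := fun p => by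
        simpa using Finset.sum_le_card_nsmul Finset.univ _ _ fun q _ => h12 p q
      simpa using Finset.sum_le_card_nsmul Finset.univ _ _ fun p _ => h14 p
    linarith
  have hone : Tendsto (fun M : ℕ => h * N v + 1 / ((M : ℝ) + 1)) atTop (𝓝 (h * N v + 0)) :=
    tendsto_one_div_add_atTop_nhds_zero_nat.const_add _
  have hsq : Tendsto (fun M => 2 * c * Real.sqrt (η M) / m) atTop (𝓝 (2 * c * 0 / m)) := by
    have := (Real.continuous_sqrt.tendsto 0).comp hη
    rw [Real.sqrt_zero] at this
    exact (this.const_mul _).div_const _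
  have hlim := ((hone.const_mul (hX * (2 * a / m))).add
    ((((hsq.mul (hone.const_mul cY)).const_mul (n : ℝ)).const_mul (n : ℝ)).const_mul cX)).add
    (hNX.tendsto_sub_trunc tendsto_finset_range v)
  have hle := ge_of_tendsto' hlim key
  have h15 : m / a * NX v ≤ m / a * (hX * (2 * a / m) * (h * N v)) := by
    refine mul_le_mul_of_nonneg_left ?_ (by positivity)
    simpa using hle
  refine h15.trans (le_of_eq ?_)
  field_simp

end IntersectionBounds

/-! ### Lifts versus decompositions of constant sequences. -/

section ConstantSequences

open ContinuousLinearMap Filter Topology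

theorem exists_pos_forall_le {ι : Type*} (I : Finset ι) {ε : ι → ℝ} (hε : ∀ k, 0 < ε k) :
    ∃ δ : ℝ, 0 < δ ∧ ∀ k ∈ I, δ ≤ ε k := by
  classical
  induction I using Finset.induction_on with
  | empty => exact ⟨1, one_pos, by simp⟩
  | insert k I _ ih =>
    obtain ⟨δ, hδ, h⟩ := ih
    refine ⟨min δ (ε k), lt_min hδ (hε k), fun l hl => ?_⟩
    rcases Finset.mem_insert.mp hl with rfl | hl
    · exact min_le_right _ _
    · exact (min_le_left _ _).trans (h l hl)

theorem position_symm_eq (j i : ℕ) : position (Equiv.intEquivNat.symm j, i) = Nat.pair j i := by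
  simp [position]

/-- The part of the constant sequence `z` that is supported on a set of indices on which the weight
is summable. -/
noncomputable def restrictConst (u : ℕ → ℝ) (P : ℕ → Prop) [DecidablePred P]
    (hu : Summable fun j => if P j then u j else 0) (z : Ell2) : WeightedEll2 u :=
  ⟨fun j => if P j then z else 0, by
    refine (hu.mul_right (‖z‖ ^ 2)).congr fun j => ?_
    by_cases h : P j <;> simp [h]⟩

variable {L : Type*} [NormedAddCommGroup L] [InnerProductSpace ℂ L] [CompleteSpace L]
  {B : L →L[ℂ] L} {V : Ell2 →ₗᵢ[ℂ] L} {r : ℤ → ℝ}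
  {J₁ J₂ : Ell2 →L[ℂ] L} {a c : ℝ} {n : ℕ} {NX NY N : Matrix (Fin n) (Fin n) Ell2 → ℝ}
  {hX hY h : ℝ}

/-- A lift of the shifted `v` is analysed on both sides with the same test vectors, so at each index
of a finite box the two coordinates add up to that of `v`. Outside the box an arbitrary
decomposition of finite norm will do, because its tail is small. -/
theorem exists_const_decomposition (hB : IsSelfAdjoint B) (hs : spectrum ℝ B ⊆ Set.Icc 0 1)
    (hJ₁ : J₁ ∘L adjoint J₁ = cfc (fun t : ℝ => t) B)
    (hJ₂ : J₂ ∘L adjoint J₂ = cfc (fun t : ℝ => 1 - t) B) (ha : 0 < a) (hc : 0 < c)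
    (hNX : TameNorm hX NX) (hNY : TameNorm hY NY) (hN : TameNorm h N)
    (hl : LiftNorm V J₁ J₂ a c NX NY N) (hr : IsAsymptoticForm B V ramp r) {ε uX uY : ℤ → ℝ}
    (hε : ∀ k, 0 < ε k) (hεX : ∀ I : Finset ℤ, ∑ k ∈ I, ε k / node k ≤ 1)
    (hεY : ∀ I : Finset ℤ, ∑ k ∈ I, ε k / (1 - node k) ≤ 1)
    (huX : ∀ k, 0 < uX k) (huY : ∀ k, 0 < uY k)
    (huXr : ∀ k, a ^ 2 * node k * uX k = r k - r (k + 1) + ε k)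
    (huYr : ∀ k, c ^ 2 * (1 - node k) * uY k = r k - r (k + 1) + ε k)
    (hW : Summable fun j : ℕ => min (uX (Equiv.intEquivNat.symm j)) (uY (Equiv.intEquivNat.symm j)))
    (v : Matrix (Fin n) (Fin n) Ell2) {ρ : ℝ} (hρ : 0 < ρ) :
    ∃ (x : Matrix (Fin n) (Fin n) (WeightedEll2 fun j => uX (Equiv.intEquivNat.symm j)))
      (y : Matrix (Fin n) (Fin n) (WeightedEll2 fun j => uY (Equiv.intEquivNat.symm j))),
      (∀ p q j, v p q = (x p q).1 j + (y p q).1 j) ∧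
      NX (x.map (flatten _)) ≤ hX * 6 * (h * N v + ρ) + ρ ∧
      NY (y.map (flatten _)) ≤ hY * 6 * (h * N v + ρ) + ρ := by
  classical
  set e := Equiv.intEquivNat
  set u₁ : ℕ → ℝ := fun j => uX (e.symm j)
  set u₂ : ℕ → ℝ := fun j => uY (e.symm j)
  have hu₁ : ∀ j, 0 < u₁ j := fun j => huX _
  have hu₂ : ∀ j, 0 < u₂ j := fun j => huY _
  -- The default decomposition puts the whole of `v` at index `j` on the side with the smaller
  -- weight; (W) says that both parts have finite norm.
  have hsum₁ : Summable fun j => if u₁ j ≤ u₂ j then u₁ j else 0 := by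
    refine Summable.of_nonneg_of_le (fun j => ?_) (fun j => ?_) hW
    · split_ifs
      exacts [(hu₁ j).le, le_rfl]
    · split_ifs with h1
      exacts [(min_eq_left h1).ge, (lt_min (hu₁ j) (hu₂ j)).le]
  have hsum₂ : Summable fun j => if ¬ u₁ j ≤ u₂ j then u₂ j else 0 := by
    refine Summable.of_nonneg_of_le (fun j => ?_) (fun j => ?_) hW
    · split_ifs
      exacts [le_rfl, (hu₂ j).le]
    · split_ifs with h1
      exacts [(lt_min (hu₁ j) (hu₂ j)).le, (min_eq_right (not_le.mp h1).le).ge]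
  set z₁ : Matrix (Fin n) (Fin n) Ell2 := v.map fun z => flatten u₁ (restrictConst u₁ _ hsum₁ z)
  set z₂ : Matrix (Fin n) (Fin n) Ell2 := v.map fun z => flatten u₂ (restrictConst u₂ _ hsum₂ z)
  obtain ⟨M, hM₁, hM₂⟩ := (((hNX.tendsto_sub_trunc tendsto_box z₁).eventually_lt_const hρ).and
    ((hNY.tendsto_sub_trunc tendsto_box z₂).eventually_lt_const hρ)).exists
  obtain ⟨T₁, hT₁, h1⟩ := dyadicSide_left.exists_central_analysis hJ₁ hs ha huX hε hεX huXr M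
  obtain ⟨T₂, hT₂, h2⟩ := dyadicSide_right.exists_central_analysis hJ₂ hs hc huY hε hεY huYr M
  set T₃ : Set (L →L[ℂ] L) := (fun k => cfc (fun t => bump k t + ε k) B) ''
    (Finset.Ico (-(M : ℤ)) M : Finset ℤ)
  -- An error of at most `ε k / 2` leaves at least half of the mass `r k - r (k + 1) + ε k`.
  obtain ⟨δ, hδ, hδε⟩ := exists_pos_forall_le (Finset.Ico (-(M : ℤ)) M) (ε := fun k => ε k / 2)
    fun k => half_pos (hε k)
  obtain ⟨w, hw, hT, hwr⟩ := hr.exists_sequence hB (T := T₁ ∪ T₂ ∪ T₃)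
    ((hT₁.union hT₂).union ((Finset.finite_toSet _).image _)) M hδ
  have hlow : ∀ i, ∀ k ∈ Finset.Ico (-(M : ℤ)) M, (r k - r (k + 1) + ε k) / 2
      ≤ spectralForm B (V (w i)) (fun t => bump k t + ε k) := fun i k hk => by
    have h3 := (abs_lt.mp ((hwr i).1 k hk)).1
    have h4 := hδε k hk
    have h5 := hr.succ_le hs k
    rw [spectralForm_add (continuous_bump k) continuous_const]
    have h6 := spectralForm_const_mul (B := B) (ε k) (g := fun _ => 1) (by fun_prop) (V (w i))
    rw [spectralForm_one hB, V.norm_map, hw.1 i] at h6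
    simp only [mul_one, one_pow] at h6
    rw [h6]
    linarith
  obtain ⟨A, hA, hA1, hA2⟩ := h1 _ (hT.mono fun S hS => Or.inl (Or.inl hS)) hlow
  obtain ⟨A', hA', hA'1, hA'2⟩ := h2 _ (hT.mono fun S hS => Or.inl (Or.inr hS)) hlow
  obtain ⟨x, y, hxy, hx, hy⟩ := hl.exists_lift (v.map (shiftOp w M)) _ hρ
  have hsh := hN.shiftOp_le hw M v
  set s := (box M).image position
  have hxX : NX (x.map A + (z₁ - z₁.map (trunc s))) ≤ hX * 6 * (h * N v + ρ) + ρ :=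
    (hNX.add_le _ _).trans (add_le_add ((hNX.map_le hA x).trans (mul_le_mul_of_nonneg_left
      (by linarith) (mul_nonneg hNX.const_nonneg (by norm_num)))) hM₁.le)
  have hyY : NY (y.map A' + (z₂ - z₂.map (trunc s))) ≤ hY * 6 * (h * N v + ρ) + ρ :=
    (hNY.add_le _ _).trans (add_le_add ((hNY.map_le hA' y).trans (mul_le_mul_of_nonneg_left
      (by linarith) (mul_nonneg hNY.const_nonneg (by norm_num)))) hM₂.le)
  -- The analysed lift lives on the box and the tail of the default decomposition on its complement,
  -- so exactly one of them contributes at each coordinate.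
  refine ⟨(x.map A + (z₁ - z₁.map (trunc s))).map (unflatten u₁ hu₁),
    (y.map A' + (z₂ - z₂.map (trunc s))).map (unflatten u₂ hu₂), fun p q j => ?_, ?_, ?_⟩
  · ext i
    have hs₁ : ((Real.sqrt (u₁ j) : ℝ) : ℂ) ≠ 0 := by
      exact_mod_cast (Real.sqrt_pos.mpr (hu₁ j)).ne'
    have hs₂ : ((Real.sqrt (u₂ j) : ℝ) : ℂ) ≠ 0 := by
      exact_mod_cast (Real.sqrt_pos.mpr (hu₂ j)).ne'
    have hz₁ : z₁ p q (Nat.pair j i)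
        = ((Real.sqrt (u₁ j) : ℝ) : ℂ) * (if u₁ j ≤ u₂ j then v p q else 0 : Ell2) i :=
      flatten_apply u₁ _ j i
    have hz₂ : z₂ p q (Nat.pair j i)
        = ((Real.sqrt (u₂ j) : ℝ) : ℂ) * (if ¬ u₁ j ≤ u₂ j then v p q else 0 : Ell2) i :=
      flatten_apply u₂ _ j i
    change v p q i = (unflatten u₁ hu₁ (A (x p q) + (z₁ p q - trunc s (z₁ p q)))).1 j i
      + (unflatten u₂ hu₂ (A' (y p q) + (z₂ p q - trunc s (z₂ p q)))).1 j i
    rw [unflatten_apply, unflatten_apply]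
    change v p q i = ((Real.sqrt (u₁ j) : ℝ) : ℂ)⁻¹ * (A (x p q) (Nat.pair j i) +
        (z₁ p q (Nat.pair j i) - trunc s (z₁ p q) (Nat.pair j i)))
      + ((Real.sqrt (u₂ j) : ℝ) : ℂ)⁻¹ * (A' (y p q) (Nat.pair j i) +
        (z₂ p q (Nat.pair j i) - trunc s (z₂ p q) (Nat.pair j i)))
    rw [trunc_apply, trunc_apply]
    by_cases hp : (e.symm j, i) ∈ box M
    · have hmem : Nat.pair j i ∈ s := by
        rw [← position_symm_eq]
        exact Finset.mem_image_of_mem _ hp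
      obtain ⟨hk, hi⟩ := Finset.mem_product.mp hp
      have hA1' := hA1 (x p q) _ hp
      have hA'1' := hA'1 (y p q) _ hp
      rw [position_symm_eq] at hA1' hA'1'
      rw [if_pos hmem, if_pos hmem, sub_self, sub_self, add_zero, add_zero, hA1', hA'1']
      dsimp only
      rw [inv_mul_cancel_left₀ hs₁, inv_mul_cancel_left₀ hs₂]
      have h6 := inner_cfc_shiftOp (V := V) (B := B) (w := w)
        (g := fun t => bump (e.symm j) t + ε (e.symm j))
        (fun i i' hii => hT _ (Or.inr ⟨_, hk, rfl⟩) i i' hii) (Finset.mem_range.mp hi) (v p q)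
      have h7 := hxy p q
      rw [Matrix.map_apply] at h7
      rw [← h7, inner_add_right, inner_smul_right, inner_smul_right] at h6
      have h8 : (spectralForm B (V (w i)) (fun t => bump (e.symm j) t + ε (e.symm j)) : ℂ) ≠ 0 := by
        have h9 := hlow i _ hk
        have h10 := hr.succ_le hs (e.symm j)
        have h11 := hε (e.symm j)
        exact_mod_cast (show spectralForm B (V (w i)) _ ≠ 0 by linarith)
      rw [mul_right_comm, mul_right_comm (c : ℂ), ← add_mul, h6, mul_assoc,
        mul_inv_cancel₀ h8, mul_one]
    · have hmem : ∀ t ∈ box M, position t ≠ Nat.pair j i := by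
        intro t ht hti
        rw [← position_symm_eq] at hti
        exact hp (position_injective hti ▸ ht)
      have hmem' : Nat.pair j i ∉ s := fun h => by
        obtain ⟨t, ht, hti⟩ := Finset.mem_image.mp h
        exact hmem t ht hti
      rw [if_neg hmem', if_neg hmem', hA2 _ _ hmem, hA'2 _ _ hmem, zero_add, zero_add, sub_zero,
        sub_zero, hz₁, hz₂, inv_mul_cancel_left₀ hs₁, inv_mul_cancel_left₀ hs₂]
      split_ifs with h1 <;> simp
  · rw [Matrix.map_map]
    convert hxX using 2
    ext1 p q
    exact flatten_unflatten u₁ hu₁ _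
  · rw [Matrix.map_map]
    convert hyY using 2
    ext1 p q
    exact flatten_unflatten u₂ hu₂ _

/-- A lift of the shifted `v` is assembled from the decomposition on the central pieces and from `v`
itself at the two ends, through `x` near `t = 1` and through `y` near `t = 0`. As `M → ∞` the end
masses tend to `s²` and `t²`, so the end terms are paid for by `s / a * NX v` and `t / c * NY v`. -/
theorem norm_le_of_const_decomposition (hB : IsSelfAdjoint B) (hs : spectrum ℝ B ⊆ Set.Icc 0 1)
    (hJ₁ : J₁ ∘L adjoint J₁ = cfc (fun t : ℝ => t) B)
    (hJ₂ : J₂ ∘L adjoint J₂ = cfc (fun t : ℝ => 1 - t) B) (ha : 0 < a) (hc : 0 < c)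
    (hNX : TameNorm hX NX) (hNY : TameNorm hY NY) (hN : TameNorm h N)
    (hl : LiftNorm V J₁ J₂ a c NX NY N) (hr : IsAsymptoticForm B V ramp r) {ε uX uY : ℤ → ℝ}
    (hε : ∀ k, 0 < ε k) (huX : ∀ k, 0 < uX k) (huY : ∀ k, 0 < uY k)
    (huXr : ∀ k, a ^ 2 * node k * uX k = r k - r (k + 1) + ε k)
    (huYr : ∀ k, c ^ 2 * (1 - node k) * uY k = r k - r (k + 1) + ε k)
    {s t : ℝ} (hst : Tendsto (fun M : ℕ => r M) atTop (𝓝 (s ^ 2)))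
    (htt : Tendsto (fun M : ℕ => 1 - r (-M)) atTop (𝓝 (t ^ 2))) (hs0 : 0 ≤ s) (ht0 : 0 ≤ t)
    (v : Matrix (Fin n) (Fin n) Ell2) {ρ : ℝ}
    (x : Matrix (Fin n) (Fin n) (WeightedEll2 fun j => uX (Equiv.intEquivNat.symm j)))
    (y : Matrix (Fin n) (Fin n) (WeightedEll2 fun j => uY (Equiv.intEquivNat.symm j)))
    (hv : ∀ p q j, v p q = (x p q).1 j + (y p q).1 j)
    (hx : NX (x.map (flatten _)) ≤ ρ) (hy : NY (y.map (flatten _)) ≤ ρ)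
    (hsv : s / a * NX v ≤ ρ) (htv : t / c * NY v ≤ ρ) :
    N v ≤ 5 * h * max hX hY * ρ := by
  have key : ∀ M : ℕ, 1 ≤ M → N v ≤ h * max
      (hX * 3 * ρ + hX * (2 * Real.sqrt (r M + 1 / ((M : ℝ) + 1)) / a) * NX v)
      (hY * 3 * ρ + hY * (2 * Real.sqrt (1 - r (-M) + 1 / ((M : ℝ) + 1)) / c) * NY v)
      + N (v - v.map (trunc (Finset.range M))) := by
    intro M hM
    have hpos : (0 : ℝ) < 1 / ((M : ℝ) + 1) := by positivity
    obtain ⟨T₁, hT₁, h1⟩ := dyadicSide_left.exists_central_synthesis hJ₁ hs ha huX huXr M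
    obtain ⟨T₂, hT₂, h2⟩ := dyadicSide_right.exists_central_synthesis hJ₂ hs hc huY huYr M
    obtain ⟨T₃, hT₃, h3⟩ := dyadicSide_left.exists_end_synthesis hJ₁ hs ha hM
    obtain ⟨T₄, hT₄, h4⟩ := dyadicSide_right.exists_end_synthesis hJ₂ hs hc hM
    obtain ⟨δ, hδ, hδε⟩ := exists_pos_forall_le (Finset.Ico (-(M : ℤ)) M) hε
    obtain ⟨w, hw, hT, hwr⟩ := hr.exists_sequence hB (T := (T₁ ∪ T₂) ∪ (T₃ ∪ T₄))
      ((hT₁.union hT₂).union (hT₃.union hT₄)) M (lt_min hδ hpos)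
    have hup : ∀ i, ∀ k ∈ Finset.Ico (-(M : ℤ)) M,
        spectralForm B (V (w i)) (bump k) ≤ r k - r (k + 1) + ε k := fun i k hk => by
      have h5 := (abs_lt.mp (((hwr i).1 k hk).trans_le (min_le_left _ _))).2
      linarith [hδε k hk]
    obtain ⟨A₁, hA₁, hA₁'⟩ := h1 _ (hT.mono fun S hS => Or.inl (Or.inl hS)) hup
    obtain ⟨A₂, hA₂, hA₂'⟩ := h2 _ (hT.mono fun S hS => Or.inl (Or.inr hS)) hup
    have hend₁ : ∀ i, spectralForm B (V (w i)) (ramp M) ≤ r M + 1 / ((M : ℝ) + 1) := fun i => by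
      have h5 := (abs_lt.mp (((hwr i).2.1).trans_le (min_le_right _ _))).2
      linarith
    have hend₂ : ∀ i, spectralForm B (V (w i)) (fun t => 1 - ramp (-M) t)
        ≤ 1 - r (-M) + 1 / ((M : ℝ) + 1) := fun i => by
      have h5 := (abs_lt.mp (((hwr i).2.2).trans_le (min_le_right _ _))).2
      linarith
    have hnn₁ : 0 ≤ r M + 1 / ((M : ℝ) + 1) :=
      (spectralForm_nonneg hs (continuous_ramp M) (fun t _ => ramp_nonneg _ t) _).trans (hend₁ 0)
    have hnn₂ : 0 ≤ 1 - r (-M) + 1 / ((M : ℝ) + 1) :=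
      (spectralForm_nonneg hs (dyadicSide_right.cont_end M)
        (fun t _ => dyadicSide_right.end_nonneg M t) _).trans (hend₂ 0)
    obtain ⟨A₃, hA₃, hA₃'⟩ := h3 _ (hT.mono fun S hS => Or.inr (Or.inl hS)) _ (Real.sqrt_nonneg _)
      (by rw [Real.sq_sqrt hnn₁]; exact hend₁)
    obtain ⟨A₄, hA₄, hA₄'⟩ := h4 _ (hT.mono fun S hS => Or.inr (Or.inr hS)) _ (Real.sqrt_nonneg _)
      (by rw [Real.sq_sqrt hnn₂]; exact hend₂)
    have hlift : ∀ p q, (a : ℂ) • J₁ (((x.map (flatten _)).map A₁ + v.map A₃) p q)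
        + (c : ℂ) • J₂ (((y.map (flatten _)).map A₂ + v.map A₄) p q)
        = V (v.map (shiftOp w M) p q) := by
      intro p q
      change (a : ℂ) • J₁ (A₁ (flatten _ (x p q)) + A₃ (v p q))
        + (c : ℂ) • J₂ (A₂ (flatten _ (y p q)) + A₄ (v p q)) = V (shiftOp w M (v p q))
      rw [map_add, map_add, smul_add, smul_add, hA₁', hA₂', hA₃', hA₄', shiftOp_apply, map_sum,
        box, Finset.sum_product_right, Finset.sum_product_right, add_add_add_comm,
        ← Finset.sum_add_distrib, ← Finset.sum_add_distrib, ← Finset.sum_add_distrib]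
      refine Finset.sum_congr rfl fun i _ => ?_
      have h5 : ∀ k : ℤ, ((Real.sqrt (uX k) : ℝ) : ℂ)⁻¹ * flatten _ (x p q) (position (k, i))
          = (x p q).1 (Equiv.intEquivNat k) i := fun k => by
        have h6 := flatten_apply _ (x p q) (Equiv.intEquivNat k) i
        simp only [Equiv.symm_apply_apply] at h6
        rw [position, h6, inv_mul_cancel_left₀]
        exact_mod_cast (Real.sqrt_pos.mpr (huX k)).ne'
      have h5' : ∀ k : ℤ, ((Real.sqrt (uY k) : ℝ) : ℂ)⁻¹ * flatten _ (y p q) (position (k, i))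
          = (y p q).1 (Equiv.intEquivNat k) i := fun k => by
        have h6 := flatten_apply _ (y p q) (Equiv.intEquivNat k) i
        simp only [Equiv.symm_apply_apply] at h6
        rw [position, h6, inv_mul_cancel_left₀]
        exact_mod_cast (Real.sqrt_pos.mpr (huY k)).ne'
      have h7 : ∀ k : ℤ, (x p q).1 (Equiv.intEquivNat k) i + (y p q).1 (Equiv.intEquivNat k) i = v p q i := fun k => by
        rw [hv p q (Equiv.intEquivNat k)]; rfl
      -- The bumps telescope, and with the two end functions they form a partition of unity.
      have h8 : ∑ k ∈ Finset.Ico (-(M : ℤ)) M, cfc (bump k) B (V (w i))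
          + (cfc (ramp M) B (V (w i)) + cfc (fun t => 1 - ramp (-M) t) B (V (w i))) = V (w i) := by
        rw [← cfc_apply_sum _ continuous_bump, ← cfc_apply_add (continuous_ramp M)
          (dyadicSide_right.cont_end M), ← cfc_apply_add
          (h := fun t => ramp M t + (1 - ramp (-M) t))
          (continuous_finsetSum _ fun k _ => continuous_bump k)
          ((continuous_ramp M).add (dyadicSide_right.cont_end M))]
        have h9 : (fun t => ∑ k ∈ Finset.Ico (-(M : ℤ)) M, bump k t
            + (ramp M t + (1 - ramp (-M) t))) = fun _ => (1 : ℝ) := by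
          ext t
          rw [sum_bump]
          ring
        rw [h9, cfc_const_one ℝ B]
        rfl
      simp only [h5, h5']
      rw [← Finset.sum_add_distrib]
      simp only [← add_smul, h7]
      rw [← Finset.smul_sum, ← smul_add, ← smul_add, h8, map_smul]
    have hle := hl.le_of_lift _ _ _ hlift
    have h10 : NX ((x.map (flatten _)).map A₁ + v.map A₃) ≤ hX * 3 * ρ
        + hX * (2 * Real.sqrt (r M + 1 / ((M : ℝ) + 1)) / a) * NX v :=
      (hNX.add_le _ _).trans (add_le_add ((hNX.map_le hA₁ _).trans (mul_le_mul_of_nonneg_left hx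
        (mul_nonneg hNX.const_nonneg (by norm_num)))) (hNX.map_le hA₃ _))
    have h11 : NY ((y.map (flatten _)).map A₂ + v.map A₄) ≤ hY * 3 * ρ
        + hY * (2 * Real.sqrt (1 - r (-M) + 1 / ((M : ℝ) + 1)) / c) * NY v :=
      (hNY.add_le _ _).trans (add_le_add ((hNY.map_le hA₂ _).trans (mul_le_mul_of_nonneg_left hy
        (mul_nonneg hNY.const_nonneg (by norm_num)))) (hNY.map_le hA₄ _))
    have h12 := hN.trunc_le hw M v
    have h13 := hN.le_add_sub v (v.map (trunc (Finset.range M)))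
    have h14 := mul_le_mul_of_nonneg_left (hle.trans (max_le_max h10 h11)) hN.const_nonneg
    linarith
  have hzero : Tendsto (fun M : ℕ => 1 / ((M : ℝ) + 1)) atTop (𝓝 0) :=
    tendsto_one_div_add_atTop_nhds_zero_nat
  have hsq₁ : Tendsto (fun M : ℕ => Real.sqrt (r M + 1 / ((M : ℝ) + 1))) atTop (𝓝 s) := by
    have := (Real.continuous_sqrt.tendsto _).comp (hst.add hzero)
    rwa [add_zero, Real.sqrt_sq hs0] at this
  have hsq₂ : Tendsto (fun M : ℕ => Real.sqrt (1 - r (-M) + 1 / ((M : ℝ) + 1))) atTop (𝓝 t) := by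
    have := (Real.continuous_sqrt.tendsto _).comp (htt.add hzero)
    rwa [add_zero, Real.sqrt_sq ht0] at this
  have hlim := (((((((hsq₁.const_mul 2).div_const a).const_mul hX).mul_const (NX v)).const_add
    (hX * 3 * ρ)).max (((((hsq₂.const_mul 2).div_const c).const_mul hY).mul_const (NY v)).const_add
    (hY * 3 * ρ))).const_mul h).add (hN.tendsto_sub_trunc tendsto_finset_range v)
  have hle := ge_of_tendsto hlim (eventually_atTop.mpr ⟨1, key⟩)
  have hρ : 0 ≤ ρ := (hNX.nonneg _).trans hx
  -- The 5 is 3 from the central synthesis plus 2 from the end synthesis.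
  have hXm : hX * 3 * ρ + hX * (2 * s / a) * NX v ≤ 5 * (max hX hY * ρ) := by
    have h1 := mul_le_mul_of_nonneg_left hsv hNX.const_nonneg
    have h2 := mul_le_mul_of_nonneg_right (le_max_left hX hY) hρ
    have h3 : hX * (2 * s / a) * NX v = 2 * (hX * (s / a * NX v)) := by ring
    rw [h3]
    linarith
  have hYm : hY * 3 * ρ + hY * (2 * t / c) * NY v ≤ 5 * (max hX hY * ρ) := by
    have h1 := mul_le_mul_of_nonneg_left htv hNY.const_nonneg
    have h2 := mul_le_mul_of_nonneg_right (le_max_right hX hY) hρ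
    have h3 : hY * (2 * t / c) * NY v = 2 * (hY * (t / c * NY v)) := by ring
    rw [h3]
    linarith
  rw [add_zero] at hle
  calc N v ≤ h * (5 * (max hX hY * ρ)) :=
        hle.trans (mul_le_mul_of_nonneg_left (max_le hXm hYm) hN.const_nonneg)
    _ = _ := by ring

end ConstantSequences

/-! ### Construction of the parameters and the two-sided comparison of norms. -/

section Representation

open ContinuousLinearMap Filter Topology

/-- The norm `max (s NX, t NY, K)`, where `K` is the norm of the constant sequences in the sum of the
weighted spaces. -/
noncomputable def interNorm {n : ℕ} (NX NY : Matrix (Fin n) (Fin n) Ell2 → ℝ) (s t : ℝ)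
    (uc ur : ℕ → ℝ) (v : Matrix (Fin n) (Fin n) Ell2) : ℝ :=
  max (max (s * NX v) (t * NY v)) (sInf {r : ℝ |
    ∃ (a : Matrix (Fin n) (Fin n) (WeightedEll2 uc)) (b : Matrix (Fin n) (Fin n) (WeightedEll2 ur)),
      (∀ p q j, v p q = (a p q).1 j + (b p q).1 j) ∧
      max (NX (a.map (flatten uc))) (NY (b.map (flatten ur))) = r})

theorem summable_sub_succ {r : ℤ → ℝ} (hr : ∀ k, r k ∈ Set.Icc (0 : ℝ) 1)
    (hsucc : ∀ k, r (k + 1) ≤ r k) : Summable fun k => r k - r (k + 1) := by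
  refine summable_of_sum_le (c := 1) (fun k => sub_nonneg.mpr (hsucc k)) fun I => ?_
  obtain ⟨M, hM⟩ : ∃ M : ℕ, I ⊆ Finset.Ico (-(M : ℤ)) M := by
    refine ⟨I.sup Int.natAbs + 1, fun k hk => ?_⟩
    have := Finset.le_sup (f := Int.natAbs) hk
    rw [Finset.mem_Ico]
    lia
  refine (Finset.sum_le_sum_of_subset_of_nonneg hM
    fun k _ _ => sub_nonneg.mpr (hsucc k)).trans ?_
  rw [sum_Ico_sub_succ]
  linarith [(hr (-M)).2, (hr M).1]

theorem le_of_forall_le_mul_add {x K y : ℝ} (hK : 0 ≤ K) (h : ∀ δ : ℝ, 0 < δ → x ≤ y + K * δ) :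
    x ≤ y := by
  refine le_of_forall_pos_le_add fun η hη => (h (η / (K + 1)) (by positivity)).trans ?_
  have h1 : K * (η / (K + 1)) ≤ η := by
    rw [mul_div_assoc', div_le_iff₀ (by positivity)]
    nlinarith
  linarith

variable {L : Type*} [NormedAddCommGroup L] [InnerProductSpace ℂ L] [CompleteSpace L]

/-- The parameters are read off from the asymptotic distribution of `B` along `V`. They are fixed
before the matrix size and the norms, which is what makes the comparison a complete isomorphism. -/
theorem exists_interNorm_equivalent {J₁ J₂ : Ell2 →L[ℂ] L}
    (hJ : J₁ ∘L adjoint J₁ + J₂ ∘L adjoint J₂ = 1) (V : Ell2 →ₗᵢ[ℂ] L) {a c : ℝ} (ha : 1 ≤ a)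
    (hc : 1 ≤ c) :
    ∃ s ∈ Set.Icc (0 : ℝ) 1, ∃ t ∈ Set.Icc (0 : ℝ) 1, ∃ uc ur : ℕ → ℝ,
      (∀ j, 0 < uc j) ∧ (∀ j, 0 < ur j) ∧ Summable (fun j => min (uc j) (ur j)) ∧
      ∀ (n : ℕ) (NX NY N : Matrix (Fin n) (Fin n) Ell2 → ℝ) (hX hY h : ℝ), TameNorm hX NX →
        TameNorm hY NY → TameNorm h N → LiftNorm V J₁ J₂ a c NX NY N → ∀ v,
        N v ≤ 5 * h * max hX hY * interNorm NX NY s t uc ur v ∧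
        interNorm NX NY s t uc ur v ≤ 6 * h * max hX hY * N v := by
  set B : L →L[ℂ] L := J₁ ∘L adjoint J₁ with hBdef
  have hB0 : 0 ≤ B := by
    rw [ContinuousLinearMap.nonneg_iff_isPositive]
    exact isPositive_self_comp_adjoint J₁
  have hB1 : B ≤ 1 := by
    rw [ContinuousLinearMap.le_def, ← hJ, add_sub_cancel_left]
    exact isPositive_self_comp_adjoint J₂
  have hB : IsSelfAdjoint B := IsSelfAdjoint.of_nonneg hB0
  have hs : spectrum ℝ B ⊆ Set.Icc 0 1 := fun x hx =>
    ⟨spectrum_nonneg_of_nonneg hB0 hx, (CFC.le_one_iff B).mp hB1 x hx⟩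
  have hJ₁ : J₁ ∘L adjoint J₁ = cfc (fun t : ℝ => t) B := (cfc_id' ℝ B).symm
  have hJ₂ : J₂ ∘L adjoint J₂ = cfc (fun t : ℝ => 1 - t) B := by
    rw [cfc_sub (fun _ : ℝ => (1 : ℝ)) (fun t : ℝ => t) B, cfc_const_one ℝ B, cfc_id' ℝ B, ← hJ,
      add_sub_cancel_left]
  obtain ⟨r, hr⟩ := exists_asymptotic_form V hB hs continuous_ramp
    (fun k t _ => ramp_nonneg k t) (fun k t _ => ramp_le_one k t)
  have hr01 := hr.mem_Icc hB hs
  have hsucc := hr.succ_le hs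
  have hanti : Antitone r := antitone_int_of_succ_le hsucc
  have ha0 : 0 < a := one_pos.trans_le ha
  have hc0 : 0 < c := one_pos.trans_le hc
  obtain ⟨ε₀, hε₀, S, hS, hS1⟩ := posSumOfEncodable one_pos ℤ
  have hfin : ∀ I : Finset ℤ, ∑ k ∈ I, ε₀ k ≤ 1 := fun I =>
    (sum_le_hasSum I (fun k _ => (hε₀ k).le) hS).trans hS1
  -- The factor `node k * (1 - node k)` makes `ε k / node k` and `ε k / (1 - node k)` both at most
  -- `ε₀ k`.
  set ε : ℤ → ℝ := fun k => ε₀ k * (node k * (1 - node k))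
  have hn0 := node_pos
  have hn1 : ∀ k, 0 < 1 - node k := fun k => sub_pos.mpr (node_lt_one k)
  have hε : ∀ k, 0 < ε k := fun k => mul_pos (hε₀ k) (mul_pos (hn0 k) (hn1 k))
  have hεX : ∀ I : Finset ℤ, ∑ k ∈ I, ε k / node k ≤ 1 := fun I => by
    refine (Finset.sum_le_sum fun k _ => ?_).trans (hfin I)
    rw [div_le_iff₀ (hn0 k)]
    refine mul_le_mul_of_nonneg_left ?_ (hε₀ k).le
    nlinarith [hn0 k]
  have hεY : ∀ I : Finset ℤ, ∑ k ∈ I, ε k / (1 - node k) ≤ 1 := fun I => by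
    refine (Finset.sum_le_sum fun k _ => ?_).trans (hfin I)
    rw [div_le_iff₀ (hn1 k)]
    refine mul_le_mul_of_nonneg_left ?_ (hε₀ k).le
    nlinarith [hn0 k, hn1 k]
  set m : ℤ → ℝ := fun k => r k - r (k + 1) + ε k with hmdef
  have hm : ∀ k, 0 < m k := fun k => by
    have h1 := hsucc k
    have h2 := hε k
    simp only [hmdef]
    linarith
  -- The weights are the mass of the piece divided by the squared size of `a J₁`, respectively `c
  -- J₂`, on it.
  set uX : ℤ → ℝ := fun k => m k / (a ^ 2 * node k)
  set uY : ℤ → ℝ := fun k => m k / (c ^ 2 * (1 - node k))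
  have huX : ∀ k, 0 < uX k := fun k => div_pos (hm k) (mul_pos (by positivity) (hn0 k))
  have huY : ∀ k, 0 < uY k := fun k => div_pos (hm k) (mul_pos (by positivity) (hn1 k))
  have huXr : ∀ k, a ^ 2 * node k * uX k = r k - r (k + 1) + ε k := fun k =>
    mul_div_cancel₀ _ (mul_pos (by positivity) (hn0 k)).ne'
  have huYr : ∀ k, c ^ 2 * (1 - node k) * uY k = r k - r (k + 1) + ε k := fun k =>
    mul_div_cancel₀ _ (mul_pos (by positivity) (hn1 k)).ne'
  have hsum : Summable fun k : ℤ => 2 * m k := by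
    refine ((summable_sub_succ hr01 hsucc).add (Summable.of_nonneg_of_le (fun k => (hε k).le)
      (fun k => ?_) hS.summable)).mul_left 2
    refine mul_le_of_le_one_right (hε₀ k).le ?_
    nlinarith [hn0 k, hn1 k]
  -- One of `node k` and `1 - node k` is at least `1/2`, and `a, c ≥ 1`; hence the smaller weight is
  -- at most twice the mass.
  have hhalf : ∀ (x y z : ℝ), 0 < x → 1 ≤ y → 1 / 2 ≤ z → x / (y ^ 2 * z) ≤ 2 * x := by
    intro x y z hx hy hz
    have hyz : 1 * (1 / 2) ≤ y ^ 2 * z :=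
      mul_le_mul (one_le_pow₀ hy) hz (by norm_num) (by positivity)
    rw [div_le_iff₀ (by linarith)]
    nlinarith
  have hW : Summable fun j : ℕ =>
      min (uX (Equiv.intEquivNat.symm j)) (uY (Equiv.intEquivNat.symm j)) := by
    refine (Equiv.intEquivNat.symm.summable_iff (f := fun k => min (uX k) (uY k))).mpr ?_
    refine Summable.of_nonneg_of_le (fun k => (lt_min (huX k) (huY k)).le) (fun k => ?_) hsum
    rcases le_total (1 / 2) (node k) with h1 | h1
    · exact (min_le_left _ _).trans (hhalf _ _ _ (hm k) ha h1)
    · exact (min_le_right _ _).trans (hhalf _ _ _ (hm k) hc (by linarith))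
  have hs₁ : Antitone fun M : ℕ => r M := fun M M' h => hanti (by exact_mod_cast h)
  have ht₁ : Antitone fun M : ℕ => 1 - r (-M) := fun M M' h =>
    sub_le_sub_left (hanti (by simpa using h)) 1
  have hbs : BddBelow (Set.range fun M : ℕ => r M) :=
    ⟨0, by rintro _ ⟨M, rfl⟩; exact (hr01 _).1⟩
  have hbt : BddBelow (Set.range fun M : ℕ => 1 - r (-M)) :=
    ⟨0, by rintro _ ⟨M, rfl⟩; exact sub_nonneg.mpr (hr01 _).2⟩
  -- The asymptotic masses at `t = 1` and, next, at `t = 0`, as limits of monotone sequences.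
  set s₂ := ⨅ M : ℕ, r M
  set t₂ := ⨅ M : ℕ, 1 - r (-M)
  have hs₂ : 0 ≤ s₂ := le_ciInf fun M => (hr01 _).1
  have ht₂ : 0 ≤ t₂ := le_ciInf fun M => sub_nonneg.mpr (hr01 _).2
  have hs₂1 : s₂ ≤ 1 := (ciInf_le hbs 0).trans (hr01 _).2
  have ht₂1 : t₂ ≤ 1 := (ciInf_le hbt 0).trans (by linarith [(hr01 (-(0 : ℕ))).1])
  refine ⟨Real.sqrt s₂ / a, ⟨by positivity, ?_⟩, Real.sqrt t₂ / c, ⟨by positivity, ?_⟩,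
    fun j => uX (Equiv.intEquivNat.symm j), fun j => uY (Equiv.intEquivNat.symm j),
    fun j => huX _, fun j => huY _, hW, fun n NX NY N hX hY h hNX hNY hN hl v => ?_⟩
  · rw [div_le_one ha0]
    exact (Real.sqrt_le_one.mpr hs₂1).trans ha
  · rw [div_le_one hc0]
    exact (Real.sqrt_le_one.mpr ht₂1).trans hc
  have hNv := hN.nonneg v
  have hh := hN.const_nonneg
  have hmax : 0 ≤ max hX hY := hNX.const_nonneg.trans (le_max_left _ _)
  have hdec : ∀ ρ : ℝ, 0 < ρ → _ := fun ρ hρ => exists_const_decomposition hB hs hJ₁ hJ₂ ha0 hc0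
    hNX hNY hN hl hr hε hεX hεY huX huY huXr huYr hW v hρ
  let K : Set ℝ := {ρ : ℝ | ∃ (x : Matrix (Fin n) (Fin n) (WeightedEll2 fun j =>
    uX (Equiv.intEquivNat.symm j))) (y : Matrix (Fin n) (Fin n) (WeightedEll2 fun j =>
    uY (Equiv.intEquivNat.symm j))), (∀ p q j, v p q = (x p q).1 j + (y p q).1 j) ∧
    max (NX (x.map (flatten _))) (NY (y.map (flatten _))) = ρ}
  constructor
  · refine le_of_forall_le_mul_add (K := 5 * h * max hX hY) (by positivity) fun δ hδ => ?_
    rw [← mul_add]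
    -- Some decomposition must exist: the infimum of the empty set would be the default value 0.
    obtain ⟨x₀, y₀, h₀, -, -⟩ := hdec 1 one_pos
    have hlt₀ : sInf K < interNorm NX NY (Real.sqrt s₂ / a) (Real.sqrt t₂ / c)
        (fun j => uX (Equiv.intEquivNat.symm j)) (fun j => uY (Equiv.intEquivNat.symm j)) v + δ :=
      (le_max_right _ _).trans_lt (lt_add_of_pos_right _ hδ)
    obtain ⟨ρ, ⟨x, y, hv, rfl⟩, hlt⟩ := exists_lt_of_csInf_lt (s := K) ⟨_, x₀, y₀, h₀, rfl⟩ hlt₀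
    refine norm_le_of_const_decomposition hB hs hJ₁ hJ₂ ha0 hc0 hNX hNY hN hl hr hε huX huY huXr
      huYr (s := Real.sqrt s₂) (t := Real.sqrt t₂) ?_ ?_ (Real.sqrt_nonneg _) (Real.sqrt_nonneg _)
      v x y hv ((le_max_left _ _).trans hlt.le) ((le_max_right _ _).trans hlt.le) ?_ ?_
    · rw [Real.sq_sqrt hs₂]
      exact tendsto_atTop_ciInf hs₁ hbs
    · rw [Real.sq_sqrt ht₂]
      exact tendsto_atTop_ciInf ht₁ hbt
    · exact ((le_max_left _ _).trans (le_max_left _ _)).trans (le_add_of_nonneg_right hδ.le)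
    · exact ((le_max_right _ _).trans (le_max_left _ _)).trans (le_add_of_nonneg_right hδ.le)
  · have hle : ∀ x, x ≤ max hX hY → 2 * x * h * N v ≤ 6 * h * max hX hY * N v := by
      intro x hx
      refine mul_le_mul_of_nonneg_right ?_ hNv
      have h1 := mul_le_mul_of_nonneg_right hx hh
      have h2 := mul_nonneg hmax hh
      nlinarith
    refine max_le (max_le ?_ ?_) ?_
    · refine (end_bound dyadicSide_left hs (by fun_prop) hJ₁ hJ₂ ha0 hc0 hNX hNY hN hl
        (R := fun M => r M) (fun T hT M δ hδ => ?_) (Real.sqrt_nonneg s₂) (fun M => ?_) v).trans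
        (hle hX (le_max_left _ _))
      · obtain ⟨w, h1, h2, h3⟩ := hr.exists_sequence hB hT M hδ
        exact ⟨w, h1, h2, fun i => (h3 i).2.1⟩
      · rw [Real.sq_sqrt hs₂]
        exact ciInf_le hbs M
    · refine (end_bound dyadicSide_right hs (by fun_prop) hJ₂ hJ₁ hc0 ha0 hNY hNX hN hl.swap
        (R := fun M => 1 - r (-M)) (fun T hT M δ hδ => ?_) (Real.sqrt_nonneg t₂)
        (fun M => ?_) v).trans (hle hY (le_max_right _ _))
      · obtain ⟨w, h1, h2, h3⟩ := hr.exists_sequence hB hT M hδ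
        exact ⟨w, h1, h2, fun i => (h3 i).2.2⟩
      · rw [Real.sq_sqrt ht₂]
        exact ciInf_le hbt M
    · refine le_of_forall_le_mul_add (K := 6 * max hX hY + 1) (by positivity) fun δ hδ => ?_
      obtain ⟨x, y, hv, hx, hy⟩ := hdec δ hδ
      have hbdd : BddBelow K :=
        ⟨0, by rintro _ ⟨x, y, -, rfl⟩; exact (hNX.nonneg _).trans (le_max_left _ _)⟩
      refine (csInf_le (s := K) hbdd ⟨x, y, hv, rfl⟩).trans (max_le (hx.trans ?_) (hy.trans ?_))
      · have h1 : hX * (h * N v + δ) ≤ max hX hY * (h * N v + δ) :=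
          mul_le_mul_of_nonneg_right (le_max_left _ _) (by positivity)
        linarith
      · have h1 : hY * (h * N v + δ) ≤ max hX hY * (h * N v + δ) :=
          mul_le_mul_of_nonneg_right (le_max_right _ _) (by positivity)
        linarith

end Representation

/-! ### Tameness and homogeneity of the norms defined by lifts. -/

section LiftedNorms

open ContinuousLinearMap

variable {L : Type*} [NormedAddCommGroup L] [InnerProductSpace ℂ L] [CompleteSpace L]
  {J₁ J₂ : Ell2 →L[ℂ] L} {V : Ell2 →ₗᵢ[ℂ] L} {a c : ℝ}

theorem norm_adjoint_apply_le (hJ : J₁ ∘L adjoint J₁ + J₂ ∘L adjoint J₂ = 1) (l : L) :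
    ‖adjoint J₁ l‖ ≤ ‖l‖ ∧ ‖adjoint J₂ l‖ ≤ ‖l‖ := by
  have h1 : ‖adjoint J₁ l‖ ^ 2 + ‖adjoint J₂ l‖ ^ 2 = ‖l‖ ^ 2 := by
    rw [← inner_self_eq_norm_sq (𝕜 := ℂ), ← inner_self_eq_norm_sq (𝕜 := ℂ),
      ← inner_self_eq_norm_sq (𝕜 := ℂ), ContinuousLinearMap.adjoint_inner_left,
      ContinuousLinearMap.adjoint_inner_left, ← map_add, ← inner_add_right]
    have h2 : J₁ (adjoint J₁ l) + J₂ (adjoint J₂ l) = l := congrArg (fun T : L →L[ℂ] L => T l) hJ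
    rw [h2]
  constructor <;> refine le_of_sq_le_sq ?_ (norm_nonneg _)
  · linarith [sq_nonneg ‖adjoint J₂ l‖]
  · linarith [sq_nonneg ‖adjoint J₁ l‖]

theorem norm_le_one_of_add_eq_one (hJ : J₁ ∘L adjoint J₁ + J₂ ∘L adjoint J₂ = 1) :
    ‖J₁‖ ≤ 1 ∧ ‖J₂‖ ≤ 1 := by
  constructor
  · rw [← LinearIsometryEquiv.norm_map adjoint J₁]
    exact opNorm_le_bound _ zero_le_one fun l => by simpa using (norm_adjoint_apply_le hJ l).1
  · rw [← LinearIsometryEquiv.norm_map adjoint J₂]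
    exact opNorm_le_bound _ zero_le_one fun l => by simpa using (norm_adjoint_apply_le hJ l).2

/-- The row `(J₁, J₂)` is a coisometry, so its adjoint is a right inverse and gives every vector a
canonical lift. -/
theorem smul_adjoint_lift (hJ : J₁ ∘L adjoint J₁ + J₂ ∘L adjoint J₂ = 1) (ha : 0 < a) (hc : 0 < c)
    (l : L) : (a : ℂ) • J₁ ((a : ℂ)⁻¹ • adjoint J₁ l) + (c : ℂ) • J₂ ((c : ℂ)⁻¹ • adjoint J₂ l)
      = l := by
  have ha' : (a : ℂ) ≠ 0 := by exact_mod_cast ha.ne'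
  have hc' : (c : ℂ) ≠ 0 := by exact_mod_cast hc.ne'
  rw [map_smul, map_smul, smul_inv_smul₀ ha', smul_inv_smul₀ hc']
  exact congrArg (fun T : L →L[ℂ] L => T l) hJ

theorem LiftNorm.tameNorm (hJ : J₁ ∘L adjoint J₁ + J₂ ∘L adjoint J₂ = 1) (ha : 0 < a) (hc : 0 < c)
    {n : ℕ} {NX NY N : Matrix (Fin n) (Fin n) Ell2 → ℝ} {hX hY h : ℝ} (hNX : TameNorm hX NX)
    (hNY : TameNorm hY NY) (hl : LiftNorm V J₁ J₂ a c NX NY N) (hh : 0 ≤ h)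
    (hom : ∀ (T : Ell2 →L[ℂ] Ell2) x, N (x.map T) ≤ h * ‖T‖ * N x) : TameNorm h N where
  const_nonneg := hh
  nonneg v := le_of_forall_pos_le_add fun r hr => by
    obtain ⟨x, y, -, hx, -⟩ := hl.exists_lift v r hr
    exact (hNX.nonneg x).trans hx
  add_le v v' := le_of_forall_pos_le_add fun r hr => by
    obtain ⟨x, y, h1, hx, hy⟩ := hl.exists_lift v (r / 2) (by positivity)
    obtain ⟨x', y', h1', hx', hy'⟩ := hl.exists_lift v' (r / 2) (by positivity)
    refine (hl.le_of_lift (v + v') (x + x') (y + y') fun p q => ?_).trans (max_le ?_ ?_)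
    · rw [Matrix.add_apply, Matrix.add_apply, Matrix.add_apply, map_add, map_add, map_add, smul_add,
        smul_add, add_add_add_comm, h1, h1']
    · linarith [hNX.add_le x x']
    · linarith [hNY.add_le y y']
  upper := by
    obtain ⟨cX, hcX, hX'⟩ := hNX.upper
    obtain ⟨cY, hcY, hY'⟩ := hNY.upper
    refine ⟨cX * a⁻¹ + cY * c⁻¹, by positivity, fun v => ?_⟩
    refine (hl.le_of_lift v (v.map fun z => (a : ℂ)⁻¹ • adjoint J₁ (V z))
      (v.map fun z => (c : ℂ)⁻¹ • adjoint J₂ (V z))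
      fun p q => smul_adjoint_lift hJ ha hc (V (v p q))).trans ?_
    have h1 : ∀ z : Ell2, ‖(a : ℂ)⁻¹ • adjoint J₁ (V z)‖ ≤ a⁻¹ * ‖z‖ := fun z => by
      rw [norm_smul, norm_inv, Complex.norm_real, Real.norm_of_nonneg ha.le, ← V.norm_map z]
      exact mul_le_mul_of_nonneg_left (norm_adjoint_apply_le hJ _).1 (by positivity)
    have h2 : ∀ z : Ell2, ‖(c : ℂ)⁻¹ • adjoint J₂ (V z)‖ ≤ c⁻¹ * ‖z‖ := fun z => by
      rw [norm_smul, norm_inv, Complex.norm_real, Real.norm_of_nonneg hc.le, ← V.norm_map z]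
      exact mul_le_mul_of_nonneg_left (norm_adjoint_apply_le hJ _).2 (by positivity)
    have h3 : NX (v.map fun z => (a : ℂ)⁻¹ • adjoint J₁ (V z))
        ≤ cX * a⁻¹ * ∑ p, ∑ q, ‖v p q‖ := by
      refine (hX' _).trans ?_
      rw [mul_assoc, Finset.mul_sum (a := a⁻¹)]
      simp only [Finset.mul_sum (a := a⁻¹)]
      exact mul_le_mul_of_nonneg_left
        (Finset.sum_le_sum fun p _ => Finset.sum_le_sum fun q _ => h1 _) hcX
    have h4 : NY (v.map fun z => (c : ℂ)⁻¹ • adjoint J₂ (V z))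
        ≤ cY * c⁻¹ * ∑ p, ∑ q, ‖v p q‖ := by
      refine (hY' _).trans ?_
      rw [mul_assoc, Finset.mul_sum (a := c⁻¹)]
      simp only [Finset.mul_sum (a := c⁻¹)]
      exact mul_le_mul_of_nonneg_left
        (Finset.sum_le_sum fun p _ => Finset.sum_le_sum fun q _ => h2 _) hcY
    rw [add_mul]
    exact max_le (h3.trans (le_add_of_nonneg_right ((hNY.nonneg _).trans h4)))
      (h4.trans (le_add_of_nonneg_left ((hNX.nonneg _).trans h3)))
  lower := by
    obtain ⟨cX, hcX, hX'⟩ := hNX.lower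
    obtain ⟨cY, hcY, hY'⟩ := hNY.lower
    refine ⟨a * cX + c * cY, by positivity, fun v p q => ?_⟩
    refine le_of_forall_le_mul_add (K := a * cX + c * cY) (by positivity) fun r hr => ?_
    obtain ⟨x, y, h1, hx, hy⟩ := hl.exists_lift v r hr
    have h2 : ∀ (J : Ell2 →L[ℂ] L), ‖J‖ ≤ 1 → ∀ (d : ℝ), 0 < d → ∀ z,
        ‖(d : ℂ) • J z‖ ≤ d * ‖z‖ := fun J hJ d hd z => by
      rw [norm_smul, Complex.norm_real, Real.norm_of_nonneg hd.le]
      exact mul_le_mul_of_nonneg_left ((J.le_of_opNorm_le hJ z).trans_eq (one_mul _)) hd.le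
    obtain ⟨hJ₁, hJ₂⟩ := norm_le_one_of_add_eq_one hJ
    rw [← V.norm_map, ← h1 p q]
    calc _ ≤ a * ‖x p q‖ + c * ‖y p q‖ :=
          (norm_add_le _ _).trans (add_le_add (h2 _ hJ₁ a ha _) (h2 _ hJ₂ c hc _))
      _ ≤ a * (cX * (N v + r)) + c * (cY * (N v + r)) := by
        gcongr
        · exact (hX' x p q).trans (mul_le_mul_of_nonneg_left hx hcX)
        · exact (hY' y p q).trans (mul_le_mul_of_nonneg_left hy hcY)
      _ = _ := by ring
  hom := hom

variable {X Y F : Type*} [NormedAddCommGroup X] [NormedSpace ℂ X] [OperatorSpace X]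
  [NormedAddCommGroup Y] [NormedSpace ℂ Y] [OperatorSpace Y]
  [NormedAddCommGroup F] [NormedSpace ℂ F] [OperatorSpace F]
  {φ : X ≃L[ℂ] Ell2} {ψ : Y ≃L[ℂ] Ell2} {d μX μY : ℝ} {N : MatrixNorms Ell2}

theorem transportedNorms_one (φ : X ≃L[ℂ] Ell2) (x : Matrix (Fin 1) (Fin 1) Ell2) :
    transportedNorms φ 1 x = ‖φ.symm (x 0 0)‖ := OperatorSpace.mnorm_one _

/-- Together with the next bound this makes the quotient Hilbertian with constant `μX + μY`. The
scale `d`, common to both sides, cancels in the product. -/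
theorem lift_norm_one_le (hJ : J₁ ∘L adjoint J₁ + J₂ ∘L adjoint J₂ = 1) (hd : 0 < d)
    (ha : 0 < ‖(φ.symm : Ell2 →L[ℂ] X)‖) (hc : 0 < ‖(ψ.symm : Ell2 →L[ℂ] Y)‖)
    (hl : LiftNorm V J₁ J₂ (d * ‖(φ.symm : Ell2 →L[ℂ] X)‖) (d * ‖(ψ.symm : Ell2 →L[ℂ] Y)‖)
      (transportedNorms φ 1) (transportedNorms ψ 1) (N 1)) (u : Matrix (Fin 1) (Fin 1) Ell2) :
    N 1 u ≤ d⁻¹ * ‖u 0 0‖ := by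
  have key : ∀ (k : ℝ), 0 < k → ∀ z : Ell2, ‖z‖ ≤ ‖u 0 0‖ →
      k * ‖((d * k : ℝ) : ℂ)⁻¹ • z‖ ≤ d⁻¹ * ‖u 0 0‖ := fun k hk z hz => by
    rw [norm_smul, norm_inv, Complex.norm_real, Real.norm_of_nonneg (by positivity), mul_inv,
      ← mul_assoc, mul_comm d⁻¹, mul_inv_cancel_left₀ hk.ne']
    exact mul_le_mul_of_nonneg_left hz (by positivity)
  have hV := V.norm_map (u 0 0)
  obtain ⟨h1, h2⟩ := norm_adjoint_apply_le hJ (V (u 0 0))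
  rw [hV] at h1 h2
  refine (hl.le_of_lift u (u.map fun z => ((d * ‖(φ.symm : Ell2 →L[ℂ] X)‖ : ℝ) : ℂ)⁻¹ •
      adjoint J₁ (V z)) (u.map fun z => ((d * ‖(ψ.symm : Ell2 →L[ℂ] Y)‖ : ℝ) : ℂ)⁻¹ •
      adjoint J₂ (V z)) fun p q => smul_adjoint_lift hJ (by positivity) (by positivity)
        (V (u p q))).trans (max_le ?_ ?_)
  · rw [transportedNorms_one]
    exact ((φ.symm : Ell2 →L[ℂ] X).le_opNorm _).trans (key _ ha _ h1)
  · rw [transportedNorms_one]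
    exact ((ψ.symm : Ell2 →L[ℂ] Y).le_opNorm _).trans (key _ hc _ h2)

theorem norm_le_lift_norm_one (hJ : J₁ ∘L adjoint J₁ + J₂ ∘L adjoint J₂ = 1) (hd : 0 < d)
    (hφ : ‖(φ : X →L[ℂ] Ell2)‖ * ‖(φ.symm : Ell2 →L[ℂ] X)‖ ≤ μX)
    (hψ : ‖(ψ : Y →L[ℂ] Ell2)‖ * ‖(ψ.symm : Ell2 →L[ℂ] Y)‖ ≤ μY)
    (hl : LiftNorm V J₁ J₂ (d * ‖(φ.symm : Ell2 →L[ℂ] X)‖) (d * ‖(ψ.symm : Ell2 →L[ℂ] Y)‖)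
      (transportedNorms φ 1) (transportedNorms ψ 1) (N 1)) (u : Matrix (Fin 1) (Fin 1) Ell2) :
    ‖u 0 0‖ ≤ d * (μX + μY) * N 1 u := by
  have hμX : 0 ≤ μX := (mul_nonneg (norm_nonneg _) (norm_nonneg _)).trans hφ
  have hμY : 0 ≤ μY := (mul_nonneg (norm_nonneg _) (norm_nonneg _)).trans hψ
  refine le_of_forall_le_mul_add (K := d * (μX + μY)) (by positivity) fun r hr => ?_
  obtain ⟨x, y, h1, hx, hy⟩ := hl.exists_lift u r hr
  rw [transportedNorms_one] at hx hy
  obtain ⟨hJ₁, hJ₂⟩ := norm_le_one_of_add_eq_one hJ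
  have hx' : ‖x 0 0‖ ≤ ‖(φ : X →L[ℂ] Ell2)‖ * (N 1 u + r) := by
    have := (φ : X →L[ℂ] Ell2).le_opNorm (φ.symm (x 0 0))
    simp only [ContinuousLinearEquiv.coe_coe, ContinuousLinearEquiv.apply_symm_apply] at this
    exact this.trans (mul_le_mul_of_nonneg_left hx (norm_nonneg _))
  have hy' : ‖y 0 0‖ ≤ ‖(ψ : Y →L[ℂ] Ell2)‖ * (N 1 u + r) := by
    have := (ψ : Y →L[ℂ] Ell2).le_opNorm (ψ.symm (y 0 0))
    simp only [ContinuousLinearEquiv.coe_coe, ContinuousLinearEquiv.apply_symm_apply] at this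
    exact this.trans (mul_le_mul_of_nonneg_left hy (norm_nonneg _))
  have hnr : 0 ≤ N 1 u + r := (norm_nonneg _).trans hx
  have h2 : ∀ (J : Ell2 →L[ℂ] L), ‖J‖ ≤ 1 → ∀ k : ℝ, 0 ≤ k → ∀ z,
      ‖((d * k : ℝ) : ℂ) • J z‖ ≤ d * k * ‖z‖ := fun J hJ k hk z => by
    rw [norm_smul, Complex.norm_real, Real.norm_of_nonneg (by positivity)]
    exact mul_le_mul_of_nonneg_left ((J.le_of_opNorm_le hJ z).trans_eq (one_mul _)) (by positivity)
  rw [← V.norm_map, ← h1 0 0]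
  calc _ ≤ d * ‖(φ.symm : Ell2 →L[ℂ] X)‖ * ‖x 0 0‖ + d * ‖(ψ.symm : Ell2 →L[ℂ] Y)‖ * ‖y 0 0‖ :=
        (norm_add_le _ _).trans (add_le_add (h2 _ hJ₁ _ (norm_nonneg _) _)
          (h2 _ hJ₂ _ (norm_nonneg _) _))
    _ ≤ d * ‖(φ.symm : Ell2 →L[ℂ] X)‖ * (‖(φ : X →L[ℂ] Ell2)‖ * (N 1 u + r))
        + d * ‖(ψ.symm : Ell2 →L[ℂ] Y)‖ * (‖(ψ : Y →L[ℂ] Ell2)‖ * (N 1 u + r)) := by gcongr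
    _ = d * (‖(φ : X →L[ℂ] Ell2)‖ * ‖(φ.symm : Ell2 →L[ℂ] X)‖) * (N 1 u + r)
        + d * (‖(ψ : Y →L[ℂ] Ell2)‖ * ‖(ψ.symm : Ell2 →L[ℂ] Y)‖) * (N 1 u + r) := by ring
    _ ≤ d * μX * (N 1 u + r) + d * μY * (N 1 u + r) := by gcongr
    _ = _ := by ring

/-- The homogeneity of `F` passes to the norms of a quotient to which it is completely
isomorphic. -/
theorem lift_norm_map_le {hF κ : ℝ} (hJ : J₁ ∘L adjoint J₁ + J₂ ∘L adjoint J₂ = 1) (hd : 0 < d)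
    (ha : 0 < ‖(φ.symm : Ell2 →L[ℂ] X)‖) (hc : 0 < ‖(ψ.symm : Ell2 →L[ℂ] Y)‖)
    (hφ : ‖(φ : X →L[ℂ] Ell2)‖ * ‖(φ.symm : Ell2 →L[ℂ] X)‖ ≤ μX)
    (hψ : ‖(ψ : Y →L[ℂ] Ell2)‖ * ‖(ψ.symm : Ell2 →L[ℂ] Y)‖ ≤ μY)
    (hl : LiftNorm V J₁ J₂ (d * ‖(φ.symm : Ell2 →L[ℂ] X)‖) (d * ‖(ψ.symm : Ell2 →L[ℂ] Y)‖)
      (transportedNorms φ 1) (transportedNorms ψ 1) (N 1)) (hFF : IsHomogeneous hF F)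
    (T : F ≃ₗ[ℂ] Ell2) {A B : ℝ} (hA0 : 0 ≤ A) (hB0 : 0 ≤ B) (hAB : A * B ≤ κ)
    (hA : ∀ (n : ℕ) (x : Matrix (Fin n) (Fin n) F), N n (x.map T) ≤ A * OperatorSpace.mnorm n x)
    (hB : ∀ (n : ℕ) (y : Matrix (Fin n) (Fin n) Ell2),
      OperatorSpace.mnorm n (y.map T.symm) ≤ B * N n y)
    (n : ℕ) (R : Ell2 →L[ℂ] Ell2) (v : Matrix (Fin n) (Fin n) Ell2) (hv : 0 ≤ N n v) :
    N n (v.map R) ≤ κ ^ 2 * |hF| * (μX + μY) * ‖R‖ * N n v := by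
  have hμX : 0 ≤ μX := (mul_nonneg (norm_nonneg _) (norm_nonneg _)).trans hφ
  have hμY : 0 ≤ μY := (mul_nonneg (norm_nonneg _) (norm_nonneg _)).trans hψ
  have hbound : ∀ f : F, ‖T.symm (R (T f))‖ ≤ A * B * (μX + μY) * ‖R‖ * ‖f‖ := fun f => by
    have h1 := hB 1 (Matrix.of fun _ _ => R (T f))
    have h2 := lift_norm_one_le (φ := φ) (ψ := ψ) (N := N) hJ hd ha hc hl
      (Matrix.of fun _ _ => R (T f))
    have h3 := norm_le_lift_norm_one (φ := φ) (ψ := ψ) (N := N) hJ hd hφ hψ hl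
      (Matrix.of fun _ _ => T f)
    have h4 := hA 1 (Matrix.of fun _ _ => f)
    rw [OperatorSpace.mnorm_one] at h1 h4
    simp only [Matrix.map_apply, Matrix.of_apply] at h1 h2 h3 h4
    have h5 : (Matrix.of fun _ _ : Fin 1 => f).map T = Matrix.of fun _ _ => T f := rfl
    rw [h5] at h4
    have h6 := R.le_opNorm (T f)
    calc _ ≤ B * (d⁻¹ * (‖R‖ * (d * (μX + μY) * (A * ‖f‖)))) := by
          refine h1.trans (mul_le_mul_of_nonneg_left (h2.trans (mul_le_mul_of_nonneg_left
            (h6.trans (mul_le_mul_of_nonneg_left (h3.trans (mul_le_mul_of_nonneg_left h4 ?_))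
              (norm_nonneg _))) ?_)) hB0) <;> positivity
      _ = _ := by field_simp
  let R' : F →L[ℂ] F := (T.symm.toLinearMap ∘ₗ R.toLinearMap ∘ₗ T.toLinearMap).mkContinuous _ hbound
  have hR' : ‖R'‖ ≤ A * B * (μX + μY) * ‖R‖ := LinearMap.mkContinuous_norm_le _ (by positivity) _
  have h1 := hFF R' n (v.map T.symm)
  have h2 := hA n ((v.map T.symm).map R')
  have h3 : ((v.map T.symm).map R').map T = v.map R := by
    ext1 p q
    change T (T.symm (R (T (T.symm (v p q))))) = R (v p q)
    simp
  rw [h3] at h2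
  have h4 := hB n v
  have hAB0 : 0 ≤ A * B := mul_nonneg hA0 hB0
  calc N n (v.map R) ≤ A * (|hF| * (A * B * (μX + μY) * ‖R‖) * (B * N n v)) := by
        refine h2.trans (mul_le_mul_of_nonneg_left (h1.trans ?_) hA0)
        refine mul_le_mul (mul_le_mul (le_abs_self _) hR' (norm_nonneg _) (abs_nonneg _)) h4
          (mnorm_nonneg _) (by positivity)
    _ = (A * B) ^ 2 * |hF| * (μX + μY) * ‖R‖ * N n v := by ring
    _ ≤ κ ^ 2 * |hF| * (μX + μY) * ‖R‖ * N n v := by gcongr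

theorem exists_completelyIsomorphic_interNorms {hX hY hF κ : ℝ}
    (hJ : J₁ ∘L adjoint J₁ + J₂ ∘L adjoint J₂ = 1) (V : Ell2 →ₗᵢ[ℂ] L) (hd : 0 < d)
    (ha : 1 ≤ d * ‖(φ.symm : Ell2 →L[ℂ] X)‖) (hc : 1 ≤ d * ‖(ψ.symm : Ell2 →L[ℂ] Y)‖)
    (hφ : ‖(φ : X →L[ℂ] Ell2)‖ * ‖(φ.symm : Ell2 →L[ℂ] X)‖ ≤ μX)
    (hψ : ‖(ψ : Y →L[ℂ] Ell2)‖ * ‖(ψ.symm : Ell2 →L[ℂ] Y)‖ ≤ μY)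
    (hXX : IsHomogeneous hX X) (hYY : IsHomogeneous hY Y) (hFF : IsHomogeneous hF F)
    (hl : ∀ n, LiftNorm V J₁ J₂ (d * ‖(φ.symm : Ell2 →L[ℂ] X)‖) (d * ‖(ψ.symm : Ell2 →L[ℂ] Y)‖)
      (transportedNorms φ n) (transportedNorms ψ n) (N n))
    (hFN : CompletelyIsomorphic κ (OperatorSpace.mnorm (E := F)) N) :
    ∃ s ∈ Set.Icc (0 : ℝ) 1, ∃ t ∈ Set.Icc (0 : ℝ) 1, ∃ uc ur : ℕ → ℝ,
      (∀ j, 0 < uc j) ∧ (∀ j, 0 < ur j) ∧ Summable (fun j => min (uc j) (ur j)) ∧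
      CompletelyIsomorphic
        (30 * (κ ^ 2 * |hF| * (μX + μY)) ^ 2 * max (|hX| * μX) (|hY| * μY) ^ 2 * κ)
        (OperatorSpace.mnorm (E := F)) (interNorms φ ψ s t uc ur) := by
  have hμX : 0 ≤ μX := (mul_nonneg (norm_nonneg _) (norm_nonneg _)).trans hφ
  have hμY : 0 ≤ μY := (mul_nonneg (norm_nonneg _) (norm_nonneg _)).trans hψ
  obtain ⟨T, A, B, hA0, hB0, hAB, hA, hB⟩ := hFN
  have ha0 : 0 < ‖(φ.symm : Ell2 →L[ℂ] X)‖ := pos_of_mul_pos_right (one_pos.trans_le ha) hd.le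
  have hc0 : 0 < ‖(ψ.symm : Ell2 →L[ℂ] Y)‖ := pos_of_mul_pos_right (one_pos.trans_le hc) hd.le
  have hNX := tameNorm_transportedNorms φ hφ hXX
  have hNY := tameNorm_transportedNorms ψ hψ hYY
  have hnn : ∀ n v, 0 ≤ N n v := fun n v => le_of_forall_pos_le_add fun r hr => by
    obtain ⟨x, y, -, hx, -⟩ := (hl n).exists_lift v r hr
    exact ((hNX n).nonneg x).trans hx
  set h := κ ^ 2 * |hF| * (μX + μY)
  have hh : 0 ≤ h := by positivity
  have hN : ∀ n, TameNorm h (N n) := fun n => (hl n).tameNorm hJ (one_pos.trans_le ha)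
    (one_pos.trans_le hc) (hNX n) (hNY n) hh fun R v => lift_norm_map_le hJ hd ha0 hc0 hφ hψ (hl 1)
      hFF T hA0 hB0 hAB hA hB n R v (hnn n v)
  obtain ⟨s, hs, t, ht, uc, ur, huc, hur, hW, hmain⟩ := exists_interNorm_equivalent hJ V ha hc
  -- The product of the constants 6 and 5 of the two comparisons is the 30 of the statement.
  refine ⟨s, hs, t, ht, uc, ur, huc, hur, hW, T, 6 * h * max (|hX| * μX) (|hY| * μY) * A,
    B * (5 * h * max (|hX| * μX) (|hY| * μY)), ?_, ?_, ?_, fun n x => ?_, fun n y => ?_⟩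
  · have : 0 ≤ max (|hX| * μX) (|hY| * μY) := le_max_of_le_left (by positivity)
    positivity
  · have : 0 ≤ max (|hX| * μX) (|hY| * μY) := le_max_of_le_left (by positivity)
    positivity
  · have h1 : 0 ≤ 30 * h ^ 2 * max (|hX| * μX) (|hY| * μY) ^ 2 := by positivity
    calc _ = 30 * h ^ 2 * max (|hX| * μX) (|hY| * μY) ^ 2 * (A * B) := by ring
      _ ≤ _ := mul_le_mul_of_nonneg_left hAB h1
  · have h1 := (hmain n _ _ _ _ _ _ (hNX n) (hNY n) (hN n) (hl n) (x.map T)).2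
    have : 0 ≤ max (|hX| * μX) (|hY| * μY) := le_max_of_le_left (by positivity)
    refine h1.trans ?_
    rw [mul_assoc (6 * h * _) A]
    exact mul_le_mul_of_nonneg_left (hA n x) (by positivity)
  · have h1 := (hmain n _ _ _ _ _ _ (hNX n) (hNY n) (hN n) (hl n) y).1
    rw [mul_assoc B]
    exact (hB n y).trans (mul_le_mul_of_nonneg_left h1 hB0)

end LiftedNorms

/-! ### The Hilbert space model of a subquotient of `X ⊕ Y`. -/

section HilbertModel

open ContinuousLinearMap

/-- Each `g m` has nonzero inner product with only countably many vectors of an orthonormal family,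
and totality of the `g m` leaves no basis vector out; hence every Hilbert basis of `E` is countable.
-/
theorem exists_linearIsometryEquiv_ell2 {E H κ : Type*} [NormedAddCommGroup E]
    [InnerProductSpace ℂ E] [CompleteSpace E] [NormedAddCommGroup H] [InnerProductSpace ℂ H]
    [Countable κ] (j : E →ₗᵢ[ℂ] H) (g : κ → H) (hg : ∀ x, (∀ m, inner ℂ x (g m) = 0) → x = 0)
    (hE : ¬ FiniteDimensional ℂ E) : Nonempty (E ≃ₗᵢ[ℂ] Ell2) := by
  obtain ⟨w, b, hb⟩ := exists_hilbertBasis ℂ E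
  have hcount : Countable w := by
    rw [← Set.countable_univ_iff]
    refine (Set.countable_iUnion fun m => ((b.orthonormal.comp_linearIsometry
      j).inner_products_summable (g m)).countable_support).mono fun i _ => ?_
    by_contra hi
    rw [Set.mem_iUnion, not_exists] at hi
    have h1 : j (b i) = 0 := hg _ fun m => by
      simpa [Function.mem_support] using hi m
    have h2 := b.orthonormal.1 i
    rw [← j.norm_map, h1, norm_zero] at h2
    exact zero_ne_one h2
  have hinf : Infinite w := by
    refine ⟨fun hfin => hE ?_⟩
    have := Fintype.ofFinite w
    exact b.toOrthonormalBasis.toBasis.finiteDimensional_of_finite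
  have hden := nonempty_denumerable w
  obtain ⟨_⟩ := hden
  let e : ℕ ≃ w := (Denumerable.eqv w).symm
  have hon : Orthonormal ℂ (b ∘ e) := b.orthonormal.comp e e.injective
  refine ⟨(HilbertBasis.mk hon ?_).repr⟩
  rw [Set.range_comp, e.surjective.range_eq, Set.image_univ, b.dense_span]

/-- Here `M` is the image of `K`, and the quotient by it is realised as `Mᗮ`. As `K ⊆ S`, membership
in `S` can be read off from the projection to `Mᗮ`. Therefore the image `E` of `S` is closed, and
every preimage of one of its vectors automatically lies in `S`. -/
theorem exists_quotient_model {Z H κ : Type*} [NormedAddCommGroup Z] [NormedSpace ℂ Z]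
    [NormedAddCommGroup H] [InnerProductSpace ℂ H] [CompleteSpace H] [Countable κ] (g : κ → H)
    (hg : ∀ x, (∀ m, inner ℂ x (g m) = 0) → x = 0) (Φ : Z ≃L[ℂ] H) {S : Submodule ℂ Z}
    (hS : IsClosed (S : Set Z)) {K : Submodule ℂ S} (hK : IsClosed (K : Set S))
    (hinf : ¬ FiniteDimensional ℂ (S ⧸ K)) :
    ∃ (M : Submodule ℂ H) (W : (S ⧸ K) ≃ₗ[ℂ] Ell2) (V : Ell2 →ₗᵢ[ℂ] Mᗮ),
      (∀ z : S, V (W (K.mkQ z)) = Mᗮ.orthogonalProjectionOnto (Φ z)) ∧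
      ∀ (z : Z) (u : Ell2), Mᗮ.orthogonalProjectionOnto (Φ z) = V u → z ∈ S := by
  let M : Submodule ℂ H := (K.map S.subtype).map (Φ : Z →ₗ[ℂ] H)
  have hMmem : ∀ z : Z, Φ z ∈ M ↔ ∃ k ∈ K, (k : Z) = z := by
    intro z
    simp only [M, Submodule.mem_map]
    constructor
    · rintro ⟨_, ⟨k, hk, rfl⟩, h⟩
      exact ⟨k, hk, Φ.injective h⟩
    · rintro ⟨k, hk, rfl⟩
      exact ⟨_, ⟨k, hk, rfl⟩, rfl⟩
  have hM : IsClosed (M : Set H) := by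
    have h1 : IsClosed (Subtype.val '' (K : Set S)) := hS.isClosedEmbedding_subtypeVal.isClosedMap _ hK
    have h2 : (M : Set H) = Φ.toHomeomorph '' (Subtype.val '' (K : Set S)) := by
      ext x
      simp [M]
    rw [h2]
    exact Φ.toHomeomorph.isClosedMap _ h1
  have : CompleteSpace M := hM.completeSpace_coe
  let P := Mᗮ.orthogonalProjectionOnto
  have hsub : ∀ x : H, x - (P x : H) ∈ M := fun x => by
    have h := Mᗮ.sub_starProjection_mem_orthogonal x
    rwa [M.orthogonal_orthogonal] at h
  have hMS : ∀ x ∈ M, Φ.symm x ∈ S := fun x hx => by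
    obtain ⟨k, -, h⟩ := (hMmem (Φ.symm x)).mp (by simpa using hx)
    rw [← h]
    exact k.2
  let E : Submodule ℂ Mᗮ := S.comap ((Φ.symm : H →ₗ[ℂ] Z) ∘ₗ Mᗮ.subtype)
  have hEmem : ∀ l : Mᗮ, l ∈ E ↔ Φ.symm (l : H) ∈ S := fun l => Iff.rfl
  have hE : IsClosed (E : Set Mᗮ) :=
    hS.preimage (Φ.symm.continuous.comp continuous_subtype_val)
  have : CompleteSpace E := hE.completeSpace_coe
  have hPE : ∀ z : Z, P (Φ z) ∈ E ↔ z ∈ S := fun z => by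
    have h1 := hMS _ (hsub (Φ z))
    rw [map_sub, ContinuousLinearEquiv.symm_apply_apply] at h1
    rw [hEmem]
    constructor
    · intro h2
      simpa using S.add_mem h1 h2
    · intro h2
      simpa using S.sub_mem h2 h1
  let q : S →ₗ[ℂ] E :=
    (P.toLinearMap ∘ₗ (Φ : Z →ₗ[ℂ] H) ∘ₗ S.subtype).codRestrict E fun z => (hPE z).mpr z.2
  have hq : ∀ z : S, (q z : Mᗮ) = P (Φ z) := fun z => rfl
  have hqsurj : Function.Surjective q := fun l => by
    refine ⟨⟨Φ.symm ((l : Mᗮ) : H), l.2⟩, Subtype.ext ?_⟩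
    rw [hq]
    simp [P]
  have hqker : K = LinearMap.ker q := by
    ext z
    rw [LinearMap.mem_ker, ← Subtype.coe_inj, hq, Submodule.coe_zero,
      Submodule.orthogonalProjectionOnto_eq_zero_iff, M.orthogonal_orthogonal, hMmem]
    constructor
    · exact fun h => ⟨z, h, rfl⟩
    · rintro ⟨k, hk, h⟩
      rwa [← Subtype.ext h]
  let Q : (S ⧸ K) ≃ₗ[ℂ] E :=
    (Submodule.quotEquivOfEq _ _ hqker).trans (q.quotKerEquivOfSurjective hqsurj)
  have hQ : ∀ z : S, Q (K.mkQ z) = q z := fun z => rfl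
  let j : E →ₗᵢ[ℂ] H := Mᗮ.subtypeₗᵢ.comp E.subtypeₗᵢ
  obtain ⟨U⟩ := exists_linearIsometryEquiv_ell2 (E := E) j g hg
    fun _ => hinf (Module.Finite.equiv Q.symm)
  refine ⟨M, Q.trans U.toLinearEquiv, E.subtypeₗᵢ.comp U.symm.toLinearIsometry, fun z => ?_,
    fun z u hz => ?_⟩
  · change ((U.symm (U (Q (K.mkQ z))) : E) : Mᗮ) = _
    rw [LinearIsometryEquiv.symm_apply_apply, hQ, hq]
  · rw [← hPE]
    exact hz ▸ (U.symm u).2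

theorem exists_pos_one_le_mul {x y : ℝ} (hx : 0 < x) (hy : 0 < y) :
    ∃ d : ℝ, 0 < d ∧ 1 ≤ d * x ∧ 1 ≤ d * y := by
  refine ⟨x⁻¹ + y⁻¹, by positivity, ?_, ?_⟩
  · rw [add_mul, inv_mul_cancel₀ hx.ne']
    exact le_add_of_nonneg_right (by positivity)
  · rw [add_mul, inv_mul_cancel₀ hy.ne']
    exact le_add_of_nonneg_left (by positivity)

theorem norm_symm_pos {X : Type*} [NormedAddCommGroup X] [NormedSpace ℂ X] (φ : X ≃L[ℂ] Ell2) :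
    0 < ‖(φ.symm : Ell2 →L[ℂ] X)‖ := by
  refine norm_pos_iff.mpr fun h => ?_
  have h1 : φ.symm (stdBasis 0) = 0 := congrArg (fun T : Ell2 →L[ℂ] X => T (stdBasis 0)) h
  have h2 := orthonormal_stdBasis.1 0
  rw [(map_eq_zero_iff _ φ.symm.injective).mp h1, norm_zero] at h2
  exact zero_ne_one h2

theorem nonempty_scaled_equiv {X : Type*} [NormedAddCommGroup X] [NormedSpace ℂ X]
    (φ : X ≃L[ℂ] Ell2) {a : ℝ} (ha : 0 < a) : ∃ φ' : X ≃L[ℂ] Ell2, ∀ x, φ' x = (a : ℂ) • φ x :=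
  ⟨φ.trans (ContinuousLinearEquiv.smulLeft
    (Units.mk0 (a : ℂ) (by exact_mod_cast ha.ne'))), fun _ => rfl⟩

/-- The compressions of the two coordinate embeddings to a closed subspace of `ℓ₂ ⊕ ℓ₂`. -/
theorem exists_coordinate_compressions (P : Submodule ℂ (WithLp 2 (Ell2 × Ell2)))
    [P.HasOrthogonalProjection] [CompleteSpace P] : ∃ J₁ J₂ : Ell2 →L[ℂ] P,
      J₁ ∘L adjoint J₁ + J₂ ∘L adjoint J₂ = 1 ∧
      ∀ x y, J₁ x + J₂ y = P.orthogonalProjectionOnto (WithLp.toLp 2 (x, y)) := by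
  let e := (WithLp.prodContinuousLinearEquiv 2 ℂ Ell2 Ell2).symm
  let J₁ : Ell2 →L[ℂ] P := P.orthogonalProjectionOnto ∘L (e : Ell2 × Ell2 →L[ℂ] _) ∘L
    ContinuousLinearMap.inl ℂ Ell2 Ell2
  let J₂ : Ell2 →L[ℂ] P := P.orthogonalProjectionOnto ∘L (e : Ell2 × Ell2 →L[ℂ] _) ∘L
    ContinuousLinearMap.inr ℂ Ell2 Ell2
  have h₁ : ∀ x, J₁ x = P.orthogonalProjectionOnto (WithLp.toLp 2 (x, 0)) := fun x => rfl
  have h₂ : ∀ y, J₂ y = P.orthogonalProjectionOnto (WithLp.toLp 2 (0, y)) := fun y => rfl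
  have hadd : ∀ x y, J₁ x + J₂ y = P.orthogonalProjectionOnto (WithLp.toLp 2 (x, y)) := by
    intro x y
    rw [h₁, h₂, ← map_add, ← WithLp.toLp_add, Prod.mk_add_mk, add_zero, zero_add]
  have ha₁ : ∀ l : P, adjoint J₁ l = (l : WithLp 2 (Ell2 × Ell2)).ofLp.1 := fun l => by
    refine ext_inner_left ℂ fun x => ?_
    rw [ContinuousLinearMap.adjoint_inner_right, h₁,
      Submodule.inner_orthogonalProjectionOnto_eq_of_mem_right, WithLp.prod_inner_apply]
    simp
  have ha₂ : ∀ l : P, adjoint J₂ l = (l : WithLp 2 (Ell2 × Ell2)).ofLp.2 := fun l => by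
    refine ext_inner_left ℂ fun x => ?_
    rw [ContinuousLinearMap.adjoint_inner_right, h₂,
      Submodule.inner_orthogonalProjectionOnto_eq_of_mem_right, WithLp.prod_inner_apply]
    simp
  refine ⟨J₁, J₂, ?_, hadd⟩
  ext1 l
  change J₁ (adjoint J₁ l) + J₂ (adjoint J₂ l) = l
  rw [ha₁, ha₂, hadd]
  exact P.orthogonalProjectionOnto_mem_subspace_eq_self l

theorem eq_zero_of_inner_stdBasis (x : WithLp 2 (Ell2 × Ell2))
    (h : ∀ m : ℕ ⊕ ℕ, inner ℂ x (Sum.elim (fun i => WithLp.toLp 2 (stdBasis i, 0))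
      (fun i => WithLp.toLp 2 (0, stdBasis i)) m) = 0) : x = 0 := by
  have h1 : ∀ z : Ell2, (∀ i, inner ℂ z (stdBasis i) = 0) → z = 0 := fun z hz => by
    ext i
    rw [← inner_stdBasis, inner_eq_zero_symm.mp (hz i)]
    rfl
  have hfst : x.ofLp.1 = 0 := h1 _ fun i => by
    simpa [WithLp.prod_inner_apply] using h (Sum.inl i)
  have hsnd : x.ofLp.2 = 0 := h1 _ fun i => by
    simpa [WithLp.prod_inner_apply] using h (Sum.inr i)
  exact WithLp.ofLp_injective 2 (Prod.ext hfst hsnd)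

variable {X Y : Type*} [NormedAddCommGroup X] [NormedSpace ℂ X] [OperatorSpace X]
  [NormedAddCommGroup Y] [NormedSpace ℂ Y] [OperatorSpace Y]

/-- Representatives of a class in `S ⧸ K` correspond exactly to the solutions of the lifting
equation, because such solutions lie in `S`; so the quotient norm is the infimum over lifts without
any loss. -/
theorem exists_liftNorm_model {φ : X ≃L[ℂ] Ell2} {ψ : Y ≃L[ℂ] Ell2} {a c : ℝ} (ha : 0 < a)
    (hc : 0 < c) {S : Submodule ℂ (X × Y)} (hS : IsClosed (S : Set (X × Y))) {K : Submodule ℂ S}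
    (hK : IsClosed (K : Set S)) (hinf : ¬ FiniteDimensional ℂ (S ⧸ K)) :
    ∃ (P : Submodule ℂ (WithLp 2 (Ell2 × Ell2))) (_ : CompleteSpace P) (J₁ J₂ : Ell2 →L[ℂ] P)
      (V : Ell2 →ₗᵢ[ℂ] P) (W : (S ⧸ K) ≃ₗ[ℂ] Ell2),
      J₁ ∘L adjoint J₁ + J₂ ∘L adjoint J₂ = 1 ∧
      ∀ n, LiftNorm V J₁ J₂ a c (transportedNorms φ n) (transportedNorms ψ n)
        fun v : Matrix (Fin n) (Fin n) Ell2 => quotientNorms (subspaceNorms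
          (directSumNorms (OperatorSpace.mnorm (E := X)) (OperatorSpace.mnorm (E := Y))) S) K n
          (v.map W.symm) := by
  obtain ⟨φ', hφ'⟩ := nonempty_scaled_equiv φ ha
  obtain ⟨ψ', hψ'⟩ := nonempty_scaled_equiv ψ hc
  let Φ : (X × Y) ≃L[ℂ] WithLp 2 (Ell2 × Ell2) :=
    (φ'.prodCongr ψ').trans (WithLp.prodContinuousLinearEquiv 2 ℂ Ell2 Ell2).symm
  have hΦ : ∀ z : X × Y, Φ z = WithLp.toLp 2 ((a : ℂ) • φ z.1, (c : ℂ) • ψ z.2) := fun z => by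
    rw [← hφ', ← hψ']
    rfl
  obtain ⟨M, W, V, hVW, hmem⟩ := exists_quotient_model _ eq_zero_of_inner_stdBasis Φ hS hK hinf
  obtain ⟨J₁, J₂, hJ, hJ'⟩ := exists_coordinate_compressions Mᗮ
  refine ⟨Mᗮ, inferInstance, J₁, J₂, V, W, hJ, fun n => ⟨fun v x y hxy => ?_, fun v r hr => ?_⟩⟩
  · have h1 : ∀ p q, Mᗮ.orthogonalProjectionOnto (Φ (φ.symm (x p q), ψ.symm (y p q)))
        = V (v p q) := fun p q => by
      rw [← hxy, ← map_smul, ← map_smul, hJ', hΦ]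
      simp
    let z : Matrix (Fin n) (Fin n) S := Matrix.of fun p q =>
      ⟨(φ.symm (x p q), ψ.symm (y p q)), hmem _ _ (h1 p q)⟩
    refine csInf_le ⟨0, ?_⟩ ⟨z, ?_, rfl⟩
    · rintro _ ⟨z, -, rfl⟩
      exact (mnorm_nonneg _).trans (le_max_left _ _)
    · ext1 p q
      refine W.injective (V.injective ?_)
      rw [Matrix.map_apply, hVW, Matrix.map_apply, LinearEquiv.apply_symm_apply]
      exact h1 p q
  · have hne : {r : ℝ | ∃ z : Matrix (Fin n) (Fin n) S, z.map K.mkQ = v.map W.symm ∧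
        subspaceNorms (directSumNorms (OperatorSpace.mnorm (E := X))
          (OperatorSpace.mnorm (E := Y))) S n z = r}.Nonempty := by
      choose z hz using fun p q => K.mkQ_surjective (W.symm (v p q))
      exact ⟨_, Matrix.of z, by ext1 p q; exact hz p q, rfl⟩
    obtain ⟨_, ⟨z, hz, rfl⟩, hlt⟩ := exists_lt_of_csInf_lt hne (lt_add_of_pos_right _ hr)
    refine ⟨z.map fun ξ => φ ξ.1.1, z.map fun ξ => ψ ξ.1.2, fun p q => ?_, ?_, ?_⟩
    · have h1 : K.mkQ (z p q) = W.symm (v p q) := congrFun (congrFun hz p) q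
      have h2 := hVW (z p q)
      rw [h1, LinearEquiv.apply_symm_apply, hΦ] at h2
      rw [h2, ← hJ', map_smul, map_smul]
      rfl
    · refine le_trans (le_of_eq ?_) ((le_max_left _ _).trans hlt.le)
      refine congrArg (OperatorSpace.mnorm n) ?_
      ext1 p q
      exact φ.symm_apply_apply _
    · refine le_trans (le_of_eq ?_) ((le_max_right _ _).trans hlt.le)
      refine congrArg (OperatorSpace.mnorm n) ?_
      ext1 p q
      exact ψ.symm_apply_apply _

end HilbertModel

/-- Let `X` and `Y` be homogeneous operator spaces with identifications `φ : X → ℓ₂`, `ψ : Y → ℓ₂`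
(so `X` and `Y` are separable, infinite dimensional and Hilbertian), and let `F` be an infinite
dimensional homogeneous space in `QS(X ⊕ Y)`. Then `F` is completely isomorphic to
`s X ∩ t Y ∩ K_{u_c, u_r}(X, Y)` with a constant `C` that depends only on the homogeneity and
Hilbertian constants (and on `κ`, where `κ = 1` for `F` literally in `QS(X ⊕_∞ Y)`). -/
theorem theorem2p9 (hX hY hF μX μY κ : ℝ) :
    ∃ C : ℝ, ∀ (X Y F : Type*)
      [NormedAddCommGroup X] [NormedSpace ℂ X] [OperatorSpace X]
      [NormedAddCommGroup Y] [NormedSpace ℂ Y] [OperatorSpace Y]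
      [NormedAddCommGroup F] [NormedSpace ℂ F] [OperatorSpace F]
      (φ : X ≃L[ℂ] Ell2) (ψ : Y ≃L[ℂ] Ell2),
      ‖(φ : X →L[ℂ] Ell2)‖ * ‖(φ.symm : Ell2 →L[ℂ] X)‖ ≤ μX →
      ‖(ψ : Y →L[ℂ] Ell2)‖ * ‖(ψ.symm : Ell2 →L[ℂ] Y)‖ ≤ μY →
      IsHomogeneous hX X → IsHomogeneous hY Y → IsHomogeneous hF F →
      ¬ FiniteDimensional ℂ F → MemQSDirectSum κ F X Y →
      ∃ s ∈ Set.Icc (0 : ℝ) 1, ∃ t ∈ Set.Icc (0 : ℝ) 1, ∃ uc ur : ℕ → ℝ,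
        (∀ j, 0 < uc j) ∧ (∀ j, 0 < ur j) ∧ Summable (fun j => min (uc j) (ur j)) ∧
        CompletelyIsomorphic C (OperatorSpace.mnorm (E := F)) (interNorms φ ψ s t uc ur) := by
  refine ⟨30 * (κ ^ 2 * |hF| * (μX + μY)) ^ 2 * max (|hX| * μX) (|hY| * μY) ^ 2 * κ, ?_⟩
  intro X Y F _ _ _ _ _ _ _ _ _ φ ψ hφ hψ hXX hYY hFF hinf hQS
  obtain ⟨S, hS, K, hK, T, A, B, hA0, hB0, hAB, hA, hB⟩ := hQS
  -- Scaling both sides by the same `d` makes `a` and `c` at least 1, which puts the coefficients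
  -- `s`, `t` in `[0, 1]`, while their proportion to the norms of the inverses keeps the constant
  -- free of `d`.
  obtain ⟨d, hd, ha, hc⟩ := exists_pos_one_le_mul (norm_symm_pos φ) (norm_symm_pos ψ)
  obtain ⟨P, _, J₁, J₂, V, W, hJ, hl⟩ := exists_liftNorm_model (φ := φ) (ψ := ψ)
    (one_pos.trans_le ha) (one_pos.trans_le hc) hS hK
    fun _ => hinf (Module.Finite.equiv T.symm)
  refine exists_completelyIsomorphic_interNorms hJ V hd ha hc hφ hψ hXX hYY hFF
    (N := fun n v => quotientNorms _ K n (v.map W.symm)) hl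
    ⟨T.trans W, A, B, hA0, hB0, hAB, fun n x => ?_, fun n y => ?_⟩
  · have h : ((x.map (T.trans W)).map W.symm) = x.map T := by
      ext1 p q
      simp
    dsimp only
    rw [h]
    exact hA n x
  · exact hB n (y.map W.symm)
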